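/- Let $G$ be a connected semisimple linear algebraic group over $\mathbb{C}$, with centre $Z(G)$. Fix a maximal torus $T$ and a system of positive roots, with simple roots $\alpha_1,\dots,\alpha_d$. An irreducible rational representation $W$ of $G$ with highest weight $\lambda$ has highest weight parameters $(\lambda_1,\dots,\lambda_d)\in\mathbb{Z}_{\ge 0}^d$, $\lambda_j=\langle\lambda,\alpha_j^\vee\rangle$; write $W_\lambda$ for $W$. Let $\Gamma$ be a subgroup of $G$ (not necessarily discrete). For an $r\times s$ matrix $A$ over $\mathbb{C}[\Gamma]$ put $$\operatorname{rk}_{W}A=r-\frac{\dim_{\mathbb{C}}\big(W^r/AW^s\big)}{\dim_{\mathbb{C}}W}.$$ For a character $\chi$ of $Z(G)$, let $\ell^2(\Gamma)_\chi$ be the Hilbert space completion of $\mathbb{C}[\Gamma]$ (modulo vectors of norm zero) for the inner product $\langle g,h\rangle=\operatorname{tr}_\chi(h^{-1}g)$, where $\operatorname{tr}_\chi(g)=\chi(g)$ if $g\in\Gamma\cap Z(G)$ and $\operatorname{tr}_\chi(g)=0$ for the other $g\in\Gamma$. The twisted von Neumann rank $\operatorname{rk}_\Gamma^\chi A$ is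 $\sum_{i=1}^r\langle Pe_i,e_i\rangle$, where $P$ is the orthogonal projection onto the closure of the image of $A\colon\ell^2(\Gamma)_\chi^s\to\ell^2(\Gamma)_\chi^r$ and $e_i$ is the vector with the class of $1$ in the $i$-th coordinate and $0$ elsewhere. We say that $\Gamma$ satisfies the rank-function conjecture if for every character $\chi$ of $Z(G)$ and every matrix $A$ over $\mathbb{C}[\Gamma]$ we have $\operatorname{rk}_{W_\lambda}A\to\operatorname{rk}^\chi_\Gamma A$ as $\min_j\lambda_j\to\infty$, where $W_\lambda$ runs over the irreducible rational representations of $G$ on which $Z(G)$ acts through $\chi$. We say that $\Gamma$ satisfies the quantitative rank-function conjecture if for every such $\chi$ and $A$ there is a constant $C$ such that $|\operatorname{rk}_{W_\lambda}A-\operatorname{rk}^\chi_\Gamma A|\le C/\min_j\lambda_j$ for all these $W_\lambda$ with $\min_j\lambda_j>0$. Let $b_i^{(2)}(\Gamma)=\dim_{\mathcal N(\Gamma)}H_i(\Gamma,\mathcal N(\Gamma))\in[0,\infty]$ be the $i$-th $\ell^2$-Betti number, where $\mathcal N(\Gamma)$ is the group von Neumann algebra and $\dim_{\mathcal N(\Gamma)}$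 of a module is the supremum of the von Neumann dimensions of its finitely generated projective submodules. **Proposition.** Let $n\ge 0$, and assume that $\Gamma$ is of type $FP_{n+1}$ over $\mathbb{C}$ and that $\Gamma\cap Z(G)=\{1\}$. Then $b_i^{(2)}(\Gamma)<\infty$ for $0\le i\le n$, and $H_i(\Gamma,W)$ and $H^i(\Gamma,W)$ are finite dimensional for $0\le i\le n$ and every finite dimensional representation $W$ of $G$. Moreover: 1. If $\Gamma$ satisfies the rank-function conjecture, then for every sequence $(W_k)_k$ of irreducible rational representations of $G$ whose highest weight parameters $\lambda_j(k)$ satisfy $\min_j\lambda_j(k)\to\infty$, and for every $0\le i\le n$, $$\lim_{k\to\infty}\frac{\dim_{\mathbb{C}}H_i(\Gamma,W_k)}{\dim_{\mathbb{C}}W_k}=\lim_{k\to\infty}\frac{\dim_{\mathbb{C}}H^i(\Gamma,W_k)}{\dim_{\mathbb{C}}W_k}=b_i^{(2)}(\Gamma).$$ 2. If $\Gamma$ satisfies the quantitative rank-function conjecture, then for every $0\le i\le n$ there is a constant $C$ such that for every irreducible rational representation $W$ of $G$ with highest weight parameters $(\lambda_1,\dots,\lambda_d)$ and $\min_j\lambda_j>0$,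 $$\left|\frac{\dim_{\mathbb{C}}H_i(\Gamma,W)}{\dim_{\mathbb{C}}W}-b_i^{(2)}(\Gamma)\right|\le\frac{C}{\min_j\lambda_j}\quad\text{and}\quad\left|\frac{\dim_{\mathbb{C}}H^i(\Gamma,W)}{\dim_{\mathbb{C}}W}-b_i^{(2)}(\Gamma)\right|\le\frac{C}{\min_j\lambda_j}.$$ -/

import Mathlib

open scoped ENNReal Topology

noncomputable section

namespace L2Approx

/-! ### Linear algebraic groups over `ℂ` -/

section Algebraic

variable {m : ℕ}

/-- Value of a polynomial in the matrix entries at `g ∈ GL_m(ℂ)`. -/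
def evalGL (p : MvPolynomial (Fin m × Fin m) ℂ) (g : GL (Fin m) ℂ) : ℂ :=
  MvPolynomial.eval (fun ij => (g : Matrix (Fin m) (Fin m) ℂ) ij.1 ij.2) p

/-- The Zariski topology on `GL_m(ℂ)`, pulled back from the prime spectrum of the polynomial ring
in the matrix entries; see `isClosed_zariski_iff`. -/
@[reducible] def zariski (m : ℕ) : TopologicalSpace (GL (Fin m) ℂ) :=
  TopologicalSpace.induced
    (fun g => MvPolynomial.pointToPoint (k := ℂ)
      (fun ij : Fin m × Fin m => (g : Matrix (Fin m) (Fin m) ℂ) ij.1 ij.2))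
    inferInstance

/-- The Zariski closed sets are the zero loci of sets of polynomials in the matrix entries. -/
theorem isClosed_zariski_iff (S : Set (GL (Fin m) ℂ)) :
    IsClosed[zariski m] S ↔
      ∃ P : Set (MvPolynomial (Fin m × Fin m) ℂ), S = {g | ∀ p ∈ P, evalGL p g = 0} := by
  have key : ∀ (p : MvPolynomial (Fin m × Fin m) ℂ) (g : GL (Fin m) ℂ),
      p ∈ (MvPolynomial.pointToPoint (k := ℂ)
        (fun ij : Fin m × Fin m => (g : Matrix (Fin m) (Fin m) ℂ) ij.1 ij.2)).asIdeal ↔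
        evalGL p g = 0 := by
    intro p g
    change p ∈ MvPolynomial.vanishingIdeal ℂ {_} ↔ _
    rw [MvPolynomial.mem_vanishingIdeal_singleton_iff]
    rw [MvPolynomial.aeval_eq_eval, evalGL]
  constructor
  · intro h
    obtain ⟨t, ht, rfl⟩ := isClosed_induced_iff.1 h
    obtain ⟨P, rfl⟩ := (PrimeSpectrum.isClosed_iff_zeroLocus t).1 ht
    refine ⟨P, ?_⟩
    ext g
    simp only [Set.mem_preimage, PrimeSpectrum.mem_zeroLocus, Set.mem_ofPred_eq]
    exact forall₂_congr fun p _ => key p g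
  · rintro ⟨P, rfl⟩
    refine isClosed_induced_iff.2 ⟨PrimeSpectrum.zeroLocus P,
      (PrimeSpectrum.isClosed_iff_zeroLocus _).2 ⟨P, rfl⟩, ?_⟩
    ext g
    simp only [Set.mem_preimage, PrimeSpectrum.mem_zeroLocus, Set.mem_ofPred_eq]
    exact forall₂_congr fun p _ => key p g

/-- `S` is Zariski closed and Zariski connected. -/
def IsClosedConnected (S : Set (GL (Fin m) ℂ)) : Prop :=
  IsClosed[zariski m] S ∧ @IsConnected _ (zariski m) S

/-- A semisimple linear algebraic group over `ℂ`, embedded in `GL_m(ℂ)`: a Zariski closed connected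
subgroup in which every Zariski closed connected solvable normal subgroup is trivial. -/
structure IsSemisimpleAlgebraicGroup (G : Subgroup (GL (Fin m) ℂ)) : Prop where
  closedConnected : IsClosedConnected (G : Set (GL (Fin m) ℂ))
  radical_trivial : ∀ N : Subgroup G, N.Normal → Group.IsSolvable N →
    IsClosedConnected (((↑) : G → GL (Fin m) ℂ) '' (N : Set G)) → N = ⊥

/-- Regular functions on a subset `X` of `GL_m(ℂ)` (given with its inclusion `ι`): restrictions of
elements of `ℂ[x_{ij}, det⁻¹]`. -/
def IsRegularFun {X : Type*} (ι : X → GL (Fin m) ℂ) (f : X → ℂ) : Prop :=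
  ∃ (p : MvPolynomial (Fin m × Fin m) ℂ) (k : ℕ), ∀ x : X,
    f x = evalGL p (ι x) * ((ι x : Matrix (Fin m) (Fin m) ℂ).det⁻¹) ^ k

/-- A (finite dimensional) representation of `G` is rational if its matrix coefficients are
regular functions. -/
def IsRational {G : Subgroup (GL (Fin m) ℂ)} {W : Type*} [AddCommGroup W] [Module ℂ W]
    (ρ : Representation ℂ G W) : Prop :=
  ∀ (φ : Module.Dual ℂ W) (w : W), IsRegularFun (fun g : G => (g : GL (Fin m) ℂ))
    (fun g => φ (ρ g w))

variable (G : Subgroup (GL (Fin m) ℂ))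

/-- A torus in `G`: a Zariski closed connected subgroup that is diagonalizable. -/
def IsTorus (T : Subgroup G) : Prop :=
  IsClosedConnected (((↑) : G → GL (Fin m) ℂ) '' (T : Set G)) ∧
    ∃ P : GL (Fin m) ℂ, ∀ t ∈ T,
      ((P * (t : GL (Fin m) ℂ) * P⁻¹ : GL (Fin m) ℂ) : Matrix (Fin m) (Fin m) ℂ).IsDiag

/-- A maximal torus of `G`. -/
def IsMaximalTorus (T : Subgroup G) : Prop :=
  IsTorus G T ∧ ∀ T' : Subgroup G, IsTorus G T' → T ≤ T' → T' = T

/-- The Lie algebra of `G`, as the tangent space at the identity: the matrices along which the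
derivative at `1` of every polynomial vanishing on `G` is zero. -/
def lieAlg : Set (Matrix (Fin m) (Fin m) ℂ) :=
  {X | ∀ f : MvPolynomial (Fin m × Fin m) ℂ, (∀ g ∈ G, evalGL f g = 0) →
    ∑ ij : Fin m × Fin m, X ij.1 ij.2 * evalGL (MvPolynomial.pderiv ij f) 1 = 0}

variable {G}

/-- The characters of `T` (written multiplicatively) that are morphisms of algebraic groups; they
form the character group `X(T)`. -/
def IsAlgChar {T : Subgroup G} (α : T →* ℂˣ) : Prop :=
  IsRegularFun (fun t : T => ((t : G) : GL (Fin m) ℂ)) (fun t => (α t : ℂ))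

/-- Cocharacters of `T`: homomorphisms `ℂ^× → T` whose matrix entries are Laurent polynomials. -/
def IsAlgCochar {T : Subgroup G} (γ : ℂˣ →* T) : Prop :=
  ∀ i j : Fin m, ∃ (p : Polynomial ℂ) (k : ℕ), ∀ z : ℂˣ,
    (((γ z : G) : GL (Fin m) ℂ) : Matrix (Fin m) (Fin m) ℂ) i j = p.eval (z : ℂ) * ((z : ℂ)⁻¹) ^ k

/-- The roots of `G` with respect to `T`: nontrivial characters occurring in the adjoint action of
`T` on the Lie algebra of `G`. -/
def roots (T : Subgroup G) : Set (T →* ℂˣ) :=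
  {α | IsAlgChar α ∧ α ≠ 1 ∧ ∃ X ∈ lieAlg G, X ≠ 0 ∧ ∀ t : T,
    (((t : G) : GL (Fin m) ℂ) : Matrix (Fin m) (Fin m) ℂ) * X *
      ((((t : G) : GL (Fin m) ℂ)⁻¹ : GL (Fin m) ℂ) : Matrix (Fin m) (Fin m) ℂ) = (α t : ℂ) • X}

/-- A system of positive roots: a set of roots that contains exactly one of each pair of opposite
roots and is closed under those sums (here: products) which are roots. -/
structure IsPositiveSystem {T : Subgroup G} (P : Set (T →* ℂˣ)) : Prop where
  subset : P ⊆ roots T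
  xor_inv : ∀ α ∈ roots T, Xor (α ∈ P) (α⁻¹ ∈ P)
  closed : ∀ α ∈ P, ∀ β ∈ P, α * β ∈ roots T → α * β ∈ P

/-- `γ` is the coroot of the root `α`: `⟨α, γ⟩ = 2`, and the reflection `β ↦ β - ⟨β, γ⟩ α` maps
roots to roots. -/
structure IsCoroot {T : Subgroup G} (α : T →* ℂˣ) (γ : ℂˣ →* T) : Prop where
  alg : IsAlgCochar γ
  pairing_self : ∀ z : ℂˣ, α (γ z) = z ^ (2 : ℤ)
  reflection : ∀ β ∈ roots T, ∃ k : ℤ, (∀ z : ℂˣ, β (γ z) = z ^ k) ∧ β * α ^ (-k) ∈ roots T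

/-- The choices that parametrize the irreducible representations of `G` by tuples of natural
numbers: a maximal torus, a system of positive roots, and an enumeration of the simple roots
(the indecomposable positive roots), listed with their coroots. -/
structure RootFrame (G : Subgroup (GL (Fin m) ℂ)) where
  T : Subgroup G
  isMaximalTorus : IsMaximalTorus G T
  pos : Set (T →* ℂˣ)
  isPositiveSystem : IsPositiveSystem pos
  rank : ℕ
  simpleRoot : Fin rank → (T →* ℂˣ)
  simpleRoot_injective : Function.Injective simpleRoot
  range_simpleRoot :
    Set.range simpleRoot = {α | α ∈ pos ∧ ¬ ∃ β ∈ pos, ∃ γ ∈ pos, α = β * γ}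
  coroot : Fin rank → (ℂˣ →* T)
  isCoroot : ∀ i, IsCoroot (simpleRoot i) (coroot i)

section Weights

variable (R : RootFrame G) {W : Type*} [AddCommGroup W] [Module ℂ W] (ρ : Representation ℂ G W)

/-- `μ` is a weight of the representation. -/
def IsWeight (μ : R.T →* ℂˣ) : Prop :=
  ∃ w : W, w ≠ 0 ∧ ∀ t : R.T, ρ (t : G) w = (μ t : ℂ) • w

/-- `μ` is the highest weight: it is a weight, and every weight is obtained from it by subtracting
a sum of positive roots. -/
def IsHighestWeight (μ : R.T →* ℂˣ) : Prop :=
  IsWeight R ρ μ ∧ ∀ ν : R.T →* ℂˣ, IsWeight R ρ ν → μ * ν⁻¹ ∈ Submonoid.closure R.pos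

/-- The highest weight parameters of `ρ` are `l = (λ₁, …, λₙ)`, where `λᵢ` is the pairing of the
highest weight with the `i`-th simple coroot. -/
def HasHighestWeight (l : Fin R.rank → ℕ) : Prop :=
  ∃ μ : R.T →* ℂˣ, IsHighestWeight R ρ μ ∧ ∀ i, ∀ z : ℂˣ, μ (R.coroot i z) = z ^ (l i)

/-- `ρ` is a finite dimensional irreducible rational representation with highest weight
parameters `l`. -/
structure IsIrrepWithHighestWeight (l : Fin R.rank → ℕ) : Prop where
  finiteDimensional : FiniteDimensional ℂ W
  rational : IsRational ρ
  irreducible : ρ.IsIrreducible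
  highestWeight : HasHighestWeight R ρ l

/-- The center of `G` acts on `W` through the character `χ`. -/
def HasCentralChar (χ : Subgroup.center G →* ℂˣ) : Prop :=
  ∀ (z : Subgroup.center G) (w : W), ρ (z : G) w = (χ z : ℂ) • w

end Weights

end Algebraic

/-! ### Rank functions on matrices over the group algebra -/

section Ranks

/-- The map `V^s → V^r` given by left multiplication with an `r × s` matrix over `ℂ[Γ]`. -/
def matAct {Γ : Type*} [Group Γ] {V : Type*} [AddCommGroup V] [Module ℂ V]
    (ρ : Representation ℂ Γ V) {r s : ℕ} (A : Matrix (Fin r) (Fin s) (MonoidAlgebra ℂ Γ)) :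
    (Fin s → V) →ₗ[ℂ] (Fin r → V) :=
  LinearMap.pi fun i => ∑ j, ρ.asAlgebraHom (A i j) ∘ₗ LinearMap.proj j

/-- The rank function `rk_W A = r - dim (M ⊗_{ℂ[Γ]} W) / dim W` of a finite dimensional
representation `W` of `Γ`, where `M = ℂ[Γ]^r / A ℂ[Γ]^s`, so that `M ⊗_{ℂ[Γ]} W = W^r / A W^s`. -/
def repRank {Γ : Type*} [Group Γ] {W : Type*} [AddCommGroup W] [Module ℂ W]
    (ρ : Representation ℂ Γ W) {r s : ℕ} (A : Matrix (Fin r) (Fin s) (MonoidAlgebra ℂ Γ)) : ℝ :=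
  r - (Module.finrank ℂ ((Fin r → W) ⧸ LinearMap.range (matAct ρ A)) : ℝ) / Module.finrank ℂ W

/-- The Hilbert space `ℓ²(Γ)`. -/
abbrev L2 (Γ : Type*) : Type _ := lp (fun _ : Γ => ℂ) 2

theorem memlp_comp_perm {Γ : Type*} (σ : Equiv.Perm Γ) (f : L2 Γ) :
    Memℓp (fun h => (f : Γ → ℂ) (σ h)) 2 := by
  have h2 : 0 < (2 : ℝ≥0∞).toReal := by norm_num
  rw [memℓp_gen_iff h2]
  exact (σ.summable_iff (f := fun h => ‖(f : Γ → ℂ) h‖ ^ (2 : ℝ≥0∞).toReal)).2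
    ((memℓp_gen_iff h2).1 (lp.memℓp f))

/-- The isometry `f ↦ f ∘ σ` of `ℓ²(Γ)` for a permutation `σ` of `Γ`. -/
def permL2 {Γ : Type*} (σ : Equiv.Perm Γ) : L2 Γ →ₗᵢ[ℂ] L2 Γ where
  toFun f := ⟨fun h => (f : Γ → ℂ) (σ h), memlp_comp_perm σ f⟩
  map_add' _ _ := rfl
  map_smul' _ _ := rfl
  norm_map' f := by
    have h2 : 0 < (2 : ℝ≥0∞).toReal := by norm_num
    rw [lp.norm_eq_tsum_rpow h2, lp.norm_eq_tsum_rpow h2]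
    congr 1
    exact σ.tsum_eq (fun h => ‖(f : Γ → ℂ) h‖ ^ (2 : ℝ≥0∞).toReal)

@[simp]
theorem permL2_apply {Γ : Type*} (σ : Equiv.Perm Γ) (f : L2 Γ) (h : Γ) :
    (permL2 σ f : Γ → ℂ) h = (f : Γ → ℂ) (σ h) := rfl

variable {Γ : Type*} [Group Γ]

/-- Left translation by `g` on `ℓ²(Γ)`, mapping the basis vector `δ_h` to `δ_{gh}`. -/
def leftTranslation (g : Γ) : L2 Γ →L[ℂ] L2 Γ :=
  (permL2 (Equiv.mulLeft g⁻¹)).toContinuousLinearMap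

/-- Right translation by `g` on `ℓ²(Γ)`, mapping the basis vector `δ_h` to `δ_{hg⁻¹}`. -/
def rightTranslation (g : Γ) : L2 Γ →L[ℂ] L2 Γ :=
  (permL2 (Equiv.mulRight g)).toContinuousLinearMap

theorem leftTranslation_apply (g : Γ) (f : L2 Γ) (h : Γ) :
    (leftTranslation g f : Γ → ℂ) h = (f : Γ → ℂ) (g⁻¹ * h) := rfl

theorem rightTranslation_apply (g : Γ) (f : L2 Γ) (h : Γ) :
    (rightTranslation g f : Γ → ℂ) h = (f : Γ → ℂ) (h * g) := rfl

variable (Γ) in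
/-- The left regular representation of `Γ` on `ℓ²(Γ)`. -/
def regularRep : Representation ℂ Γ (L2 Γ) where
  toFun g := (leftTranslation g : L2 Γ →ₗ[ℂ] L2 Γ)
  map_one' := by
    ext f h
    simp [leftTranslation_apply]
  map_mul' g g' := by
    ext f h
    simp [leftTranslation_apply, mul_assoc]

/-- The twisted `ℓ²`-space `ℓ²(Γ)_χ` for a character `χ` of a finite central subgroup `Z`. The
completion of `ℂ[Γ]` (modulo the vectors of norm zero) for `⟨g, h⟩ = tr_χ(h⁻¹ g)`, where `tr_χ` is
`χ` on `Z` and `0` off `Z`, is realized isometrically and `Γ`-equivariantly on the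
`f ∈ ℓ²(Γ)` with `f(zg) = χ(z)⁻¹ f(g)`; the class of `1 ∈ ℂ[Γ]` corresponds to `twistedOne`. -/
def twistedL2 (Z : Subgroup Γ) (χ : Z →* ℂˣ) : Submodule ℂ (L2 Γ) where
  carrier := {f | ∀ (z : Z) (g : Γ), (f : Γ → ℂ) (z * g) = ((χ z)⁻¹ : ℂˣ) * (f : Γ → ℂ) g}
  add_mem' {a b} ha hb z g := by
    simp only [lp.coeFn_add, Pi.add_apply, ha z g, hb z g, mul_add]
  zero_mem' z g := by simp
  smul_mem' c a ha z g := by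
    simp only [lp.coeFn_smul, Pi.smul_apply, ha z g, smul_eq_mul]
    ring

open Classical in
/-- The cyclic unit vector `|Z|^{-1/2} ∑_{z ∈ Z} χ(z)⁻¹ δ_z` of `ℓ²(Γ)_χ`, with
`⟨g · twistedOne, twistedOne⟩ = tr_χ(g)`. -/
def twistedOne (Z : Subgroup Γ) (χ : Z →* ℂˣ) : L2 Γ :=
  ((Real.sqrt (Nat.card Z) : ℂ)⁻¹) •
    ∑ᶠ z : Z, (((χ z)⁻¹ : ℂˣ) : ℂ) • lp.single 2 (z : Γ) (1 : ℂ)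

/-- The closure in `ℓ²(Γ)^r` of the image of `(ℓ²(Γ)_χ)^s` under left multiplication with the
matrix `A`; it is contained in `(ℓ²(Γ)_χ)^r`. -/
def twistedImage (Z : Subgroup Γ) (χ : Z →* ℂˣ) {r s : ℕ}
    (A : Matrix (Fin r) (Fin s) (MonoidAlgebra ℂ Γ)) :
    Submodule ℂ (PiLp 2 fun _ : Fin r => L2 Γ) :=
  (((Submodule.pi Set.univ fun _ : Fin s => twistedL2 Z χ).map (matAct (regularRep Γ) A)).map
    (WithLp.linearEquiv 2 ℂ (Fin r → L2 Γ)).symm.toLinearMap).topologicalClosure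

instance (Z : Subgroup Γ) (χ : Z →* ℂˣ) {r s : ℕ}
    (A : Matrix (Fin r) (Fin s) (MonoidAlgebra ℂ Γ)) : CompleteSpace (twistedImage Z χ A) :=
  (Submodule.isClosed_topologicalClosure _).completeSpace_coe

/-- The twisted von Neumann rank `rk_Γ^χ A`: the twisted von Neumann dimension
`∑ᵢ ⟨P eᵢ, eᵢ⟩` of the closure of the image of `A : (ℓ²(Γ)_χ)^s → (ℓ²(Γ)_χ)^r`, where `P` is the
orthogonal projection onto it and `eᵢ` has the cyclic vector in the `i`-th coordinate and zeros
elsewhere. -/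
def twistedVNRank (Z : Subgroup Γ) (χ : Z →* ℂˣ) {r s : ℕ}
    (A : Matrix (Fin r) (Fin s) (MonoidAlgebra ℂ Γ)) : ℝ :=
  ∑ i : Fin r, RCLike.re (inner ℂ
    ((twistedImage Z χ A).starProjection (WithLp.toLp 2 (Pi.single i (twistedOne Z χ))))
    (WithLp.toLp 2 (Pi.single i (twistedOne Z χ)) : PiLp 2 fun _ : Fin r => L2 Γ))

end Ranks

/-! ### `ℓ²`-Betti numbers -/

section Betti

variable (Γ : Type*) [Group Γ]

/-- The group von Neumann algebra `N(Γ)`: the bounded operators on `ℓ²(Γ)` that commute with right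
translations. It is the von Neumann algebra generated by the left translations. -/
def groupVN : Subalgebra ℂ (L2 Γ →L[ℂ] L2 Γ) :=
  Subalgebra.centralizer ℂ (Set.range rightTranslation)

/-- The ring underlying `N(Γ)`. -/
def VN : Type _ := groupVN Γ

instance : Ring (VN Γ) := inferInstanceAs (Ring (groupVN Γ))

instance : Algebra ℂ (VN Γ) := inferInstanceAs (Algebra ℂ (groupVN Γ))

variable {Γ}

theorem leftTranslation_mem (g : Γ) : leftTranslation g ∈ groupVN Γ := by
  rw [groupVN, Subalgebra.mem_centralizer_iff]
  rintro _ ⟨h, rfl⟩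
  ext f x
  simp [leftTranslation_apply, rightTranslation_apply, mul_assoc]

/-- A group element as an element of `N(Γ)`. -/
def toVN (g : Γ) : VN Γ := ⟨leftTranslation g, leftTranslation_mem g⟩

open Classical in
/-- The von Neumann trace `tr(a) = ⟨a δ₁, δ₁⟩`, which is the coordinate of `a δ₁` at `1`. -/
def vnTrace (a : VN Γ) : ℂ :=
  (a.1 (lp.single 2 (1 : Γ) (1 : ℂ)) : Γ → ℂ) 1

/-- The von Neumann dimension of an arbitrary left `N(Γ)`-module `M`: the supremum of the
dimensions of the finitely generated projective submodules of `M`. These are the images of the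
injective homomorphisms into `M` from the modules `N(Γ)^k e` with `e` an idempotent matrix, and
`dim N(Γ)^k e` is the trace of `e`. -/
def vnDim (M : Type*) [AddCommGroup M] [Module (VN Γ) M] : ℝ≥0∞ :=
  ⨆ (k : ℕ) (e : Matrix (Fin k) (Fin k) (VN Γ)) (_ : e * e = e)
    (f : LinearMap.range (Matrix.toLinearMapRight' e) →ₗ[VN Γ] M)
    (_ : Function.Injective f), ENNReal.ofReal (∑ i, vnTrace (e i i)).re

/-- The degree `i` term `C_i` of the complex `C_• = N(Γ) ⊗_{ℂ[Γ]} B_•`, where `B_•` is the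
(inhomogeneous) bar resolution of `ℂ` over `ℂ[Γ]`: the free left `N(Γ)`-module on `Γ^i`. -/
def VNChains (Γ : Type*) [Group Γ] (i : ℕ) : Type _ := (Fin i → Γ) →₀ VN Γ

instance (i : ℕ) : AddCommGroup (VNChains Γ i) :=
  inferInstanceAs (AddCommGroup ((Fin i → Γ) →₀ VN Γ))

instance (i : ℕ) : Module (VN Γ) (VNChains Γ i) :=
  inferInstanceAs (Module (VN Γ) ((Fin i → Γ) →₀ VN Γ))

/-- The element `a [g₁ | … | gᵢ]` of `C_i`. -/
def vnSingle {i : ℕ} (g : Fin i → Γ) (a : VN Γ) : VNChains Γ i := Finsupp.single g a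

/-- The differential `C_{i+1} → C_i`, which maps `[g₀ | … | gᵢ]` to
`g₀ [g₁ | … | gᵢ] + ∑_{j < i} (-1)^{j+1} [g₀ | … | gⱼ gⱼ₊₁ | … | gᵢ] + (-1)^{i+1} [g₀ | … | gᵢ₋₁]`. -/
def vnDiff (Γ : Type*) [Group Γ] (i : ℕ) : VNChains Γ (i + 1) →ₗ[VN Γ] VNChains Γ i :=
  Finsupp.linearCombination (VN Γ) fun g : Fin (i + 1) → Γ =>
    (vnSingle (fun j => g j.succ) (toVN (g 0)) +
      ∑ j : Fin (i + 1), vnSingle (Fin.contractNth j (· * ·) g) ((-1) ^ ((j : ℕ) + 1)) :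
        VNChains Γ i)

/-- The cycles of the complex `C_•` in degree `i`. -/
def vnCycles (Γ : Type*) [Group Γ] : (i : ℕ) → Submodule (VN Γ) (VNChains Γ i)
  | 0 => ⊤
  | i + 1 => LinearMap.ker (vnDiff Γ i)

/-- The `ℓ²`-homology `H_i(Γ, N(Γ))`, as an `N(Γ)`-module. -/
abbrev l2Homology (Γ : Type*) [Group Γ] (i : ℕ) : Type _ :=
  vnCycles Γ i ⧸ (LinearMap.range (vnDiff Γ i)).submoduleOf (vnCycles Γ i)

/-- The `i`-th `ℓ²`-Betti number `dim_{N(Γ)} H_i(Γ, N(Γ)) ∈ [0, ∞]`. -/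
def l2Betti (Γ : Type*) [Group Γ] (i : ℕ) : ℝ≥0∞ := vnDim (Γ := Γ) (l2Homology Γ i)

/-- `Γ` is of type `FP_n` over `ℂ`: the trivial module `ℂ` has a projective resolution over `ℂ[Γ]`
whose terms in degrees `0, …, n` are finitely generated. -/
def IsTypeFP (Γ : Type) [Group Γ] (n : ℕ) : Prop :=
  ∃ P : CategoryTheory.ProjectiveResolution (Rep.trivial ℂ Γ ℂ),
    ∀ i ≤ n, Module.Finite (MonoidAlgebra ℂ Γ) (P.complex.X i).ρ.asModule

end Betti

/-! ### Approximation of the twisted von Neumann rank -/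

section Conjectures

variable {m : ℕ} {G : Subgroup (GL (Fin m) ℂ)}

/-- The restriction to `Γ ∩ Z(G)` of a character of `Z(G)`. -/
def restrictChar (Γ : Subgroup G) (χ : Subgroup.center G →* ℂˣ) :
    (Subgroup.center G).subgroupOf Γ →* ℂˣ :=
  χ.comp (Γ.subtype.subgroupComap (Subgroup.center G))

/-- `Γ` satisfies the (qualitative) rank-function conjecture: for every character `χ` of `Z(G)`,
`lim_{min λᵢ → ∞} rk_{W_λ} = rk_Γ^χ` pointwise on matrices over `ℂ[Γ]`, where `W_λ` runs over the
irreducible representations of `G` with central character `χ`. -/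
def SatisfiesRankConjecture (R : RootFrame G) (Γ : Subgroup G) : Prop :=
  ∀ (χ : Subgroup.center G →* ℂˣ) (r s : ℕ) (A : Matrix (Fin r) (Fin s) (MonoidAlgebra ℂ Γ)),
    ∀ ε > (0 : ℝ), ∃ N : ℕ,
      ∀ (W : Type) [AddCommGroup W] [Module ℂ W] (ρ : Representation ℂ G W)
        (l : Fin R.rank → ℕ), IsIrrepWithHighestWeight R ρ l → HasCentralChar ρ χ →
        (∀ i, N ≤ l i) →
        |repRank (ρ.comp Γ.subtype) A -
          twistedVNRank ((Subgroup.center G).subgroupOf Γ) (restrictChar Γ χ) A| < ε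

/-- `Γ` satisfies the quantitative rank-function conjecture: for every character `χ` of `Z(G)` and
every matrix `A` over `ℂ[Γ]`, `|rk_{W_λ} A - rk_Γ^χ A| ≤ C / min λᵢ` with a constant `C` that does
not depend on the irreducible representation `W_λ` with central character `χ`. The bound by
`C / min λᵢ` is expressed as the bound by `C / N` for all `0 < N ≤ min λᵢ`. -/
def SatisfiesQuantitativeRankConjecture (R : RootFrame G) (Γ : Subgroup G) : Prop :=
  ∀ (χ : Subgroup.center G →* ℂˣ) (r s : ℕ) (A : Matrix (Fin r) (Fin s) (MonoidAlgebra ℂ Γ)),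
    ∃ C : ℝ,
      ∀ (W : Type) [AddCommGroup W] [Module ℂ W] (ρ : Representation ℂ G W)
        (l : Fin R.rank → ℕ), IsIrrepWithHighestWeight R ρ l → HasCentralChar ρ χ →
        ∀ N : ℕ, 0 < N → (∀ i, N ≤ l i) →
        |repRank (ρ.comp Γ.subtype) A -
          twistedVNRank ((Subgroup.center G).subgroupOf Γ) (restrictChar Γ χ) A| ≤ C / N

/-- The homology `H_i(Γ, W)` of `Γ ≤ G` with coefficients in a representation `W` of `G`. -/
abbrev homologyOf (Γ : Subgroup G) {W : Type} [AddCommGroup W] [Module ℂ W]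
    (ρ : Representation ℂ G W) (i : ℕ) : ModuleCat ℂ :=
  groupHomology (Rep.of (ρ.comp Γ.subtype)) i

/-- The cohomology `H^i(Γ, W)` of `Γ ≤ G` with coefficients in a representation `W` of `G`. -/
abbrev cohomologyOf (Γ : Subgroup G) {W : Type} [AddCommGroup W] [Module ℂ W]
    (ρ : Representation ℂ G W) (i : ℕ) : ModuleCat ℂ :=
  groupCohomology (Rep.of (ρ.comp Γ.subtype)) i

end Conjectures

end L2Approx

end

/-!
# Betti numbers with coefficients in irreducible representations and `ℓ²`-Betti numbers

Let `P_•` be a projective resolution of `ℂ` over `ℂ[Γ]`, finitely generated up to degree `n + 1`. For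
`i ≤ n` the terms of `P_•` in degrees `i - 1`, `i`, `i + 1` are retracts of free modules of finite rank, so
that `P_i` is the image of an idempotent matrix `E`, and the differentials leaving and entering `P_i`
are given by matrices `D` and `A` over `ℂ[Γ]`. By linear algebra, for a finite dimensional
representation `W` of `Γ`, the dimensions of `H^i(Γ, W)` and `H_i(Γ, W)` are `rk E - rk D - rk A`, where
`rk` is the rank of the action on powers of `W` of these matrices, respectively of their
anti-transposes (`antiTranspose`; the antipode turns right modules into left ones). This is
`exists_matrices_of_isTypeFP`, which also gives the analogous formula
`b_i^{(2)}(Γ) = rk_Γ E - rk_Γ D - rk_Γ A` with von Neumann ranks.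

The formula for `b_i^{(2)}` refers to the dimension of an arbitrary module as a supremum over
projective submodules, and it rests on `vnDim_eq_of_surjective`: the dimension of the module of rows
annihilating an invariant subspace `V` of `ℓ²(Γ)^r`, modulo the row space of a matrix `A` with
`A V = 0`, is `dim ker A - dim V`. Both inequalities use that every equivariant operator is a matrix
over `N(Γ)` (`IsEquivariant.exists_matOp`) together with the rank-nullity formula
`hilbertDim_range_add_hilbertDim_ker`. The latter is proved without polar decomposition: the
operators `T (T* T + ε)⁻¹ T*` and `(T* T + ε)⁻¹ T* T` have the same trace, and they converge strongly
to the projections whose traces are to be compared. That `b_i^{(2)}` does not depend on the resolution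
follows from base change to `N(Γ)` being an additive functor, which preserves homotopy equivalences
(`l2Betti_eq_vnDim_homology`).

Since `Γ ∩ Z(G)` is trivial, the twisted von Neumann ranks are the untwisted ones for every central
character (`twistedVNRank_eq_vnRank`), and a matrix has the same von Neumann rank as its
anti-transpose (`vnRank_antiTranspose`), which up to complex conjugation is its adjoint. The
rank-function conjecture thus applies to six matrices. It is stated for each central character
separately, but the center of a semisimple group is finite (`finite_center`), and irreducible
representations have central characters by Schur's lemma (`exists_hasCentralChar`), so the
convergence is uniform.
-/

noncomputable section

set_option linter.unusedSectionVars false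

namespace L2Approx

section

open Filter ContinuousLinearMap

/-! ### Regularised inverses of `T* T` -/

section Resolvent

variable {E F : Type*} [NormedAddCommGroup E] [InnerProductSpace ℂ E] [CompleteSpace E]
  [NormedAddCommGroup F] [InnerProductSpace ℂ F] [CompleteSpace F]

/-- The regularised inverse `(T* T + ε)⁻¹`, which exists for `ε > 0`. -/
def resolvent (T : E →L[ℂ] F) (ε : ℝ) : E →L[ℂ] E :=
  Ring.inverse (adjoint T ∘L T + (ε : ℂ) • ContinuousLinearMap.id ℂ E)

theorem isUnit_adjoint_comp_add (T : E →L[ℂ] F) {ε : ℝ} (hε : 0 < ε) :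
    IsUnit (adjoint T ∘L T + (ε : ℂ) • ContinuousLinearMap.id ℂ E) := by
  have hpos : (0 : E →L[ℂ] E) ≤ adjoint T ∘L T :=
    (ContinuousLinearMap.nonneg_iff_isPositive _).2 (isPositive_adjoint_comp_self T)
  have h : (-ε : ℝ) ∉ spectrum ℝ (adjoint T ∘L T) := fun hmem =>
    absurd (spectrum_nonneg_of_nonneg hpos hmem) (by linarith)
  rw [spectrum.notMem_iff] at h
  have h2 := h.neg
  convert h2 using 1
  ext x
  simp [Algebra.algebraMap_eq_smul_one, add_comm]

theorem resolvent_mul (T : E →L[ℂ] F) {ε : ℝ} (hε : 0 < ε) (x : E) :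
    resolvent T ε (adjoint T (T x)) + (ε : ℂ) • resolvent T ε x = x := by
  have := congrArg (fun S : E →L[ℂ] E => S x)
    (Ring.inverse_mul_cancel _ (isUnit_adjoint_comp_add T hε))
  simpa [resolvent] using this

theorem mul_resolvent (T : E →L[ℂ] F) {ε : ℝ} (hε : 0 < ε) (x : E) :
    adjoint T (T (resolvent T ε x)) + (ε : ℂ) • resolvent T ε x = x := by
  have := congrArg (fun S : E →L[ℂ] E => S x)
    (Ring.mul_inverse_cancel _ (isUnit_adjoint_comp_add T hε))
  simpa [resolvent] using this

theorem resolvent_adjoint_apply (T : E →L[ℂ] F) {ε : ℝ} (hε : 0 < ε) (x : E) :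
    resolvent (adjoint T) ε (T x) = T (resolvent T ε x) := by
  have h := resolvent_mul (adjoint T) hε (T (resolvent T ε x))
  rw [adjoint_adjoint, ← map_smul, ← map_add, ← map_smul, ← map_add, mul_resolvent T hε] at h
  exact h

theorem norm_smul_resolvent_le (T : E →L[ℂ] F) {ε : ℝ} (hε : 0 < ε) (x : E) :
    ‖(ε : ℂ) • resolvent T ε x‖ ≤ ‖x‖ := by
  set u := resolvent T ε x with hu
  have h1 : RCLike.re (inner ℂ u x) = ‖T u‖ ^ 2 + ε * ‖u‖ ^ 2 := by
    conv_lhs => rw [← mul_resolvent T hε x, ← hu]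
    rw [inner_add_right, adjoint_inner_right, inner_smul_right, inner_self_eq_norm_sq_to_K,
      inner_self_eq_norm_sq_to_K]
    simp [← Complex.ofReal_pow, ← Complex.ofReal_mul]
  have h2 : RCLike.re (inner ℂ u x) ≤ ‖u‖ * ‖x‖ := re_inner_le_norm u x
  rw [norm_smul, Complex.norm_real, Real.norm_of_nonneg hε.le]
  by_cases h0 : ‖u‖ = 0
  · rw [h0]; simp
  · have hp : 0 < ‖u‖ := lt_of_le_of_ne (norm_nonneg _) (Ne.symm h0)
    have : ‖u‖ * (ε * ‖u‖) ≤ ‖u‖ * ‖x‖ := by nlinarith [sq_nonneg ‖T u‖]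
    exact le_of_mul_le_mul_left this hp

theorem norm_smul_resolvent_adjoint_le (T : E →L[ℂ] F) {ε : ℝ} (hε : 0 < ε) (y : F) :
    ‖(ε : ℂ) • resolvent T ε (adjoint T y)‖ ≤ √ε * ‖y‖ := by
  set u := resolvent T ε (adjoint T y) with hu
  have h1 : RCLike.re (inner ℂ u (adjoint T y)) = ‖T u‖ ^ 2 + ε * ‖u‖ ^ 2 := by
    conv_lhs => rw [← mul_resolvent T hε (adjoint T y), ← hu]
    rw [inner_add_right, adjoint_inner_right, inner_smul_right, inner_self_eq_norm_sq_to_K,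
      inner_self_eq_norm_sq_to_K]
    simp [← Complex.ofReal_pow, ← Complex.ofReal_mul]
  have h2 : RCLike.re (inner ℂ u (adjoint T y)) ≤ ‖T u‖ * ‖y‖ := by
    rw [adjoint_inner_right]
    exact re_inner_le_norm _ _
  have h3 : ε * ‖u‖ ^ 2 ≤ ‖y‖ ^ 2 := by nlinarith [sq_nonneg (‖T u‖ - ‖y‖), sq_nonneg ‖T u‖]
  rw [norm_smul, Complex.norm_real, Real.norm_of_nonneg hε.le]
  have h4 : √ε * √ε = ε := Real.mul_self_sqrt hε.le
  have h5 : √ε * ‖u‖ ≤ ‖y‖ := by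
    refine abs_le_of_sq_le_sq' ?_ (norm_nonneg _) |>.2
    rw [mul_pow, Real.sq_sqrt hε.le]; exact h3
  calc ε * ‖u‖ = √ε * (√ε * ‖u‖) := by rw [← mul_assoc, h4]
    _ ≤ √ε * ‖y‖ := by gcongr

/-- `ε (T* T + ε)⁻¹` converges strongly to the projection onto the kernel of `T`: it fixes the
kernel, and it tends to `0` on the range of `T*`, which is dense in the orthogonal complement. -/
theorem tendsto_smul_resolvent (T : E →L[ℂ] F) (x : E) :
    Tendsto (fun ε : ℝ => (ε : ℂ) • resolvent T ε x) (𝓝[>] 0)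
      (𝓝 ((LinearMap.ker T.toLinearMap).topologicalClosure.starProjection x)) := by
  set K := (LinearMap.ker T.toLinearMap).topologicalClosure with hK
  have hKker : ∀ z ∈ K, T z = 0 := by
    intro z hz
    have : K ≤ LinearMap.ker T.toLinearMap :=
      Submodule.topologicalClosure_minimal _ le_rfl (ContinuousLinearMap.isClosed_ker T)
    exact this hz
  have hfix : ∀ z ∈ K, ∀ ε : ℝ, 0 < ε → (ε : ℂ) • resolvent T ε z = z := by
    intro z hz ε hε
    have := resolvent_mul T hε z
    simpa [hKker z hz] using this
  have hzero : ∀ z ∈ Kᗮ, Tendsto (fun ε : ℝ => (ε : ℂ) • resolvent T ε z) (𝓝[>] 0) (𝓝 0) := by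
    intro z hz
    have hz' : z ∈ (LinearMap.range (adjoint T).toLinearMap).topologicalClosure := by
      rw [← Submodule.orthogonal_orthogonal_eq_closure]
      have h1 : (LinearMap.range (adjoint T).toLinearMap)ᗮ = LinearMap.ker T.toLinearMap := by
        have := ContinuousLinearMap.orthogonal_range (adjoint T)
        rw [adjoint_adjoint] at this
        exact this
      rw [h1]
      exact Submodule.orthogonal_le (Submodule.le_topologicalClosure _) hz
    rw [Metric.tendsto_nhds]
    intro δ hδ
    obtain ⟨w, hw, hzw⟩ := Metric.mem_closure_iff.1 hz' (δ / 2) (by positivity)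
    obtain ⟨y, rfl⟩ := hw
    have hsq : Tendsto (fun ε : ℝ => √ε * ‖y‖) (𝓝[>] 0) (𝓝 0) := by
      have : Tendsto (fun ε : ℝ => √ε * ‖y‖) (𝓝 0) (𝓝 (√0 * ‖y‖)) :=
        (Real.continuous_sqrt.mul continuous_const).tendsto 0
      simpa using this.mono_left nhdsWithin_le_nhds
    filter_upwards [self_mem_nhdsWithin, hsq.eventually (gt_mem_nhds (half_pos hδ))] with ε hε hy
    have hε : 0 < ε := hε
    rw [dist_zero_right]
    have hsplit : (ε : ℂ) • resolvent T ε z =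
        (ε : ℂ) • resolvent T ε (z - adjoint T y) + (ε : ℂ) • resolvent T ε (adjoint T y) := by
      rw [← smul_add, ← map_add, sub_add_cancel]
    rw [hsplit]
    calc _ ≤ ‖z - adjoint T y‖ + √ε * ‖y‖ :=
          (norm_add_le _ _).trans (add_le_add (norm_smul_resolvent_le T hε _)
            (norm_smul_resolvent_adjoint_le T hε y))
      _ < δ / 2 + δ / 2 := by
          refine add_lt_add ?_ hy
          rw [← dist_eq_norm]; exact hzw
      _ = δ := by ring
  have hdec : x = K.starProjection x + (x - K.starProjection x) := by abel
  have h1 := hzero _ (Submodule.sub_starProjection_mem_orthogonal (K := K) x)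
  have h2 := h1.const_add (K.starProjection x)
  rw [add_zero] at h2
  refine h2.congr' ?_
  filter_upwards [self_mem_nhdsWithin] with ε hε
  conv_rhs => rw [hdec, map_add, smul_add, hfix _ (Submodule.starProjection_apply_mem K x) ε hε]

end Resolvent

/-! ### Equivariant operators between powers of `ℓ²(Γ)` -/

section Equivariant

/-- The Hilbert space `ℓ²(Γ)^ι`. -/
abbrev L2Pow (Γ ι : Type*) : Type _ := PiLp 2 fun _ : ι => L2 Γ

variable {Γ : Type*} {ι κ μ : Type*} [Fintype ι] [Fintype κ] [Fintype μ]

open Classical in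
/-- The vector with `δ_g` in coordinate `i` and zeros elsewhere. -/
def basisVec (i : ι) (g : Γ) : L2Pow Γ ι :=
  WithLp.toLp 2 (Pi.single i (lp.single 2 g (1 : ℂ)))

theorem inner_basisVec (i : ι) (g : Γ) (x : L2Pow Γ ι) :
    inner ℂ (basisVec i g) x = (x i : Γ → ℂ) g := by
  classical
  rw [PiLp.inner_apply, Finset.sum_eq_single i]
  · simp [basisVec, lp.inner_single_left]
  · intro j _ hj
    simp [basisVec, hj]
  · simp

variable [Group Γ]

/-- Right translation by `g` in every coordinate of `ℓ²(Γ)^ι`. -/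
def rightShift (g : Γ) : L2Pow Γ ι →ₗ[ℂ] L2Pow Γ ι where
  toFun x := WithLp.toLp 2 fun i => rightTranslation g (x i)
  map_add' x y := by ext i; simp
  map_smul' c x := by ext i; simp

@[simp]
theorem rightShift_apply (g : Γ) (x : L2Pow Γ ι) (i : ι) (h : Γ) :
    (rightShift g x i : Γ → ℂ) h = (x i : Γ → ℂ) (h * g) := rfl

theorem rightShift_coord (g : Γ) (x : L2Pow Γ ι) (i : ι) :
    rightShift g x i = rightTranslation g (x i) := rfl

theorem L2Pow.ext {x y : L2Pow Γ ι} (h : ∀ i g, (x i : Γ → ℂ) g = (y i : Γ → ℂ) g) : x = y := by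
  apply PiLp.ext
  intro i
  apply lp.ext
  funext g
  exact h i g

theorem rightShift_mul (g h : Γ) (x : L2Pow Γ ι) :
    rightShift (g * h) x = rightShift g (rightShift h x) := by
  apply L2Pow.ext
  intro i k
  simp [mul_assoc]

@[simp]
theorem rightShift_one (x : L2Pow Γ ι) : rightShift (1 : Γ) x = x := by
  apply L2Pow.ext
  intro i k
  simp

theorem norm_rightTranslation (g : Γ) (f : L2 Γ) : ‖rightTranslation g f‖ = ‖f‖ :=
  (permL2 (Equiv.mulRight g)).norm_map f

theorem norm_rightShift (g : Γ) (x : L2Pow Γ ι) : ‖rightShift g x‖ = ‖x‖ := by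
  rw [PiLp.norm_eq_of_L2, PiLp.norm_eq_of_L2]
  simp [rightShift_coord, norm_rightTranslation]

theorem inner_rightShift (g : Γ) (x y : L2Pow Γ ι) :
    inner ℂ (rightShift g x) (rightShift g y) = inner ℂ x y :=
  (LinearIsometry.mk (rightShift g) (norm_rightShift g)).inner_map_map x y

theorem inner_rightShift_left (g : Γ) (x y : L2Pow Γ ι) :
    inner ℂ (rightShift g x) y = inner ℂ x (rightShift g⁻¹ y) := by
  rw [← inner_rightShift g x (rightShift g⁻¹ y), ← rightShift_mul]; simp

theorem rightShift_basisVec (i : ι) (g h : Γ) :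
    rightShift g (basisVec i h) = basisVec i (h * g⁻¹) := by
  classical
  apply L2Pow.ext
  intro j k
  by_cases hij : j = i
  · subst hij
    simp [basisVec, Pi.single_apply, eq_mul_inv_iff_mul_eq]
  · simp [basisVec, hij]

/-- An operator `ℓ²(Γ)^ι → ℓ²(Γ)^κ` is equivariant if it commutes with right translations. -/
def IsEquivariant (T : L2Pow Γ ι →L[ℂ] L2Pow Γ κ) : Prop :=
  ∀ g x, T (rightShift g x) = rightShift g (T x)

theorem IsEquivariant.comp {S : L2Pow Γ κ →L[ℂ] L2Pow Γ μ} {T : L2Pow Γ ι →L[ℂ] L2Pow Γ κ}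
    (hS : IsEquivariant S) (hT : IsEquivariant T) : IsEquivariant (S ∘L T) := fun g x => by
  simp [hT g x, hS g]

theorem IsEquivariant.add {S T : L2Pow Γ ι →L[ℂ] L2Pow Γ κ}
    (hS : IsEquivariant S) (hT : IsEquivariant T) : IsEquivariant (S + T) := fun g x => by
  simp [hT g x, hS g]

theorem IsEquivariant.sub {S T : L2Pow Γ ι →L[ℂ] L2Pow Γ κ}
    (hS : IsEquivariant S) (hT : IsEquivariant T) : IsEquivariant (S - T) := fun g x => by
  simp [hT g x, hS g]

theorem IsEquivariant.smul {T : L2Pow Γ ι →L[ℂ] L2Pow Γ κ} (c : ℂ)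
    (hT : IsEquivariant T) : IsEquivariant (c • T) := fun g x => by
  simp [hT g x]

theorem IsEquivariant.id : IsEquivariant (ContinuousLinearMap.id ℂ (L2Pow Γ ι)) := fun _ _ => rfl

theorem IsEquivariant.adjoint {T : L2Pow Γ ι →L[ℂ] L2Pow Γ κ} (hT : IsEquivariant T) :
    IsEquivariant (adjoint T) := fun g x => by
  refine ext_inner_left ℂ fun y => ?_
  have h := inner_rightShift_left g⁻¹ y (ContinuousLinearMap.adjoint T x)
  rw [inv_inv] at h
  rw [adjoint_inner_right, ← h, adjoint_inner_right, hT, inner_rightShift_left, inv_inv]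

theorem IsEquivariant.inverse {T : L2Pow Γ ι →L[ℂ] L2Pow Γ ι} (hT : IsEquivariant T) :
    IsEquivariant (Ring.inverse T) := by
  by_cases h : IsUnit T
  · intro g x
    have h1 : ∀ y, Ring.inverse T (T y) = y := fun y =>
      congrArg (fun S : L2Pow Γ ι →L[ℂ] L2Pow Γ ι => S y) (Ring.inverse_mul_cancel T h)
    have h2 : ∀ y, T (Ring.inverse T y) = y := fun y =>
      congrArg (fun S : L2Pow Γ ι →L[ℂ] L2Pow Γ ι => S y) (Ring.mul_inverse_cancel T h)
    rw [← h1 (rightShift g (Ring.inverse T x)), hT, h2]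
  · rw [Ring.inverse_non_unit _ h]
    intro g x
    simp

theorem IsEquivariant.resolvent {T : L2Pow Γ ι →L[ℂ] L2Pow Γ κ} (hT : IsEquivariant T) (ε : ℝ) :
    IsEquivariant (resolvent T ε) :=
  ((hT.adjoint.comp hT).add (IsEquivariant.id.smul _)).inverse

/-- The trace `∑ᵢ ⟨δᵢ, T δᵢ⟩` of an operator on `ℓ²(Γ)^ι`, where `δᵢ` is `δ₁` in coordinate `i`. -/
def opTrace (T : L2Pow Γ ι →L[ℂ] L2Pow Γ ι) : ℂ := ∑ i, (T (basisVec i 1) i : Γ → ℂ) 1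

theorem opTrace_add (S T : L2Pow Γ ι →L[ℂ] L2Pow Γ ι) :
    opTrace (S + T) = opTrace S + opTrace T := by
  simp [opTrace, Finset.sum_add_distrib]

theorem opTrace_sub (S T : L2Pow Γ ι →L[ℂ] L2Pow Γ ι) :
    opTrace (S - T) = opTrace S - opTrace T := by
  simp [opTrace]

theorem opTrace_id : opTrace (ContinuousLinearMap.id ℂ (L2Pow Γ ι)) = Fintype.card ι := by
  simp [opTrace, basisVec]

theorem opTrace_eq_inner (T : L2Pow Γ ι →L[ℂ] L2Pow Γ ι) :
    opTrace T = ∑ i, inner ℂ (basisVec i (1 : Γ)) (T (basisVec i 1)) := by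
  simp [opTrace, inner_basisVec]

/-- The trace of a product of equivariant operators in terms of their matrix coefficients. -/
theorem opTrace_comp {S : L2Pow Γ κ →L[ℂ] L2Pow Γ ι} {T : L2Pow Γ ι →L[ℂ] L2Pow Γ κ}
    (hS : IsEquivariant S) :
    opTrace (S ∘L T) = ∑ i, ∑ k, ∑' g : Γ,
      (S (basisVec k 1) i : Γ → ℂ) g⁻¹ * (T (basisVec i 1) k : Γ → ℂ) g := by
  rw [opTrace_eq_inner]
  refine Finset.sum_congr rfl fun i _ => ?_
  rw [ContinuousLinearMap.comp_apply, ← adjoint_inner_left, PiLp.inner_apply]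
  refine Finset.sum_congr rfl fun k _ => ?_
  rw [lp.inner_eq_tsum]
  refine tsum_congr fun g => ?_
  have h : ((ContinuousLinearMap.adjoint S (basisVec i 1)) k : Γ → ℂ) g =
      starRingEnd ℂ ((S (basisVec k 1) i : Γ → ℂ) g⁻¹) := by
    rw [← inner_basisVec, adjoint_inner_right, ← inner_conj_symm, inner_basisVec]
    congr 1
    have h1 : basisVec k g = rightShift g⁻¹ (basisVec k (1 : Γ)) := by
      rw [rightShift_basisVec]; simp
    rw [h1, hS]; simp
  rw [h]
  simp [mul_comm]

theorem opTrace_comp_comm {S : L2Pow Γ κ →L[ℂ] L2Pow Γ ι} {T : L2Pow Γ ι →L[ℂ] L2Pow Γ κ}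
    (hS : IsEquivariant S) (hT : IsEquivariant T) : opTrace (S ∘L T) = opTrace (T ∘L S) := by
  rw [opTrace_comp hS, opTrace_comp hT, Finset.sum_comm]
  refine Finset.sum_congr rfl fun k _ => Finset.sum_congr rfl fun i _ => ?_
  rw [← (Equiv.inv Γ).tsum_eq]
  refine tsum_congr fun g => ?_
  simp [mul_comm]

end Equivariant

/-! ### The von Neumann dimension of subspaces of `ℓ²(Γ)^ι` -/

section Dimension

variable {Γ : Type*} [Group Γ] {ι κ μ : Type*} [Fintype ι] [Fintype κ] [Fintype μ]

/-- The orthogonal projection onto the closure of `V`. -/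
def projCl (V : Submodule ℂ (L2Pow Γ ι)) : L2Pow Γ ι →L[ℂ] L2Pow Γ ι :=
  V.topologicalClosure.starProjection

/-- The von Neumann dimension of the closure of a subspace `V`: the trace of the projection. -/
def hilbertDim (V : Submodule ℂ (L2Pow Γ ι)) : ℝ := (opTrace (projCl V)).re

theorem projCl_mem (V : Submodule ℂ (L2Pow Γ ι)) (x : L2Pow Γ ι) :
    projCl V x ∈ V.topologicalClosure :=
  Submodule.starProjection_apply_mem _ x

theorem projCl_eq_self {V : Submodule ℂ (L2Pow Γ ι)} {x : L2Pow Γ ι}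
    (hx : x ∈ V.topologicalClosure) : projCl V x = x :=
  Submodule.starProjection_eq_self_iff.2 hx

theorem projCl_eq_of_mem {V : Submodule ℂ (L2Pow Γ ι)} {x y : L2Pow Γ ι}
    (hy : y ∈ V.topologicalClosure) (h : ∀ w ∈ V, inner ℂ w (x - y) = 0) : projCl V x = y := by
  refine Submodule.eq_starProjection_of_mem_orthogonal hy ?_
  rw [Submodule.orthogonal_closure]
  exact h

theorem inner_sub_projCl (V : Submodule ℂ (L2Pow Γ ι)) (x w : L2Pow Γ ι) (hw : w ∈ V) :
    inner ℂ w (x - projCl V x) = 0 :=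
  Submodule.sub_starProjection_mem_orthogonal (K := V.topologicalClosure) x w
    (V.le_topologicalClosure hw)

theorem hilbertDim_eq_sum (V : Submodule ℂ (L2Pow Γ ι)) :
    hilbertDim V = ∑ i, ‖projCl V (basisVec i (1 : Γ))‖ ^ 2 := by
  rw [hilbertDim, opTrace_eq_inner, Complex.re_sum]
  refine Finset.sum_congr rfl fun i _ => ?_
  have := Submodule.re_inner_starProjection_eq_normSq V.topologicalClosure (basisVec i (1 : Γ))
  rw [← inner_conj_symm, Complex.conj_re]
  exact this

theorem hilbertDim_mono {V W : Submodule ℂ (L2Pow Γ ι)} (h : V ≤ W.topologicalClosure) :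
    hilbertDim V ≤ hilbertDim W := by
  rw [hilbertDim_eq_sum, hilbertDim_eq_sum]
  refine Finset.sum_le_sum fun i _ => ?_
  have hle : V.topologicalClosure ≤ W.topologicalClosure :=
    Submodule.topologicalClosure_minimal _ h (Submodule.isClosed_topologicalClosure _)
  have : projCl V (projCl W (basisVec i (1 : Γ))) = projCl V (basisVec i (1 : Γ)) :=
    congrArg (fun S : L2Pow Γ ι →L[ℂ] L2Pow Γ ι => S (basisVec i (1 : Γ)))
      (Submodule.starProjection_comp_starProjection_of_le hle)
  rw [← this]
  gcongr
  exact Submodule.norm_starProjection_apply_le _ _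

/-- The projection onto an invariant subspace is equivariant. -/
theorem isEquivariant_projCl {V : Submodule ℂ (L2Pow Γ ι)}
    (hV : ∀ (g : Γ), ∀ x ∈ V, rightShift g x ∈ V) : IsEquivariant (projCl V) := by
  intro g x
  refine projCl_eq_of_mem ?_ fun w hw => ?_
  · have hc : Continuous (rightShift g : L2Pow Γ ι → L2Pow Γ ι) :=
      AddMonoidHomClass.continuous_of_bound (rightShift g : L2Pow Γ ι →ₗ[ℂ] L2Pow Γ ι) 1
        fun x => by rw [norm_rightShift, one_mul]
    exact map_mem_closure hc (projCl_mem V x) (fun y hy => hV g y hy)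
  · rw [← map_sub, ← inner_conj_symm, inner_rightShift_left, inner_conj_symm]
    exact inner_sub_projCl V x _ (hV _ _ hw)

theorem IsEquivariant.projCl_range {T : L2Pow Γ ι →L[ℂ] L2Pow Γ κ} (hT : IsEquivariant T) :
    IsEquivariant (projCl (LinearMap.range T.toLinearMap)) :=
  isEquivariant_projCl fun g x ⟨y, hy⟩ => ⟨rightShift g y, by
    rw [← hy]; exact hT g y⟩

theorem IsEquivariant.projCl_ker {T : L2Pow Γ ι →L[ℂ] L2Pow Γ κ} (hT : IsEquivariant T) :
    IsEquivariant (projCl (LinearMap.ker T.toLinearMap)) :=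
  isEquivariant_projCl fun g x hx => by
    have hx : T x = 0 := hx
    change T _ = 0
    rw [hT, hx, map_zero]

theorem ker_topologicalClosure (T : L2Pow Γ ι →L[ℂ] L2Pow Γ κ) :
    (LinearMap.ker T.toLinearMap).topologicalClosure = LinearMap.ker T.toLinearMap :=
  (ContinuousLinearMap.isClosed_ker T).submodule_topologicalClosure_eq

theorem hilbertDim_range_add_hilbertDim_ker_adjoint (T : L2Pow Γ ι →L[ℂ] L2Pow Γ κ) :
    hilbertDim (LinearMap.range T.toLinearMap) +
      hilbertDim (LinearMap.ker (adjoint T).toLinearMap) = Fintype.card κ := by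
  have h : projCl (LinearMap.range T.toLinearMap) +
      projCl (LinearMap.ker (adjoint T).toLinearMap) = ContinuousLinearMap.id ℂ _ := by
    have h1 : (LinearMap.range T.toLinearMap)ᗮ = LinearMap.ker (adjoint T).toLinearMap :=
      ContinuousLinearMap.orthogonal_range T
    ext1 x
    rw [add_apply, ← eq_sub_iff_add_eq']
    refine projCl_eq_of_mem ?_ fun w hw => ?_
    · refine Submodule.le_topologicalClosure _ ?_
      rw [← h1]
      exact fun w hw => inner_sub_projCl _ _ _ hw
    · rw [← h1] at hw
      rw [id_apply, sub_sub_cancel, ← inner_conj_symm]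
      rw [← Submodule.orthogonal_closure] at hw
      rw [hw _ (projCl_mem _ x), map_zero]
  rw [hilbertDim, hilbertDim, ← Complex.add_re, ← opTrace_add, h, opTrace_id]
  simp

theorem tendsto_opTrace_smul_resolvent (S : L2Pow Γ ι →L[ℂ] L2Pow Γ κ) :
    Tendsto (fun ε : ℝ => opTrace ((ε : ℂ) • resolvent S ε)) (𝓝[>] 0)
      (𝓝 (opTrace (projCl (LinearMap.ker S.toLinearMap)))) := by
  simp only [opTrace_eq_inner]
  exact tendsto_finsetSum _ fun i _ =>
    Tendsto.inner tendsto_const_nhds (tendsto_smul_resolvent S (basisVec i 1))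

/-- Rank-nullity: the trace of `T (T* T + ε)⁻¹ T*` equals that of `(T* T + ε)⁻¹ T* T`, and as
`ε → 0` these converge to the dimensions of the closure of the range of `T` and of the
orthogonal complement of its kernel. -/
theorem hilbertDim_range_add_hilbertDim_ker {T : L2Pow Γ ι →L[ℂ] L2Pow Γ κ}
    (hT : IsEquivariant T) :
    hilbertDim (LinearMap.range T.toLinearMap) + hilbertDim (LinearMap.ker T.toLinearMap) =
      Fintype.card ι := by
  have key : ∀ ε : ℝ, 0 < ε →
      (Fintype.card κ : ℂ) - opTrace ((ε : ℂ) • resolvent (adjoint T) ε) =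
        Fintype.card ι - opTrace ((ε : ℂ) • resolvent T ε) := by
    intro ε hε
    have h1 : T ∘L (resolvent T ε ∘L adjoint T) =
        ContinuousLinearMap.id ℂ _ - (ε : ℂ) • resolvent (adjoint T) ε := by
      ext1 x
      have := resolvent_mul (adjoint T) hε x
      rw [adjoint_adjoint] at this
      rw [sub_apply, eq_sub_iff_add_eq, comp_apply, comp_apply, ← resolvent_adjoint_apply T hε]
      exact this
    have h2 : (resolvent T ε ∘L adjoint T) ∘L T =
        ContinuousLinearMap.id ℂ _ - (ε : ℂ) • resolvent T ε := by
      ext1 x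
      rw [sub_apply, eq_sub_iff_add_eq]
      exact resolvent_mul T hε x
    have := opTrace_comp_comm hT ((hT.resolvent ε).comp hT.adjoint)
    rw [h1, h2, opTrace_sub, opTrace_sub, opTrace_id, opTrace_id] at this
    exact this
  have l1 := (tendsto_opTrace_smul_resolvent (adjoint T)).const_sub (Fintype.card κ : ℂ)
  have l2 := (tendsto_opTrace_smul_resolvent T).const_sub (Fintype.card ι : ℂ)
  have heq := tendsto_nhds_unique (l1.congr' (by
    filter_upwards [self_mem_nhdsWithin] with ε hε using key ε hε)) l2
  have h3 := congrArg Complex.re heq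
  have h4 := hilbertDim_range_add_hilbertDim_ker_adjoint T
  simp only [Complex.sub_re, Complex.natCast_re] at h3
  simp only [hilbertDim] at h4 ⊢
  linarith

theorem hilbertDim_range_adjoint {T : L2Pow Γ ι →L[ℂ] L2Pow Γ κ} (hT : IsEquivariant T) :
    hilbertDim (LinearMap.range (adjoint T).toLinearMap) =
      hilbertDim (LinearMap.range T.toLinearMap) := by
  have h1 := hilbertDim_range_add_hilbertDim_ker_adjoint (adjoint T)
  rw [adjoint_adjoint] at h1
  have h2 := hilbertDim_range_add_hilbertDim_ker hT
  linarith

/-- The trace of an idempotent is the dimension of its range: if `p` is the projection onto the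
range of `e` then `p e = e` and `e p = p`. -/
theorem hilbertDim_range_of_idempotent {e : L2Pow Γ ι →L[ℂ] L2Pow Γ ι} (he : IsEquivariant e)
    (hid : e ∘L e = e) : hilbertDim (LinearMap.range e.toLinearMap) = (opTrace e).re := by
  have hid' : ∀ x, e (e x) = e x := fun x => congrArg (fun S : _ →L[ℂ] _ => S x) hid
  set p := projCl (LinearMap.range e.toLinearMap)
  have h1 : p ∘L e = e := by
    ext1 x
    exact projCl_eq_self (Submodule.le_topologicalClosure _ ⟨x, rfl⟩)
  have h2 : e ∘L p = p := by
    ext1 x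
    have hcl : IsClosed {y : L2Pow Γ ι | e y = y} := isClosed_eq e.continuous continuous_id
    exact closure_minimal (s := (LinearMap.range e.toLinearMap : Set (L2Pow Γ ι)))
      (by rintro _ ⟨y, rfl⟩; exact hid' y) hcl (projCl_mem _ x)
  change (opTrace p).re = _
  rw [← h2, opTrace_comp_comm he he.projCl_range, h1]

end Dimension

/-! ### Matrices over the group von Neumann algebra as operators -/

section MatrixOperators

variable {Γ : Type*} [Group Γ] {ι κ μ : Type*} [Fintype ι] [Fintype κ] [Fintype μ]

/-- The operator into `ℓ²(Γ)^κ` with given coordinates. -/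
def coordOp {E : Type*} [NormedAddCommGroup E] [NormedSpace ℂ E] (T : κ → E →L[ℂ] L2 Γ) :
    E →L[ℂ] L2Pow Γ κ :=
  (PiLp.continuousLinearEquiv 2 ℂ fun _ : κ => L2 Γ).symm.toContinuousLinearMap ∘L
    ContinuousLinearMap.pi T

@[simp]
theorem coordOp_apply {E : Type*} [NormedAddCommGroup E] [NormedSpace ℂ E]
    (T : κ → E →L[ℂ] L2 Γ) (x : E) (k : κ) : coordOp T x k = T k x := rfl

theorem coe_rightTranslation_vn (a : VN Γ) (g : Γ) (f : L2 Γ) :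
    a.1 (rightTranslation g f) = rightTranslation g (a.1 f) := by
  have h := (Subalgebra.mem_centralizer_iff ℂ).1 a.2 (rightTranslation g) ⟨g, rfl⟩
  exact congrArg (fun S : L2 Γ →L[ℂ] L2 Γ => S f) h.symm

/-- The inclusion of `N(Γ)` into the bounded operators. -/
def vnVal : VN Γ →ₐ[ℂ] (L2 Γ →L[ℂ] L2 Γ) := (groupVN Γ).val

theorem vnVal_injective : Function.Injective (vnVal : VN Γ → L2 Γ →L[ℂ] L2 Γ) :=
  Subtype.val_injective

theorem vnVal_toVN (g : Γ) : vnVal (toVN g) = leftTranslation g := rfl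

theorem vnVal_rightTranslation (a : VN Γ) (g : Γ) (f : L2 Γ) :
    vnVal a (rightTranslation g f) = rightTranslation g (vnVal a f) :=
  coe_rightTranslation_vn a g f

/-- A row over `N(Γ)` as an operator `ℓ²(Γ)^ι → ℓ²(Γ)`. -/
def rowOp (v : ι → VN Γ) : L2Pow Γ ι →L[ℂ] L2 Γ :=
  ∑ i, vnVal (v i) ∘L PiLp.proj 2 (fun _ : ι => L2 Γ) i

theorem rowOp_apply (v : ι → VN Γ) (x : L2Pow Γ ι) : rowOp v x = ∑ i, vnVal (v i) (x i) := by
  simp [rowOp]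

theorem rowOp_sub (v w : ι → VN Γ) (x : L2Pow Γ ι) :
    rowOp (v - w) x = rowOp v x - rowOp w x := by
  simp [rowOp_apply]

theorem rowOp_rightShift (v : ι → VN Γ) (g : Γ) (x : L2Pow Γ ι) :
    rowOp v (rightShift g x) = rightTranslation g (rowOp v x) := by
  simp [rowOp_apply, rightShift_coord, vnVal_rightTranslation]

/-- The operator `ℓ²(Γ)^ι → ℓ²(Γ)^κ` of left multiplication with a matrix over `N(Γ)`. -/
def matOp (A : Matrix κ ι (VN Γ)) : L2Pow Γ ι →L[ℂ] L2Pow Γ κ := coordOp fun k => rowOp (A k)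

theorem matOp_apply (A : Matrix κ ι (VN Γ)) (x : L2Pow Γ ι) (k : κ) :
    matOp A x k = rowOp (A k) x := rfl

theorem matOp_coord (A : Matrix κ ι (VN Γ)) (x : L2Pow Γ ι) (k : κ) :
    matOp A x k = ∑ i, vnVal (A k i) (x i) := rowOp_apply _ _

theorem isEquivariant_matOp (A : Matrix κ ι (VN Γ)) : IsEquivariant (matOp A) := fun g x => by
  apply PiLp.ext
  intro k
  exact rowOp_rightShift (A k) g x

theorem rowOp_vecMul (v : κ → VN Γ) (A : Matrix κ ι (VN Γ)) (x : L2Pow Γ ι) :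
    rowOp (Matrix.vecMul v A) x = rowOp v (matOp A x) := by
  simp only [rowOp_apply, matOp_coord, Matrix.vecMul, dotProduct, map_sum, map_mul,
    _root_.sum_apply]
  rw [Finset.sum_comm]
  rfl

theorem matOp_mul (A : Matrix μ κ (VN Γ)) (B : Matrix κ ι (VN Γ)) (x : L2Pow Γ ι) :
    matOp (A * B) x = matOp A (matOp B x) := by
  apply PiLp.ext
  intro k
  exact rowOp_vecMul (A k) B x

theorem matOp_sub (A B : Matrix κ ι (VN Γ)) (x : L2Pow Γ ι) :
    matOp (A - B) x = matOp A x - matOp B x := by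
  apply PiLp.ext
  intro k
  exact rowOp_sub (A k) (B k) x

theorem matOp_one [DecidableEq ι] (x : L2Pow Γ ι) : matOp (1 : Matrix ι ι (VN Γ)) x = x := by
  apply PiLp.ext
  intro k
  rw [matOp_coord, Finset.sum_eq_single k]
  · simp
  · intro j _ hj
    simp [Matrix.one_apply_ne hj.symm]
  · simp

theorem matOp_zero (x : L2Pow Γ ι) : matOp (0 : Matrix κ ι (VN Γ)) x = 0 := by
  apply PiLp.ext
  intro k
  simp [matOp_coord]

open Classical in
/-- The inclusion of the `i`-th coordinate. -/
def coordIncl (i : ι) : L2 Γ →L[ℂ] L2Pow Γ ι :=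
  coordOp fun j => if j = i then ContinuousLinearMap.id ℂ _ else 0

theorem sum_coordIncl (x : L2Pow Γ ι) : ∑ i, coordIncl i (x i) = x := by
  classical
  apply PiLp.ext
  intro k
  rw [WithLp.ofLp_sum, Finset.sum_apply, Finset.sum_eq_single k]
  · simp [coordIncl]
  · intro j _ hj
    simp [coordIncl, Ne.symm hj]
  · simp

theorem coordIncl_rightTranslation (i : ι) (g : Γ) (f : L2 Γ) :
    coordIncl i (rightTranslation g f) = rightShift g (coordIncl i f) := by
  classical
  apply PiLp.ext
  intro k
  by_cases h : k = i
  · simp [coordIncl, rightShift_coord, h]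
  · simp [coordIncl, rightShift_coord, h]

theorem rowOp_coordIncl (v : ι → VN Γ) (i : ι) (f : L2 Γ) :
    rowOp v (coordIncl i f) = vnVal (v i) f := by
  classical
  rw [rowOp_apply, Finset.sum_eq_single i]
  · simp [coordIncl]
  · intro j _ hj
    simp [coordIncl, hj]
  · simp

theorem rowOp_injective {v w : ι → VN Γ} (h : ∀ x, rowOp v x = rowOp w x) : v = w := by
  funext i
  apply vnVal_injective
  ext1 f
  rw [← rowOp_coordIncl, ← rowOp_coordIncl, h]

theorem matOp_injective {A B : Matrix κ ι (VN Γ)} (h : ∀ x, matOp A x = matOp B x) : A = B := by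
  funext k
  apply rowOp_injective
  intro x
  have := congrArg (fun y : L2Pow Γ κ => y k) (h x)
  exact this

theorem IsEquivariant.entry_mem {T : L2Pow Γ ι →L[ℂ] L2Pow Γ κ} (hT : IsEquivariant T) (k : κ)
    (i : ι) : PiLp.proj 2 (fun _ : κ => L2 Γ) k ∘L T ∘L coordIncl i ∈ groupVN Γ := by
  refine (Subalgebra.mem_centralizer_iff ℂ).2 fun S hS => ?_
  obtain ⟨g, rfl⟩ := hS
  ext1 f
  change rightTranslation g (T (coordIncl i f) k) = T (coordIncl i (rightTranslation g f)) k
  rw [coordIncl_rightTranslation, hT, rightShift_coord]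

/-- Every equivariant operator is left multiplication with a matrix over `N(Γ)`. -/
theorem IsEquivariant.exists_matOp {T : L2Pow Γ ι →L[ℂ] L2Pow Γ κ} (hT : IsEquivariant T) :
    ∃ A : Matrix κ ι (VN Γ), matOp A = T := by
  refine ⟨Matrix.of fun k i => (⟨_, hT.entry_mem k i⟩ : groupVN Γ), ?_⟩
  ext1 x
  apply PiLp.ext
  intro k
  refine (matOp_coord _ x k).trans ?_
  conv_rhs => rw [← sum_coordIncl x, map_sum, WithLp.ofLp_sum, Finset.sum_apply]
  rfl

theorem opTrace_matOp {r : ℕ} (A : Matrix (Fin r) (Fin r) (VN Γ)) :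
    opTrace (matOp A) = ∑ i, vnTrace (A i i) := by
  classical
  refine Finset.sum_congr rfl fun i _ => ?_
  rw [matOp_coord, Finset.sum_eq_single i]
  · simp [basisVec, vnTrace, vnVal]
    rfl
  · intro j _ hj
    simp [basisVec, hj]
  · simp

end MatrixOperators

/-! ### Direct sums -/

section DirectSum

variable {Γ : Type*} [Group Γ] {ι κ : Type*} [Fintype ι] [Fintype κ]

/-- The first component of a vector of `ℓ²(Γ)^(ι ⊕ κ)`. -/
def sumFst : L2Pow Γ (ι ⊕ κ) →L[ℂ] L2Pow Γ ι := coordOp fun i => PiLp.proj 2 _ (Sum.inl i)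

/-- The second component of a vector of `ℓ²(Γ)^(ι ⊕ κ)`. -/
def sumSnd : L2Pow Γ (ι ⊕ κ) →L[ℂ] L2Pow Γ κ := coordOp fun i => PiLp.proj 2 _ (Sum.inr i)

/-- The pairing of two operators into an operator into `ℓ²(Γ)^(ι ⊕ κ)`. -/
def sumPair {E : Type*} [NormedAddCommGroup E] [NormedSpace ℂ E] (S : E →L[ℂ] L2Pow Γ ι)
    (T : E →L[ℂ] L2Pow Γ κ) : E →L[ℂ] L2Pow Γ (ι ⊕ κ) :=
  coordOp (Sum.elim (fun i => PiLp.proj 2 _ i ∘L S) (fun i => PiLp.proj 2 _ i ∘L T))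

variable {E : Type*} [NormedAddCommGroup E] [NormedSpace ℂ E]

@[simp]
theorem sumFst_sumPair (S : E →L[ℂ] L2Pow Γ ι) (T : E →L[ℂ] L2Pow Γ κ) (x : E) :
    sumFst (sumPair S T x) = S x := rfl

@[simp]
theorem sumSnd_sumPair (S : E →L[ℂ] L2Pow Γ ι) (T : E →L[ℂ] L2Pow Γ κ) (x : E) :
    sumSnd (sumPair S T x) = T x := rfl

theorem sum_ext {x y : L2Pow Γ (ι ⊕ κ)} (h1 : sumFst x = sumFst y) (h2 : sumSnd x = sumSnd y) :
    x = y := by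
  apply PiLp.ext
  rintro (i | i)
  · exact congrArg (fun z : L2Pow Γ ι => z i) h1
  · exact congrArg (fun z : L2Pow Γ κ => z i) h2

/-- The inclusion of the first summand. -/
def sumInl : L2Pow Γ ι →L[ℂ] L2Pow Γ (ι ⊕ κ) := sumPair (ContinuousLinearMap.id ℂ _) 0

/-- The inclusion of the second summand. -/
def sumInr : L2Pow Γ κ →L[ℂ] L2Pow Γ (ι ⊕ κ) := sumPair 0 (ContinuousLinearMap.id ℂ _)

theorem sumInl_add_sumInr (z : L2Pow Γ (ι ⊕ κ)) : sumInl (sumFst z) + sumInr (sumSnd z) = z := by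
  apply PiLp.ext
  rintro (i | i)
  · exact add_zero (z (Sum.inl i))
  · exact zero_add (z (Sum.inr i))

theorem sumFst_sumInl (y : L2Pow Γ ι) : sumFst (sumInl y : L2Pow Γ (ι ⊕ κ)) = y := rfl

theorem sumSnd_sumInl (y : L2Pow Γ ι) : sumSnd (sumInl y : L2Pow Γ (ι ⊕ κ)) = 0 := rfl

theorem sumFst_sumInr (y : L2Pow Γ κ) : sumFst (sumInr y : L2Pow Γ (ι ⊕ κ)) = 0 := rfl

theorem sumSnd_sumInr (y : L2Pow Γ κ) : sumSnd (sumInr y : L2Pow Γ (ι ⊕ κ)) = y := rfl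

theorem inner_sum (x y : L2Pow Γ (ι ⊕ κ)) :
    inner ℂ x y = inner ℂ (sumFst x) (sumFst y) + inner ℂ (sumSnd x) (sumSnd y) := by
  simp only [PiLp.inner_apply, Fintype.sum_sum_type]
  rfl

theorem isEquivariant_sumFst : IsEquivariant (sumFst : L2Pow Γ (ι ⊕ κ) →L[ℂ] L2Pow Γ ι) :=
  fun _ _ => rfl

theorem isEquivariant_sumSnd : IsEquivariant (sumSnd : L2Pow Γ (ι ⊕ κ) →L[ℂ] L2Pow Γ κ) :=
  fun _ _ => rfl

theorem IsEquivariant.sumPair {μ : Type*} [Fintype μ] {S : L2Pow Γ μ →L[ℂ] L2Pow Γ ι}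
    {T : L2Pow Γ μ →L[ℂ] L2Pow Γ κ} (hS : IsEquivariant S) (hT : IsEquivariant T) :
    IsEquivariant (sumPair S T) := fun g x => by
  apply sum_ext
  · exact hS g x
  · exact hT g x

/-- The direct sum of the closures of two subspaces. -/
def sumSub (V : Submodule ℂ (L2Pow Γ ι)) (W : Submodule ℂ (L2Pow Γ κ)) :
    Submodule ℂ (L2Pow Γ (ι ⊕ κ)) :=
  V.topologicalClosure.comap sumFst.toLinearMap ⊓ W.topologicalClosure.comap sumSnd.toLinearMap

theorem mem_sumSub {V : Submodule ℂ (L2Pow Γ ι)} {W : Submodule ℂ (L2Pow Γ κ)}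
    {x : L2Pow Γ (ι ⊕ κ)} :
    x ∈ sumSub V W ↔ sumFst x ∈ V.topologicalClosure ∧ sumSnd x ∈ W.topologicalClosure := Iff.rfl

theorem projCl_sumSub (V : Submodule ℂ (L2Pow Γ ι)) (W : Submodule ℂ (L2Pow Γ κ))
    (x : L2Pow Γ (ι ⊕ κ)) :
    projCl (sumSub V W) x = sumPair (projCl V ∘L sumFst) (projCl W ∘L sumSnd) x := by
  refine projCl_eq_of_mem (Submodule.le_topologicalClosure _ ?_) fun w hw => ?_
  · exact ⟨projCl_mem V _, projCl_mem W _⟩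
  · rw [inner_sum, map_sub, map_sub, sumFst_sumPair, sumSnd_sumPair]
    have h1 := Submodule.sub_starProjection_mem_orthogonal (K := V.topologicalClosure)
      (sumFst x) _ hw.1
    have h2 := Submodule.sub_starProjection_mem_orthogonal (K := W.topologicalClosure)
      (sumSnd x) _ hw.2
    rw [← add_zero (0 : ℂ)]
    exact congrArg₂ (· + ·) h1 h2

theorem hilbertDim_sumSub (V : Submodule ℂ (L2Pow Γ ι)) (W : Submodule ℂ (L2Pow Γ κ)) :
    hilbertDim (sumSub V W) = hilbertDim V + hilbertDim W := by
  classical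
  have h1 : ∀ i : ι, sumFst (basisVec (Sum.inl i : ι ⊕ κ) (1 : Γ)) = basisVec i 1 := by
    intro i
    apply PiLp.ext
    intro j
    by_cases h : j = i <;> simp [sumFst, basisVec, h]
  have h2 : ∀ i : κ, sumSnd (basisVec (Sum.inr i : ι ⊕ κ) (1 : Γ)) = basisVec i 1 := by
    intro i
    apply PiLp.ext
    intro j
    by_cases h : j = i <;> simp [sumSnd, basisVec, h]
  simp only [hilbertDim, opTrace, Fintype.sum_sum_type, Complex.add_re]
  congr 2
  · refine Finset.sum_congr rfl fun i _ => ?_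
    rw [projCl_sumSub]
    change ((projCl V (sumFst (basisVec (Sum.inl i) 1)) i : L2 Γ) : Γ → ℂ) 1 = _
    rw [h1]
  · refine Finset.sum_congr rfl fun i _ => ?_
    rw [projCl_sumSub]
    change ((projCl W (sumSnd (basisVec (Sum.inr i) 1)) i : L2 Γ) : Γ → ℂ) 1 = _
    rw [h2]

end DirectSum

/-! ### The dimension of finitely presented modules over `N(Γ)` -/

section VNDim

variable {Γ : Type*} [Group Γ] {r : ℕ} {σ : Type*} [Fintype σ]

theorem rowOp_sum (v : Fin r ⊕ σ → VN Γ) (x : L2Pow Γ (Fin r ⊕ σ)) :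
    rowOp v x = rowOp (fun i => v (Sum.inl i)) (sumFst x) +
      rowOp (fun i => v (Sum.inr i)) (sumSnd x) := by
  simp only [rowOp_apply, Fintype.sum_sum_type]
  rfl

theorem rowOp_add_apply {ι : Type*} [Fintype ι] (v w : ι → VN Γ) (x : L2Pow Γ ι) :
    rowOp (v + w) x = rowOp v x + rowOp w x := by
  simp [rowOp_apply, Finset.sum_add_distrib]

theorem rowOp_zero {ι : Type*} [Fintype ι] (x : L2Pow Γ ι) : rowOp (0 : ι → VN Γ) x = 0 := by
  simp [rowOp_apply]

theorem matOp_comp_self_of_idempotent {k : ℕ} {e : Matrix (Fin k) (Fin k) (VN Γ)} (he : e * e = e) :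
    matOp e ∘L matOp e = matOp e := by
  ext1 x
  rw [comp_apply, ← matOp_mul, he]

theorem hilbertDim_range_matOp_of_idempotent {k : ℕ} {e : Matrix (Fin k) (Fin k) (VN Γ)}
    (he : e * e = e) : hilbertDim (LinearMap.range (matOp e).toLinearMap) =
      (∑ i, vnTrace (e i i)).re := by
  rw [hilbertDim_range_of_idempotent (isEquivariant_matOp e) (matOp_comp_self_of_idempotent he),
    opTrace_matOp]

/-- Suppose that a row `v e` vanishes whenever `v e B` lies in the row space of `A`. Then the closure
of the range of `x ↦ (B x, A x)` contains `(e y, 0)` for all `y`, because the rows of the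
complementary projection annihilate these vectors. -/
theorem range_idempotent_le_of_independent {k : ℕ} (A : Matrix σ (Fin r) (VN Γ))
    (e : Matrix (Fin k) (Fin k) (VN Γ)) (B : Matrix (Fin k) (Fin r) (VN Γ)) (hB : e * B = B)
    (hind : ∀ (v : Fin k → VN Γ) (w : σ → VN Γ),
      Matrix.vecMul (Matrix.vecMul v e) B = Matrix.vecMul w A → Matrix.vecMul v e = 0)
    (y : L2Pow Γ (Fin k)) :
    (sumInl (matOp e y) : L2Pow Γ (Fin k ⊕ σ)) ∈
      (LinearMap.range (sumPair (matOp B) (matOp A)).toLinearMap).topologicalClosure := by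
  set C := sumPair (matOp B) (matOp A) with hC
  have hCeq : IsEquivariant C := (isEquivariant_matOp B).sumPair (isEquivariant_matOp A)
  obtain ⟨Q, hQ⟩ := (IsEquivariant.id.sub hCeq.projCl_range).exists_matOp
  have hrow : ∀ j, Matrix.vecMul (fun i => Q j (Sum.inl i)) e = 0 := by
    intro j
    refine hind _ (-fun i => Q j (Sum.inr i)) ?_
    rw [Matrix.vecMul_vecMul, hB, Matrix.neg_vecMul, eq_neg_iff_add_eq_zero]
    apply rowOp_injective
    intro x
    rw [rowOp_add_apply, rowOp_zero, rowOp_vecMul, rowOp_vecMul]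
    have h0 : matOp Q (C x) = 0 := by
      rw [hQ, sub_apply, projCl_eq_self (Submodule.le_topologicalClosure _
        (show C x ∈ LinearMap.range C.toLinearMap from ⟨x, rfl⟩))]
      simp
    have h1 := congrArg (fun z : L2Pow Γ (Fin k ⊕ σ) => z j) h0
    exact (rowOp_sum (Q j) (C x)).symm.trans h1
  have hz : matOp Q (sumInl (matOp e y) : L2Pow Γ (Fin k ⊕ σ)) = 0 := by
    apply PiLp.ext
    intro j
    rw [matOp_apply, rowOp_sum, sumFst_sumInl, sumSnd_sumInl, ← rowOp_vecMul, hrow, rowOp_zero]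
    simp
  rw [hQ, sub_apply, id_apply, sub_eq_zero] at hz
  rw [hz]
  exact projCl_mem _ _

/-- The dimension of a finitely generated projective submodule `N(Γ)^k e` of a quotient of row
modules is at most the difference of the dimensions of the annihilated subspaces. -/
theorem hilbertDim_range_idempotent_le {k : ℕ} (A : Matrix σ (Fin r) (VN Γ))
    (V : Submodule ℂ (L2Pow Γ (Fin r))) (hVA : V ≤ LinearMap.ker (matOp A).toLinearMap)
    (e : Matrix (Fin k) (Fin k) (VN Γ)) (B : Matrix (Fin k) (Fin r) (VN Γ)) (hB : e * B = B)
    (hVB : V ≤ LinearMap.ker (matOp B).toLinearMap)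
    (hind : ∀ (v : Fin k → VN Γ) (w : σ → VN Γ),
      Matrix.vecMul (Matrix.vecMul v e) B = Matrix.vecMul w A → Matrix.vecMul v e = 0) :
    hilbertDim (LinearMap.range (matOp e).toLinearMap) ≤
      hilbertDim (LinearMap.ker (matOp A).toLinearMap) - hilbertDim V := by
  set C := sumPair (matOp B) (matOp A) with hC
  have hCeq : IsEquivariant C := (isEquivariant_matOp B).sumPair (isEquivariant_matOp A)
  set W := (LinearMap.range C.toLinearMap).topologicalClosure with hW
  have hWcl : IsClosed (W : Set (L2Pow Γ (Fin k ⊕ σ))) := Submodule.isClosed_topologicalClosure _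
  have hinl : ∀ y ∈ (LinearMap.range (matOp e).toLinearMap).topologicalClosure,
      (sumInl y : L2Pow Γ (Fin k ⊕ σ)) ∈ W := by
    intro y hy
    have hpre := hWcl.preimage (sumInl : L2Pow Γ (Fin k) →L[ℂ] L2Pow Γ (Fin k ⊕ σ)).continuous
    refine closure_minimal (s := (LinearMap.range (matOp e).toLinearMap : Set (L2Pow Γ (Fin k))))
      ?_ hpre hy
    rintro _ ⟨z, rfl⟩
    exact range_idempotent_le_of_independent A e B hB hind z
  have hinr : ∀ y ∈ (LinearMap.range (matOp A).toLinearMap).topologicalClosure,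
      (sumInr y : L2Pow Γ (Fin k ⊕ σ)) ∈ W := by
    intro y hy
    have hpre := hWcl.preimage (sumInr : L2Pow Γ σ →L[ℂ] L2Pow Γ (Fin k ⊕ σ)).continuous
    refine closure_minimal (s := (LinearMap.range (matOp A).toLinearMap : Set (L2Pow Γ σ)))
      ?_ hpre hy
    rintro _ ⟨z, rfl⟩
    have h1 : C z ∈ W :=
      Submodule.le_topologicalClosure _ (show C z ∈ LinearMap.range C.toLinearMap from ⟨z, rfl⟩)
    have h2 := hinl (matOp B z) (Submodule.le_topologicalClosure _
      ⟨matOp B z, by change matOp e (matOp B z) = _; rw [← matOp_mul, hB]⟩)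
    have h3 : C z = sumInl (matOp B z) + sumInr (matOp A z) := (sumInl_add_sumInr (C z)).symm
    rw [h3] at h1
    exact (W.add_mem_iff_right h2).1 h1
  have hle : sumSub (LinearMap.range (matOp e).toLinearMap)
      (LinearMap.range (matOp A).toLinearMap) ≤ W := by
    intro z hz
    rw [← sumInl_add_sumInr z]
    exact W.add_mem (hinl _ hz.1) (hinr _ hz.2)
  have h1 := hilbertDim_mono hle
  rw [hilbertDim_sumSub] at h1
  have h2 := hilbertDim_range_add_hilbertDim_ker hCeq
  have h3 := hilbertDim_range_add_hilbertDim_ker (isEquivariant_matOp A)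
  have h4 : hilbertDim V ≤ hilbertDim (LinearMap.ker C.toLinearMap) := by
    refine hilbertDim_mono (le_trans ?_ (Submodule.le_topologicalClosure _))
    intro x hx
    change C x = 0
    apply sum_ext
    · rw [map_zero]; exact hVB hx
    · rw [map_zero]; exact hVA hx
  linarith

/-- The dimension of the module of rows annihilating `V` modulo the row space of `A` is the dimension
of the orthogonal complement of `V` in the kernel of `A`. This bounds the dimensions of all finitely
generated projective submodules by rank-nullity, and the bound is attained because the rows of the
projection onto that complement form a projective submodule. -/
theorem vnDim_eq_of_surjective (A : Matrix σ (Fin r) (VN Γ)) (V : Submodule ℂ (L2Pow Γ (Fin r)))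
    (hV : ∀ (g : Γ), ∀ x ∈ V, rightShift g x ∈ V)
    (hVA : V ≤ LinearMap.ker (matOp A).toLinearMap)
    {K : Submodule (VN Γ) (Fin r → VN Γ)} (hK : ∀ v, v ∈ K ↔ ∀ x ∈ V, rowOp v x = 0)
    {M : Type*} [AddCommGroup M] [Module (VN Γ) M] (q : K →ₗ[VN Γ] M)
    (hq : Function.Surjective q) (hker : ∀ v : K, q v = 0 ↔ ∃ w, (v : Fin r → VN Γ) =
      Matrix.vecMul w A) :
    vnDim (Γ := Γ) M = ENNReal.ofReal
      (hilbertDim (LinearMap.ker (matOp A).toLinearMap) - hilbertDim V) := by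
  set U := LinearMap.ker (matOp A).toLinearMap with hU
  have hUcl : U.topologicalClosure = U := ker_topologicalClosure (matOp A)
  have hVU : V.topologicalClosure ≤ U := Submodule.topologicalClosure_minimal _ hVA
    (ContinuousLinearMap.isClosed_ker (matOp A))
  refine le_antisymm ?_ ?_
  · -- a projective submodule is lifted to rows and compared by rank-nullity
    refine iSup_le fun k => iSup_le fun e => iSup_le fun he => iSup_le fun f => iSup_le fun hf => ?_
    refine ENNReal.ofReal_le_ofReal ?_
    rw [← hilbertDim_range_matOp_of_idempotent he]
    have hmem : ∀ v : Fin k → VN Γ, Matrix.vecMul v e ∈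
        LinearMap.range (Matrix.toLinearMapRight' e) := fun v => ⟨v, by simp⟩
    choose b hb using fun j : Fin k => hq (f ⟨_, hmem (Pi.single j 1)⟩)
    -- the matrix of a lift of `f` to a map from `N(Γ)^k` to the rows annihilating `V`
    set B₀ : Matrix (Fin k) (Fin r) (VN Γ) := Matrix.of fun j => (b j : Fin r → VN Γ) with hB₀
    have hbV : ∀ x ∈ V, matOp B₀ x = 0 := by
      intro x hx
      apply PiLp.ext
      intro j
      exact (hK _).1 (b j).2 x hx
    have hvec : ∀ v : Fin k → VN Γ, Matrix.vecMul v B₀ = ((∑ j, v j • b j : K) : Fin r → VN Γ) := by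
      intro v
      rw [Submodule.coe_sum]
      ext i
      simp [Matrix.vecMul, dotProduct, hB₀]
    have hfv : ∀ v : Fin k → VN Γ, f ⟨_, hmem v⟩ = q (∑ j, v j • b j) := by
      intro v
      rw [map_sum]
      simp only [map_smul, hb]
      rw [← Finset.sum_congr rfl fun j _ => map_smul f (v j) _, ← map_sum]
      congr 1
      apply Subtype.ext
      rw [Submodule.coe_sum]
      ext i
      simp [Matrix.vecMul, dotProduct]
    refine hilbertDim_range_idempotent_le A V hVA e (e * B₀) (by rw [← Matrix.mul_assoc, he]) ?_ ?_
    · intro x hx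
      change matOp (e * B₀) x = 0
      rw [matOp_mul, hbV x hx, map_zero]
    · intro v w hvw
      rw [← Matrix.vecMul_vecMul, Matrix.vecMul_vecMul v e e, he, hvec] at hvw
      have h0 := (hker _).2 ⟨w, hvw⟩
      rw [← hfv, ← map_zero f] at h0
      have h1 := congrArg Subtype.val (hf h0)
      simpa [Matrix.vecMul_vecMul, he] using h1
  · -- the rows of the projection onto the orthogonal complement of `V` in the kernel
    have hUinv : IsEquivariant (projCl U) := (isEquivariant_matOp A).projCl_ker
    obtain ⟨e, he⟩ := (hUinv.sub (isEquivariant_projCl hV)).exists_matOp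
    have hPU : ∀ x, projCl U x ∈ U := fun x => by
      have := projCl_mem U x
      rwa [hUcl] at this
    have hPV : ∀ x, projCl V x ∈ U := fun x => hVU (projCl_mem V x)
    have hUV : ∀ x, projCl U (projCl V x) = projCl V x := fun x =>
      projCl_eq_self (by rw [hUcl]; exact hPV x)
    have hVUx : ∀ x, projCl V (projCl U x) = projCl V x := fun x =>
      congrArg (fun S : L2Pow Γ (Fin r) →L[ℂ] L2Pow Γ (Fin r) => S x)
        (Submodule.starProjection_comp_starProjection_of_le
          (hVU.trans (Submodule.le_topologicalClosure U)))
    have hee : e * e = e := by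
      apply matOp_injective
      intro x
      rw [matOp_mul, he]
      simp only [sub_apply, map_sub, hUV, hVUx, projCl_eq_self (projCl_mem V x),
        projCl_eq_self (projCl_mem U x)]
      abel
    have hrange : LinearMap.range (Matrix.toLinearMapRight' e) ≤ K := by
      rintro _ ⟨v, rfl⟩
      rw [hK]
      intro x hx
      have hx' := V.le_topologicalClosure hx
      rw [Matrix.toLinearMapRight'_apply, rowOp_vecMul, he, sub_apply, projCl_eq_self hx',
        projCl_eq_self (by rw [hUcl]; exact hVU hx'), sub_self, map_zero]
    refine le_iSup_of_le r (le_iSup_of_le e (le_iSup_of_le hee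
      (le_iSup_of_le (q ∘ₗ Submodule.inclusion hrange) (le_iSup_of_le ?_ ?_))))
    · rw [← LinearMap.ker_eq_bot, LinearMap.ker_eq_bot']
      rintro ⟨_, v, rfl⟩ h0
      obtain ⟨w, hw⟩ := (hker _).1 h0
      simp only [Matrix.toLinearMapRight'_apply, Submodule.coe_inclusion] at hw
      apply Subtype.ext
      simp only [Matrix.toLinearMapRight'_apply, Submodule.coe_zero]
      apply rowOp_injective
      intro x
      rw [← hee, ← Matrix.vecMul_vecMul, rowOp_vecMul, hw, rowOp_vecMul, he, sub_apply, map_sub,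
        show matOp A (projCl U x) = 0 from hPU x, show matOp A (projCl V x) = 0 from hPV x]
      simp [rowOp_zero]
    · rw [← opTrace_matOp, he, opTrace_sub, Complex.sub_re]
      rfl

end VNDim

end

section

open CategoryTheory TensorProduct

/-! ### Homology of pairs of composable linear maps -/

section Homology

variable {R : Type*} [Ring R] {X Y Z X' Y' Z' : Type*}
  [AddCommGroup X] [AddCommGroup Y] [AddCommGroup Z] [Module R X] [Module R Y] [Module R Z]
  [AddCommGroup X'] [AddCommGroup Y'] [AddCommGroup Z'] [Module R X'] [Module R Y'] [Module R Z']

/-- `M` is a model of the homology `ker g / im f` of `X → Y → Z`. -/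
def IsHomologyOf (f : X →ₗ[R] Y) (g : Y →ₗ[R] Z) (M : Type*) [AddCommGroup M] [Module R M] : Prop :=
  ∃ q : LinearMap.ker g →ₗ[R] M, Function.Surjective q ∧
    ∀ x : LinearMap.ker g, q x = 0 ↔ ∃ y, f y = (x : Y)

theorem IsHomologyOf.of_equiv {f : X →ₗ[R] Y} {g : Y →ₗ[R] Z} {M N : Type*} [AddCommGroup M]
    [Module R M] [AddCommGroup N] [Module R N] (h : IsHomologyOf f g M) (e : M ≃ₗ[R] N) :
    IsHomologyOf f g N := by
  obtain ⟨q, hq, hk⟩ := h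
  exact ⟨e.toLinearMap ∘ₗ q, e.surjective.comp hq, fun x => by simp [hk]⟩

theorem IsHomologyOf.linearEquiv {f : X →ₗ[R] Y} {g : Y →ₗ[R] Z} {M N : Type*} [AddCommGroup M]
    [Module R M] [AddCommGroup N] [Module R N] (h : IsHomologyOf f g M) (h' : IsHomologyOf f g N) :
    Nonempty (M ≃ₗ[R] N) := by
  obtain ⟨q, hq, hk⟩ := h
  obtain ⟨q', hq', hk'⟩ := h'
  have hker : LinearMap.ker q = LinearMap.ker q' := by
    ext x
    rw [LinearMap.mem_ker, LinearMap.mem_ker, hk, hk']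
  exact ⟨(q.quotKerEquivOfSurjective hq).symm ≪≫ₗ Submodule.quotEquivOfEq _ _ hker ≪≫ₗ
    q'.quotKerEquivOfSurjective hq'⟩

/-- Homology is invariant under isomorphisms of the three terms. -/
theorem IsHomologyOf.congr {f : X →ₗ[R] Y} {g : Y →ₗ[R] Z} {f' : X' →ₗ[R] Y'} {g' : Y' →ₗ[R] Z'}
    {M : Type*} [AddCommGroup M] [Module R M] (h : IsHomologyOf f g M) (a : X ≃ₗ[R] X')
    (b : Y ≃ₗ[R] Y') (c : Z ≃ₗ[R] Z') (hf : ∀ x, b (f x) = f' (a x)) (hg : ∀ y, c (g y) = g' (b y)) :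
    IsHomologyOf f' g' M := by
  obtain ⟨q, hq, hk⟩ := h
  have hmem : ∀ y : LinearMap.ker g', b.symm y ∈ LinearMap.ker g := by
    intro y
    rw [LinearMap.mem_ker, ← c.map_eq_zero_iff, hg, b.apply_symm_apply]
    exact y.2
  refine ⟨q ∘ₗ (b.symm.toLinearMap.restrict (q := LinearMap.ker g) fun y hy => hmem ⟨y, hy⟩), ?_, ?_⟩
  · intro m
    obtain ⟨x, rfl⟩ := hq m
    refine ⟨⟨b x, ?_⟩, ?_⟩
    · rw [LinearMap.mem_ker, ← hg, x.2, map_zero]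
    · simp only [LinearMap.comp_apply]
      congr 1
      apply Subtype.ext
      simp
  · intro y
    rw [LinearMap.comp_apply, hk]
    constructor
    · rintro ⟨x, hx⟩
      refine ⟨a x, ?_⟩
      rw [← hf, hx]
      simp
    · rintro ⟨x, hx⟩
      refine ⟨a.symm x, b.injective ?_⟩
      rw [hf, a.apply_symm_apply, hx]
      simp

theorem isHomologyOf_shortComplex {R : Type} [Ring R] (S : ShortComplex (ModuleCat.{0} R)) :
    IsHomologyOf S.f.hom S.g.hom S.homology := by
  have h : IsHomologyOf S.f.hom S.g.hom
      (LinearMap.ker S.g.hom ⧸ LinearMap.range S.moduleCatToCycles) := by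
    refine ⟨(LinearMap.range S.moduleCatToCycles).mkQ, Submodule.mkQ_surjective _, fun x => ?_⟩
    rw [Submodule.mkQ_apply, Submodule.Quotient.mk_eq_zero, LinearMap.mem_range]
    refine exists_congr fun y => ?_
    rw [Subtype.ext_iff]
    rfl
  have h' : IsHomologyOf S.f.hom S.g.hom S.moduleCatLeftHomologyData.H := h
  exact h'.of_equiv S.moduleCatHomologyIso.symm.toLinearEquiv

end Homology

/-! ### Base change of representations to the group von Neumann algebra -/

section BaseChange

variable {Γ : Type} [Group Γ]

theorem toVN_one : toVN (1 : Γ) = 1 := by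
  apply vnVal_injective
  rw [vnVal_toVN, map_one]
  ext f h
  simp [leftTranslation_apply]

theorem toVN_mul (g h : Γ) : toVN (g * h) = toVN g * toVN h := by
  apply vnVal_injective
  rw [map_mul, vnVal_toVN, vnVal_toVN, vnVal_toVN]
  ext f x
  simp [leftTranslation_apply, mul_assoc]

variable (Γ) in
/-- The inclusion `ℂ[Γ] → N(Γ)`. -/
def groupAlgToVN : MonoidAlgebra ℂ Γ →ₐ[ℂ] VN Γ :=
  MonoidAlgebra.lift ℂ (VN Γ) Γ
    { toFun := toVN, map_one' := toVN_one, map_mul' := toVN_mul }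

theorem groupAlgToVN_single (g : Γ) (c : ℂ) :
    groupAlgToVN Γ (MonoidAlgebra.single g c) = c • toVN g := by
  rw [groupAlgToVN, MonoidAlgebra.lift_single]
  rfl

/-- The relations `g ⊗ m = 1 ⊗ g m` defining `N(Γ) ⊗_{ℂ[Γ]} M`. -/
def baseChangeRel (M : Rep.{0} ℂ Γ) : Submodule (VN Γ) (VN Γ ⊗[ℂ] M) :=
  Submodule.span (VN Γ) (Set.range fun p : Γ × M =>
    toVN p.1 ⊗ₜ[ℂ] p.2 - (1 : VN Γ) ⊗ₜ[ℂ] M.ρ p.1 p.2)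

/-- The base change `N(Γ) ⊗_{ℂ[Γ]} M`, constructed as a quotient of `N(Γ) ⊗_ℂ M`. -/
abbrev BaseChange (M : Rep.{0} ℂ Γ) : Type := (VN Γ ⊗[ℂ] M) ⧸ baseChangeRel M

/-- The class of `1 ⊗ m`. -/
def BaseChange.mk {M : Rep.{0} ℂ Γ} (m : M) : BaseChange M :=
  (baseChangeRel M).mkQ ((1 : VN Γ) ⊗ₜ[ℂ] m)

theorem BaseChange.mkQ_tmul {M : Rep.{0} ℂ Γ} (a : VN Γ) (m : M) :
    (baseChangeRel M).mkQ (a ⊗ₜ[ℂ] m) = a • BaseChange.mk m := by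
  rw [BaseChange.mk, ← map_smul, TensorProduct.smul_tmul', smul_eq_mul, mul_one]

theorem BaseChange.mk_add {M : Rep.{0} ℂ Γ} (m m' : M) :
    BaseChange.mk (m + m') = BaseChange.mk m + BaseChange.mk m' := by
  simp only [BaseChange.mk, TensorProduct.tmul_add, map_add]

theorem BaseChange.mk_smul {M : Rep.{0} ℂ Γ} (c : ℂ) (m : M) :
    BaseChange.mk (c • m) = (algebraMap ℂ (VN Γ) c) • BaseChange.mk m := by
  rw [← BaseChange.mkQ_tmul, BaseChange.mk, ← TensorProduct.smul_tmul,
    Algebra.algebraMap_eq_smul_one]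

theorem BaseChange.mk_rho {M : Rep.{0} ℂ Γ} (g : Γ) (m : M) :
    BaseChange.mk (M.ρ g m) = toVN g • BaseChange.mk m := by
  rw [← BaseChange.mkQ_tmul, BaseChange.mk, eq_comm, ← sub_eq_zero, ← map_sub,
    Submodule.mkQ_apply, Submodule.Quotient.mk_eq_zero]
  exact Submodule.subset_span ⟨(g, m), rfl⟩

theorem BaseChange.hom_ext {M : Rep.{0} ℂ Γ} {X : Type} [AddCommGroup X] [Module (VN Γ) X]
    {φ ψ : BaseChange M →ₗ[VN Γ] X} (h : ∀ m, φ (BaseChange.mk m) = ψ (BaseChange.mk m)) :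
    φ = ψ := by
  refine Submodule.linearMap_qext _ (LinearMap.ext fun x => ?_)
  induction x with
  | zero => simp
  | tmul a m =>
    simp only [LinearMap.comp_apply, BaseChange.mkQ_tmul, map_smul, h]
  | add x y hx hy => rw [map_add, map_add, hx, hy]

/-- The `N(Γ)`-linear extension of an equivariant linear map. -/
def BaseChange.lift {M : Rep.{0} ℂ Γ} {X : Type} [AddCommGroup X] [Module (VN Γ) X] [Module ℂ X]
    [IsScalarTower ℂ (VN Γ) X] (φ : M →ₗ[ℂ] X) (hφ : ∀ g m, φ (M.ρ g m) = toVN g • φ m) :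
    BaseChange M →ₗ[VN Γ] X :=
  (baseChangeRel M).liftQ
    (TensorProduct.AlgebraTensorModule.lift
      (LinearMap.toSpanSingleton (VN Γ) (M →ₗ[ℂ] X) φ)) <| by
    rw [baseChangeRel, Submodule.span_le]
    rintro _ ⟨⟨g, m⟩, rfl⟩
    simp [hφ]

theorem BaseChange.lift_mk {M : Rep.{0} ℂ Γ} {X : Type} [AddCommGroup X] [Module (VN Γ) X]
    [Module ℂ X] [IsScalarTower ℂ (VN Γ) X] (φ : M →ₗ[ℂ] X)
    (hφ : ∀ g m, φ (M.ρ g m) = toVN g • φ m) (m : M) :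
    BaseChange.lift φ hφ (BaseChange.mk m) = φ m := by
  simp [BaseChange.lift, BaseChange.mk]

/-- The map induced on base changes by a morphism of representations. -/
def BaseChange.map {M N : Rep.{0} ℂ Γ} (f : M ⟶ N) : BaseChange M →ₗ[VN Γ] BaseChange N :=
  (baseChangeRel M).mapQ (baseChangeRel N)
    (TensorProduct.AlgebraTensorModule.map LinearMap.id f.hom.toLinearMap) <| by
    rw [baseChangeRel, Submodule.span_le]
    rintro _ ⟨⟨g, m⟩, rfl⟩
    refine Submodule.subset_span ⟨(g, f.hom m), ?_⟩
    simp [Rep.hom_comm_apply]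

theorem BaseChange.map_mk {M N : Rep.{0} ℂ Γ} (f : M ⟶ N) (m : M) :
    BaseChange.map f (BaseChange.mk m) = BaseChange.mk (f.hom m) := by
  simp [BaseChange.map, BaseChange.mk]

variable (Γ) in
/-- Base change as a functor. -/
def baseChangeFunctor : Rep.{0} ℂ Γ ⥤ ModuleCat.{0} (VN Γ) where
  obj M := ModuleCat.of (VN Γ) (BaseChange M)
  map f := ModuleCat.ofHom (BaseChange.map f)
  map_id M := by
    refine ModuleCat.hom_ext (BaseChange.hom_ext fun m => ?_)
    exact BaseChange.map_mk (𝟙 M) m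
  map_comp f g := by
    refine ModuleCat.hom_ext (BaseChange.hom_ext fun m => ?_)
    rw [ModuleCat.hom_ofHom, ModuleCat.hom_comp, LinearMap.comp_apply, ModuleCat.hom_ofHom,
      ModuleCat.hom_ofHom, BaseChange.map_mk, BaseChange.map_mk, BaseChange.map_mk]
    rfl

instance : (baseChangeFunctor Γ).Additive where
  map_add {M N f g} := by
    refine ModuleCat.hom_ext (BaseChange.hom_ext fun m => ?_)
    change BaseChange.map (f + g) _ = BaseChange.map f _ + BaseChange.map g _
    rw [BaseChange.map_mk, BaseChange.map_mk, BaseChange.map_mk, ← BaseChange.mk_add]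
    rfl

theorem mapRange_groupAlgToVN_rho {α : Type} (g : Γ) (m : Rep.free ℂ Γ α) :
    Finsupp.mapRange.linearMap (groupAlgToVN Γ).toLinearMap ((Rep.free ℂ Γ α).ρ g m) =
      toVN g • Finsupp.mapRange.linearMap (groupAlgToVN Γ).toLinearMap m := by
  induction m using Finsupp.induction_linear with
  | zero => simp
  | add x y hx hy => rw [map_add, map_add, hx, hy, map_add, smul_add]
  | single i x =>
    induction x using MonoidAlgebra.induction_linear with
    | zero => simp
    | add x y hx hy =>
      rw [Finsupp.single_add, map_add, map_add, hx, hy, map_add, smul_add]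
    | single h c =>
      rw [Representation.free_single_single]
      simp [groupAlgToVN_single, toVN_mul]

/-- The map from the base change of a free representation to the free `N(Γ)`-module on the same
basis. -/
def freeToFinsupp (α : Type) : BaseChange (Rep.free ℂ Γ α) →ₗ[VN Γ] (α →₀ VN Γ) :=
  BaseChange.lift (M := Rep.free ℂ Γ α) (Finsupp.mapRange.linearMap (groupAlgToVN Γ).toLinearMap)
    mapRange_groupAlgToVN_rho

theorem freeToFinsupp_mk_single {α : Type} (i : α) (x : MonoidAlgebra ℂ Γ) :
    freeToFinsupp α (BaseChange.mk (M := Rep.free ℂ Γ α) (Finsupp.single i x)) =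
      Finsupp.single i (groupAlgToVN Γ x) := by
  rw [freeToFinsupp, BaseChange.lift_mk]
  simp

theorem BaseChange.mk_single {α : Type} (i : α) (x : MonoidAlgebra ℂ Γ) :
    BaseChange.mk (M := Rep.free ℂ Γ α) (Finsupp.single i x) =
      groupAlgToVN Γ x • BaseChange.mk (M := Rep.free ℂ Γ α)
        (Finsupp.single i (MonoidAlgebra.single 1 1)) := by
  induction x using MonoidAlgebra.induction_linear with
  | zero =>
    rw [Finsupp.single_zero, map_zero, zero_smul]
    simp [BaseChange.mk]
  | add x y hx hy => rw [Finsupp.single_add, BaseChange.mk_add, hx, hy, map_add, add_smul]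
  | single g c =>
    have h : (Finsupp.single i (MonoidAlgebra.single g c) : Rep.free ℂ Γ α) =
        c • (Rep.free ℂ Γ α).ρ g (Finsupp.single i (MonoidAlgebra.single 1 1)) := by
      rw [Representation.free_single_single]
      simp
    rw [h, BaseChange.mk_smul, BaseChange.mk_rho, groupAlgToVN_single, smul_smul,
      Algebra.smul_def]

/-- The base change of a free representation is free. -/
def baseChangeFree (α : Type) : BaseChange (Rep.free ℂ Γ α) ≃ₗ[VN Γ] (α →₀ VN Γ) :=
  LinearEquiv.ofLinearMap (freeToFinsupp α)
    (Finsupp.linearCombination (VN Γ) fun i => BaseChange.mk (M := Rep.free ℂ Γ α)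
      (Finsupp.single i (MonoidAlgebra.single 1 1)))
    (by
      refine Finsupp.lhom_ext fun i a => ?_
      rw [LinearMap.comp_apply, Finsupp.linearCombination_single, map_smul,
        freeToFinsupp_mk_single, groupAlgToVN_single]
      simp [toVN_one])
    (by
      refine BaseChange.hom_ext fun m => ?_
      induction m using Finsupp.induction_linear with
      | zero => simp [BaseChange.mk]
      | add x y hx hy => rw [BaseChange.mk_add, map_add, map_add, hx, hy]
      | single i x =>
        rw [LinearMap.comp_apply, freeToFinsupp_mk_single, Finsupp.linearCombination_single,
          ← BaseChange.mk_single]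
        rfl)

theorem baseChangeFree_mk_single {α : Type} (i : α) (x : MonoidAlgebra ℂ Γ) :
    baseChangeFree α (BaseChange.mk (M := Rep.free ℂ Γ α) (Finsupp.single i x)) =
      Finsupp.single i (groupAlgToVN Γ x) := freeToFinsupp_mk_single i x

theorem baseChangeFree_symm_single {α : Type} (i : α) (a : VN Γ) :
    (baseChangeFree α).symm (Finsupp.single i a) = a • BaseChange.mk (M := Rep.free ℂ Γ α)
      (Finsupp.single i (MonoidAlgebra.single 1 1)) :=
  Finsupp.linearCombination_single _ _ _

theorem baseChangeFree_mk {α : Type} (m : Rep.free ℂ Γ α) :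
    baseChangeFree α (BaseChange.mk m) =
      Finsupp.mapRange.linearMap (groupAlgToVN Γ).toLinearMap m :=
  BaseChange.lift_mk (M := Rep.free ℂ Γ α) _ mapRange_groupAlgToVN_rho m

theorem baseChangeFree_barDiff (i : ℕ) :
    (baseChangeFree (Fin i → Γ)).toLinearMap ∘ₗ BaseChange.map (Rep.barComplex.d ℂ Γ i) =
      (vnDiff Γ i : ((Fin (i + 1) → Γ) →₀ VN Γ) →ₗ[VN Γ] ((Fin i → Γ) →₀ VN Γ)) ∘ₗ
        (baseChangeFree (Fin (i + 1) → Γ)).toLinearMap := by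
  have key : ∀ g : Fin (i + 1) → Γ, baseChangeFree (Fin i → Γ) (BaseChange.map
      (Rep.barComplex.d ℂ Γ i) (BaseChange.mk (M := Rep.free ℂ Γ (Fin (i + 1) → Γ))
        (Finsupp.single g (MonoidAlgebra.single 1 1)))) =
      Finsupp.single (fun j => g j.succ) (toVN (g 0)) +
        ∑ j : Fin (i + 1), Finsupp.single (Fin.contractNth j (· * ·) g)
          ((-1 : VN Γ) ^ ((j : ℕ) + 1)) := by
    intro g
    rw [BaseChange.map_mk, Rep.barComplex.d_single, baseChangeFree_mk, map_add, map_sum]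
    congr 1
    · simp [groupAlgToVN_single]
    · refine Finset.sum_congr rfl fun j _ => ?_
      simp only [Finsupp.mapRange.linearMap_apply, Finsupp.mapRange_single,
        AlgHom.toLinearMap_apply, groupAlgToVN_single, toVN_one]
      congr 1
      rw [← Algebra.algebraMap_eq_smul_one, map_pow, map_neg, map_one]
  have h : (baseChangeFree (Fin i → Γ)).toLinearMap ∘ₗ BaseChange.map (Rep.barComplex.d ℂ Γ i) ∘ₗ
      (baseChangeFree (Fin (i + 1) → Γ)).symm.toLinearMap =
      (vnDiff Γ i : ((Fin (i + 1) → Γ) →₀ VN Γ) →ₗ[VN Γ] ((Fin i → Γ) →₀ VN Γ)) := by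
    refine Finsupp.lhom_ext (R := VN Γ) (M := VN Γ) (N := (Fin i → Γ) →₀ VN Γ) fun g a => ?_
    refine Eq.trans ?_ (Finsupp.linearCombination_single (M := VNChains Γ i) (VN Γ) a g).symm
    have h1 : (baseChangeFree (Fin (i + 1) → Γ)).symm (Finsupp.single g a) = _ :=
      baseChangeFree_symm_single g a
    refine (congrArg (fun z => baseChangeFree (Fin i → Γ)
      (BaseChange.map (Rep.barComplex.d ℂ Γ i) z)) h1).trans ?_
    exact (congrArg (baseChangeFree (Fin i → Γ)) (LinearMap.map_smul _ a _)).trans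
      (((baseChangeFree (Fin i → Γ)).map_smul a _).trans
        (congrArg (fun z : (Fin i → Γ) →₀ VN Γ => a • z) (key g)))
  rw [← h]
  refine LinearMap.ext fun x => ?_
  exact congrArg (fun z => baseChangeFree (Fin i → Γ) (BaseChange.map (Rep.barComplex.d ℂ Γ i) z))
    ((baseChangeFree (Fin (i + 1) → Γ)).symm_apply_apply x).symm

end BaseChange

/-! ### The dimension of homology in terms of ranks of matrices -/

section Betti

variable {Γ : Type*} [Group Γ]

/-- The von Neumann rank of a matrix over `N(Γ)`: the dimension of the closure of its image. -/
def vnRank {ι κ : Type*} [Fintype ι] [Fintype κ] (A : Matrix κ ι (VN Γ)) : ℝ :=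
  hilbertDim (LinearMap.range (matOp A).toLinearMap)

/-- The dimension of the subspace spanned by the ranges of `1 - e` and of `D = e D`, for an
idempotent `e`: the sum of the ranges is direct, so rank-nullity applies. -/
theorem hilbertDim_range_one_sub_add {r s : ℕ} (e : Matrix (Fin r) (Fin r) (VN Γ))
    (D : Matrix (Fin r) (Fin s) (VN Γ)) (he : e * e = e) (hD : e * D = D) :
    hilbertDim (LinearMap.range
      (matOp (1 - e) ∘L sumFst + matOp D ∘L sumSnd :
        L2Pow Γ (Fin r ⊕ Fin s) →L[ℂ] L2Pow Γ (Fin r)).toLinearMap) =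
      r - vnRank e + vnRank D := by
  set C : L2Pow Γ (Fin r ⊕ Fin s) →L[ℂ] L2Pow Γ (Fin r) :=
    matOp (1 - e) ∘L sumFst + matOp D ∘L sumSnd with hC
  have hCeq : IsEquivariant C := ((isEquivariant_matOp _).comp isEquivariant_sumFst).add
    ((isEquivariant_matOp _).comp isEquivariant_sumSnd)
  have hCz : ∀ z, C z = matOp (1 - e) (sumFst z) + matOp D (sumSnd z) := fun z => rfl
  have hone : ∀ x, matOp (1 - e) x = x - matOp e x := fun x => by rw [matOp_sub, matOp_one]
  have hker : LinearMap.ker C.toLinearMap =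
      sumSub (LinearMap.range (matOp e).toLinearMap) (LinearMap.ker (matOp D).toLinearMap) := by
    have hcl : (LinearMap.range (matOp e).toLinearMap).topologicalClosure =
        LinearMap.ker (matOp (1 - e)).toLinearMap := by
      have : LinearMap.range (matOp e).toLinearMap = LinearMap.ker (matOp (1 - e)).toLinearMap := by
        ext x
        constructor
        · rintro ⟨y, rfl⟩
          change matOp (1 - e) (matOp e y) = 0
          rw [hone, ← matOp_mul, he, sub_self]
        · intro hx
          have hx : matOp (1 - e) x = 0 := hx
          rw [hone, sub_eq_zero] at hx
          exact ⟨x, hx.symm⟩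
      rw [this, ker_topologicalClosure]
    ext z
    rw [mem_sumSub, hcl, ker_topologicalClosure]
    change C z = 0 ↔ matOp (1 - e) (sumFst z) = 0 ∧ matOp D (sumSnd z) = 0
    rw [hCz]
    refine ⟨fun h => ?_, fun h => by rw [h.1, h.2, add_zero]⟩
    have h1 := congrArg (matOp e) h
    rw [map_add, map_zero, ← matOp_mul e D, hD, hone, map_sub, ← matOp_mul, he, sub_self,
      zero_add] at h1
    rw [h1, add_zero] at h
    exact ⟨h, h1⟩
  have h1 := hilbertDim_range_add_hilbertDim_ker hCeq
  rw [hker, hilbertDim_sumSub] at h1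
  have h2 := hilbertDim_range_add_hilbertDim_ker (isEquivariant_matOp D)
  simp only [Fintype.card_sum, Fintype.card_fin, Nat.cast_add] at h1 h2
  simp only [vnRank]
  linarith

/-- The dimension of the homology of a complex whose terms are retracts of free modules of finite
rank, in terms of the ranks of the matrices of the idempotent and of the two differentials. -/
theorem vnDim_eq_of_retract {X Y Z M : Type*} [AddCommGroup X] [AddCommGroup Y] [AddCommGroup Z]
    [AddCommGroup M] [Module (VN Γ) X] [Module (VN Γ) Y] [Module (VN Γ) Z] [Module (VN Γ) M]
    {f : X →ₗ[VN Γ] Y} {g : Y →ₗ[VN Γ] Z} (hM : IsHomologyOf f g M) (hgf : ∀ x, g (f x) = 0)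
    {r s t : ℕ} (aX : X →ₗ[VN Γ] Fin t → VN Γ) (bX : (Fin t → VN Γ) →ₗ[VN Γ] X)
    (aY : Y →ₗ[VN Γ] Fin r → VN Γ) (bY : (Fin r → VN Γ) →ₗ[VN Γ] Y)
    (aZ : Z →ₗ[VN Γ] Fin s → VN Γ) (bZ : (Fin s → VN Γ) →ₗ[VN Γ] Z)
    (hX : ∀ x, bX (aX x) = x) (hY : ∀ x, bY (aY x) = x) (hZ : ∀ x, bZ (aZ x) = x)
    (e : Matrix (Fin r) (Fin r) (VN Γ)) (D : Matrix (Fin r) (Fin s) (VN Γ))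
    (A : Matrix (Fin t) (Fin r) (VN Γ)) (he : ∀ v, aY (bY v) = Matrix.vecMul v e)
    (hD : ∀ v, aZ (g (bY v)) = Matrix.vecMul v D) (hA : ∀ v, aY (f (bX v)) = Matrix.vecMul v A) :
    0 ≤ vnRank e - vnRank D - vnRank A ∧
      vnDim (Γ := Γ) M = ENNReal.ofReal (vnRank e - vnRank D - vnRank A) := by
  have ext_rows : ∀ {k l : ℕ} {B B' : Matrix (Fin k) (Fin l) (VN Γ)},
      (∀ v, Matrix.vecMul v B = Matrix.vecMul v B') → B = B' := fun h =>
    (Matrix.toLinearMapRight').injective (LinearMap.ext fun v => by simpa using h v)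
  have hee : e * e = e := ext_rows fun v => by
    rw [← Matrix.vecMul_vecMul, ← he, ← he, hY]
  have heD : e * D = D := ext_rows fun v => by
    rw [← Matrix.vecMul_vecMul, ← hD, ← he, hY, hD]
  have hAe : A * e = A := ext_rows fun v => by
    rw [← Matrix.vecMul_vecMul, ← hA, ← he, hY]
  have hAD : A * D = 0 := ext_rows fun v => by
    rw [← Matrix.vecMul_vecMul, ← hA, ← hD, hY, hgf, map_zero, Matrix.vecMul_zero]
  set C : L2Pow Γ (Fin r ⊕ Fin s) →L[ℂ] L2Pow Γ (Fin r) :=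
    matOp (1 - e) ∘L sumFst + matOp D ∘L sumSnd with hC
  have hCeq : IsEquivariant C := ((isEquivariant_matOp _).comp isEquivariant_sumFst).add
    ((isEquivariant_matOp _).comp isEquivariant_sumSnd)
  have hCz : ∀ z, C z = matOp (1 - e) (sumFst z) + matOp D (sumSnd z) := fun z => rfl
  -- A row annihilates `V` if and only if it lies in `N(Γ)^r e` and is a cycle.
  set V := LinearMap.range C.toLinearMap with hV
  have hVinv : ∀ (g : Γ), ∀ x ∈ V, rightShift g x ∈ V := fun g x ⟨y, hy⟩ =>
    ⟨rightShift g y, by rw [← hy]; exact hCeq g y⟩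
  have hVA : V ≤ LinearMap.ker (matOp A).toLinearMap := by
    rintro _ ⟨z, rfl⟩
    change matOp A (C z) = 0
    rw [hCz, map_add, ← matOp_mul, ← matOp_mul, hAD, Matrix.mul_sub, hAe, Matrix.mul_one, sub_self,
      matOp_zero, matOp_zero, add_zero]
  have hdimV : hilbertDim V = r - vnRank e + vnRank D := hilbertDim_range_one_sub_add e D hee heD
  have hdimA := hilbertDim_range_add_hilbertDim_ker (isEquivariant_matOp A)
  have hmono := hilbertDim_mono (hVA.trans (Submodule.le_topologicalClosure _))
  have heq : hilbertDim (LinearMap.ker (matOp A).toLinearMap) - hilbertDim V =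
      vnRank e - vnRank D - vnRank A := by
    simp only [Fintype.card_fin] at hdimA
    simp only [vnRank] at hdimV ⊢
    linarith
  rw [← heq]
  refine ⟨by linarith, ?_⟩
  set K : Submodule (VN Γ) (Fin r → VN Γ) :=
    LinearMap.ker (LinearMap.id - aY ∘ₗ bY) ⊓ LinearMap.ker (aZ ∘ₗ g ∘ₗ bY) with hKdef
  have hKmem : ∀ v, v ∈ K ↔ v - Matrix.vecMul v e = 0 ∧ Matrix.vecMul v D = 0 := by
    intro v
    rw [← he, ← hD]
    rfl
  have hK : ∀ v, v ∈ K ↔ ∀ x ∈ V, rowOp v x = 0 := by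
    intro v
    rw [hKmem]
    have hrow : ∀ z, rowOp v (C z) =
        rowOp (v - Matrix.vecMul v e) (sumFst z) + rowOp (Matrix.vecMul v D) (sumSnd z) := by
      intro z
      rw [hCz, map_add, ← rowOp_vecMul, ← rowOp_vecMul, Matrix.vecMul_sub, Matrix.vecMul_one]
    constructor
    · rintro ⟨h1, h2⟩ _ ⟨z, rfl⟩
      change rowOp v (C z) = 0
      rw [hrow, h1, h2, rowOp_zero, rowOp_zero, add_zero]
    · intro h
      have h' : ∀ z, rowOp (v - Matrix.vecMul v e) (sumFst z) +
          rowOp (Matrix.vecMul v D) (sumSnd z) = 0 := fun z => by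
        rw [← hrow]; exact h _ ⟨z, rfl⟩
      constructor
      · apply rowOp_injective
        intro x
        have := h' (sumInl x)
        rw [sumFst_sumInl, sumSnd_sumInl, map_zero, add_zero] at this
        rw [this, rowOp_zero]
      · apply rowOp_injective
        intro x
        have := h' (sumInr x)
        rw [sumFst_sumInr, sumSnd_sumInr, map_zero, zero_add] at this
        rw [this, rowOp_zero]
  obtain ⟨q, hq, hker⟩ := hM
  have hbK : ∀ v ∈ K, bY v ∈ LinearMap.ker g := by
    intro v hv
    rw [LinearMap.mem_ker, ← hZ (g (bY v)), hD, ((hKmem v).1 hv).2, map_zero]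
  refine vnDim_eq_of_surjective A V hVinv hVA hK (q ∘ₗ bY.restrict hbK) ?_ ?_
  · intro m
    obtain ⟨⟨y, hy⟩, rfl⟩ := hq m
    refine ⟨⟨aY y, ?_⟩, ?_⟩
    · rw [hKmem, ← he, hY, sub_self, ← hD, hY, LinearMap.mem_ker.1 hy, map_zero]
      exact ⟨rfl, rfl⟩
    · rw [LinearMap.comp_apply]
      congr 1
      exact Subtype.ext (hY y)
  · rintro ⟨v, hv⟩
    rw [LinearMap.comp_apply, hker]
    change (∃ y, f y = bY v) ↔ ∃ w, v = Matrix.vecMul w A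
    constructor
    · rintro ⟨x, hx⟩
      refine ⟨aX x, ?_⟩
      rw [← hA, hX, hx, he]
      exact sub_eq_zero.1 ((hKmem v).1 hv).1
    · rintro ⟨w, rfl⟩
      exact ⟨bX w, by rw [← hA, hY]⟩

theorem vnDim_congr {M N : Type*} [AddCommGroup M] [AddCommGroup N] [Module (VN Γ) M]
    [Module (VN Γ) N] (φ : M ≃ₗ[VN Γ] N) : vnDim (Γ := Γ) M = vnDim (Γ := Γ) N := by
  refine le_antisymm ?_ ?_
  · refine iSup_le fun k => iSup_le fun e => iSup_le fun he => iSup_le fun f => iSup_le fun hf => ?_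
    exact le_iSup_of_le k (le_iSup_of_le e (le_iSup_of_le he (le_iSup_of_le (φ.toLinearMap ∘ₗ f)
      (le_iSup_of_le (φ.injective.comp hf) le_rfl))))
  · refine iSup_le fun k => iSup_le fun e => iSup_le fun he => iSup_le fun f => iSup_le fun hf => ?_
    exact le_iSup_of_le k (le_iSup_of_le e (le_iSup_of_le he
      (le_iSup_of_le (φ.symm.toLinearMap ∘ₗ f)
        (le_iSup_of_le (φ.symm.injective.comp hf) le_rfl))))

end Betti

/-! ### `ℓ²`-Betti numbers from an arbitrary resolution -/

section Complexes

theorem isHomologyOf_chainComplex {R : Type} [Ring R] (K : ChainComplex (ModuleCat.{0} R) ℕ)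
    (j : ℕ) : IsHomologyOf (K.d (j + 1) j).hom (K.d j (j - 1)).hom (K.homology j) := by
  have hp : (ComplexShape.down ℕ).prev j = j + 1 := ChainComplex.prev ℕ j
  have hn : (ComplexShape.down ℕ).next j = j - 1 := by
    cases j with
    | zero => exact ChainComplex.next_nat_zero
    | succ j => exact ChainComplex.next_nat_succ j
  have h := isHomologyOf_shortComplex (K.sc' (j + 1) j (j - 1))
  exact h.of_equiv (ShortComplex.homologyMapIso (K.isoSc' (j + 1) j (j - 1) hp hn)).symm.toLinearEquiv

theorem isHomologyOf_cochainComplex {R : Type} [Ring R] (K : CochainComplex (ModuleCat.{0} R) ℕ)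
    (j : ℕ) : IsHomologyOf (K.d (j - 1) j).hom (K.d j (j + 1)).hom (K.homology j) := by
  have hn : (ComplexShape.up ℕ).next j = j + 1 := CochainComplex.next ℕ j
  have hp : (ComplexShape.up ℕ).prev j = j - 1 := by
    cases j with
    | zero => exact CochainComplex.prev_nat_zero
    | succ j => exact CochainComplex.prev_nat_succ j
  have h := isHomologyOf_shortComplex (K.sc' (j - 1) j (j + 1))
  exact h.of_equiv (ShortComplex.homologyMapIso (K.isoSc' (j - 1) j (j + 1) hp hn)).symm.toLinearEquiv

variable (Γ : Type) [Group Γ]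

/-- The differential leaving degree `i` of the complex `C_•`, which is zero for `i = 0`. -/
def vnDiffFrom : (i : ℕ) → VNChains Γ i →ₗ[VN Γ] VNChains Γ (i - 1)
  | 0 => 0
  | i + 1 => vnDiff Γ i

theorem ker_vnDiffFrom (i : ℕ) : LinearMap.ker (vnDiffFrom Γ i) = vnCycles Γ i := by
  cases i with
  | zero => exact LinearMap.ker_zero
  | succ i => rfl

theorem isHomologyOf_l2Homology (i : ℕ) :
    IsHomologyOf (vnDiff Γ i) (vnDiffFrom Γ i) (l2Homology Γ i) := by
  refine ⟨((LinearMap.range (vnDiff Γ i)).submoduleOf (vnCycles Γ i)).mkQ ∘ₗ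
    (LinearEquiv.ofEq _ _ (ker_vnDiffFrom Γ i)).toLinearMap,
    (Submodule.mkQ_surjective _).comp (LinearEquiv.surjective _), fun x => ?_⟩
  rw [LinearMap.comp_apply, Submodule.mkQ_apply, Submodule.Quotient.mk_eq_zero,
    Submodule.submoduleOf, Submodule.mem_comap, LinearMap.mem_range]
  rfl

/-- The `ℓ²`-homology is the homology of the base change of the bar resolution. -/
theorem nonempty_l2Homology_equiv (i : ℕ) : Nonempty (l2Homology Γ i ≃ₗ[VN Γ]
    ((((baseChangeFunctor Γ).mapHomologicalComplex _).obj (Rep.barComplex ℂ Γ)).homology i :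
      ModuleCat (VN Γ))) := by
  have h := isHomologyOf_chainComplex
    (((baseChangeFunctor Γ).mapHomologicalComplex _).obj (Rep.barComplex ℂ Γ)) i
  refine (isHomologyOf_l2Homology Γ i).linearEquiv ?_
  refine h.congr (f' := vnDiff Γ i) (g' := vnDiffFrom Γ i)
    (baseChangeFree (Fin (i + 1) → Γ)) (baseChangeFree (Fin i → Γ))
    (baseChangeFree (Fin (i - 1) → Γ)) ?_ ?_
  · intro x
    have hd : (((baseChangeFunctor Γ).mapHomologicalComplex _).obj (Rep.barComplex ℂ Γ)).d (i + 1) i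
        = (baseChangeFunctor Γ).map (Rep.barComplex.d ℂ Γ i) := by
      rw [← Rep.barComplex.d_def]; rfl
    rw [hd]
    exact LinearMap.congr_fun (baseChangeFree_barDiff i) x
  · cases i with
    | zero =>
      intro y
      have hd : (((baseChangeFunctor Γ).mapHomologicalComplex _).obj (Rep.barComplex ℂ Γ)).d 0
        (0 - 1) = 0 := HomologicalComplex.shape _ _ _ (by simp)
      rw [hd]
      exact map_zero (baseChangeFree (Fin (0 - 1) → Γ))
    | succ i =>
      intro x
      have hd : (((baseChangeFunctor Γ).mapHomologicalComplex _).obj (Rep.barComplex ℂ Γ)).d (i + 1)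
          (i + 1 - 1) = (baseChangeFunctor Γ).map (Rep.barComplex.d ℂ Γ i) := by
        rw [← Rep.barComplex.d_def]; rfl
      rw [hd]
      exact LinearMap.congr_fun (baseChangeFree_barDiff i) x

/-- The `ℓ²`-Betti numbers can be computed from any projective resolution. -/
theorem l2Betti_eq_vnDim_homology (P : ProjectiveResolution (Rep.trivial ℂ Γ ℂ)) (i : ℕ) :
    l2Betti Γ i = vnDim (Γ := Γ)
      ((((baseChangeFunctor Γ).mapHomologicalComplex _).obj P.complex).homology i :
        ModuleCat (VN Γ)) := by
  obtain ⟨φ⟩ := nonempty_l2Homology_equiv Γ i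
  have ψ := (((baseChangeFunctor Γ).mapHomotopyEquiv
    (ProjectiveResolution.homotopyEquiv (Rep.barResolution ℂ Γ) P)).toHomologyIso i).toLinearEquiv
  exact vnDim_congr (φ ≪≫ₗ ψ)

end Complexes

/-! ### Finitely generated projective representations as retracts of free ones -/

section Retract

variable {Γ : Type} [Group Γ]

theorem asAlgebraHom_hom_apply {M N : Rep.{0} ℂ Γ} (f : M ⟶ N) (x : MonoidAlgebra ℂ Γ) (m : M) :
    f.hom (M.ρ.asAlgebraHom x m) = N.ρ.asAlgebraHom x (f.hom m) := by
  induction x using MonoidAlgebra.induction_linear with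
  | zero => simp
  | add x y hx hy => simp only [map_add, LinearMap.add_apply, hx, hy]
  | single g c =>
    simp only [Representation.asAlgebraHom_single, LinearMap.smul_apply]
    rw [map_smul, Rep.hom_comm_apply]

theorem free_single_eq {α : Type} (i : α) (x : MonoidAlgebra ℂ Γ) :
    (Finsupp.single i x : Rep.free ℂ Γ α) = (Rep.free ℂ Γ α).ρ.asAlgebraHom x
      (Finsupp.single i (MonoidAlgebra.single 1 1)) := by
  induction x using MonoidAlgebra.induction_linear with
  | zero => simp
  | add x y hx hy => simp only [Finsupp.single_add, map_add, LinearMap.add_apply, hx, hy]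
  | single g c =>
    rw [Representation.asAlgebraHom_single, LinearMap.smul_apply, Representation.free_single_single]
    simp

/-- A projective representation that is finitely generated over `ℂ[Γ]` is a retract of a free
representation of finite rank. -/
theorem exists_free_retract (M : Rep.{0} ℂ Γ) [Projective M]
    (hM : Module.Finite (MonoidAlgebra ℂ Γ) M.ρ.asModule) :
    ∃ (r : ℕ) (a : M ⟶ Rep.free ℂ Γ (Fin r)) (b : Rep.free ℂ Γ (Fin r) ⟶ M), a ≫ b = 𝟙 M := by
  obtain ⟨r, s, hs⟩ := Submodule.fg_iff_exists_fin_generating_family.1 hM.fg_top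
  let b : Rep.free ℂ Γ (Fin r) ⟶ M := Rep.freeLift ℂ Γ M fun i => M.ρ.asModuleEquiv (s i)
  have hb1 : ∀ i, b.hom (Finsupp.single i (MonoidAlgebra.single 1 1)) = M.ρ.asModuleEquiv (s i) := by
    intro i
    refine (Representation.freeLift_single_single _ _ _ _ _).trans ?_
    simp only [map_one, one_smul]
    rfl
  have hsurj : Function.Surjective b.hom := by
    intro m
    have hm : M.ρ.asModuleEquiv.symm m ∈ Submodule.span (MonoidAlgebra ℂ Γ) (Set.range s) := by
      rw [hs]; trivial
    obtain ⟨c, hc⟩ := (Submodule.mem_span_range_iff_exists_fun _).1 hm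
    refine ⟨∑ i, Finsupp.single i (c i), ?_⟩
    rw [map_sum]
    have h2 := congrArg M.ρ.asModuleEquiv hc
    rw [LinearEquiv.apply_symm_apply, map_sum] at h2
    rw [← h2]
    refine Finset.sum_congr rfl fun i _ => ?_
    rw [free_single_eq, asAlgebraHom_hom_apply, hb1, Representation.asModuleEquiv_map_smul]
  have : Epi b := (Rep.epi_iff_surjective b).2 hsurj
  exact ⟨r, Projective.factorThru (𝟙 M) b, b, Projective.factorThru_comp _ _⟩

/-- The matrix over `ℂ[Γ]` of a morphism of free representations, acting on rows. -/
def repMatrix {r s : ℕ} (φ : Rep.free ℂ Γ (Fin r) ⟶ Rep.free ℂ Γ (Fin s)) :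
    Matrix (Fin r) (Fin s) (MonoidAlgebra ℂ Γ) :=
  fun i => (φ.hom (Finsupp.single i (MonoidAlgebra.single 1 1)) : Fin s →₀ MonoidAlgebra ℂ Γ)

theorem hom_single_eq_sum {r s : ℕ} (φ : Rep.free ℂ Γ (Fin r) ⟶ Rep.free ℂ Γ (Fin s)) (i : Fin r) :
    φ.hom (Finsupp.single i (MonoidAlgebra.single 1 1)) =
      ∑ j, (Finsupp.single j (repMatrix φ i j) : Fin s →₀ MonoidAlgebra ℂ Γ) :=
  (Finsupp.univ_sum_single (M := MonoidAlgebra ℂ Γ)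
    (φ.hom (Finsupp.single i (MonoidAlgebra.single 1 1)))).symm

/-- The base change of a free representation of finite rank. -/
def baseChangeFin (r : ℕ) : BaseChange (Rep.free ℂ Γ (Fin r)) ≃ₗ[VN Γ] (Fin r → VN Γ) :=
  baseChangeFree (Fin r) ≪≫ₗ Finsupp.linearEquivFunOnFinite (VN Γ) (VN Γ) (Fin r)

theorem baseChangeFin_map {r s : ℕ} (φ : Rep.free ℂ Γ (Fin r) ⟶ Rep.free ℂ Γ (Fin s))
    (v : Fin r → VN Γ) : baseChangeFin s (BaseChange.map φ ((baseChangeFin r).symm v)) =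
      Matrix.vecMul v ((repMatrix φ).map (groupAlgToVN Γ)) := by
  have h : (baseChangeFin s).toLinearMap ∘ₗ BaseChange.map φ ∘ₗ (baseChangeFin r).symm.toLinearMap =
      Matrix.toLinearMapRight' ((repMatrix φ).map (groupAlgToVN Γ)) := by
    refine LinearMap.pi_ext' fun i => LinearMap.ext_ring ?_
    have h1 : (baseChangeFin r).symm (Pi.single i (1 : VN Γ)) =
        BaseChange.mk (M := Rep.free ℂ Γ (Fin r))
          (Finsupp.single i (MonoidAlgebra.single 1 1)) := by
      rw [LinearEquiv.symm_apply_eq]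
      funext j
      simp [baseChangeFin, baseChangeFree_mk_single, groupAlgToVN_single, toVN_one,
        Finsupp.single_eq_pi_single]
    simp only [LinearMap.comp_apply, LinearMap.single_apply, LinearEquiv.coe_coe, h1,
      Matrix.toLinearMapRight'_apply, Matrix.single_one_vecMul]
    rw [BaseChange.map_mk]
    funext j
    change (baseChangeFree (Fin s) (BaseChange.mk _) : Fin s →₀ VN Γ) j = _
    rw [baseChangeFree_mk]
    rfl
  exact (LinearMap.congr_fun h v).trans (by simp)

end Retract

/-! ### Dimensions of homology and cohomology with finite dimensional coefficients -/

section FiniteDim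

variable {X Y Z M : Type*} [AddCommGroup X] [AddCommGroup Y] [AddCommGroup Z] [AddCommGroup M]
  [Module ℂ X] [Module ℂ Y] [Module ℂ Z] [Module ℂ M]

theorem IsHomologyOf.finrank_add {f : X →ₗ[ℂ] Y} {g : Y →ₗ[ℂ] Z} (hM : IsHomologyOf f g M)
    (hgf : ∀ x, g (f x) = 0) [FiniteDimensional ℂ Y] :
    FiniteDimensional ℂ M ∧ Module.finrank ℂ M + Module.finrank ℂ (LinearMap.range g) +
      Module.finrank ℂ (LinearMap.range f) = Module.finrank ℂ Y := by
  obtain ⟨q, hq, hker⟩ := hM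
  refine ⟨Module.Finite.of_surjective q hq, ?_⟩
  have h1 := q.finrank_range_add_finrank_ker
  rw [LinearMap.range_eq_top.2 hq, finrank_top] at h1
  have h2 := g.finrank_range_add_finrank_ker
  have h3 : Module.finrank ℂ (LinearMap.ker q) = Module.finrank ℂ (LinearMap.range f) := by
    have : (LinearMap.ker q).map (LinearMap.ker g).subtype = LinearMap.range f := by
      ext y
      constructor
      · rintro ⟨x, hx, rfl⟩
        exact (hker x).1 hx
      · rintro ⟨x, rfl⟩
        exact ⟨⟨f x, hgf x⟩, (hker _).2 ⟨x, rfl⟩, rfl⟩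
    rw [← this]
    exact (Submodule.equivMapOfInjective _ (LinearMap.ker g).injective_subtype _).finrank_eq
  omega

/-- The dimension of the homology of a complex whose terms are retracts of finite dimensional
spaces, in terms of the ranks of the idempotent and of the two differentials. -/
theorem IsHomologyOf.finrank_of_retract {f : X →ₗ[ℂ] Y} {g : Y →ₗ[ℂ] Z} (hM : IsHomologyOf f g M)
    (hgf : ∀ x, g (f x) = 0) {X' Y' Z' : Type*} [AddCommGroup X'] [AddCommGroup Y']
    [AddCommGroup Z'] [Module ℂ X'] [Module ℂ Y'] [Module ℂ Z'] [FiniteDimensional ℂ Y']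
    (aX : X →ₗ[ℂ] X') (bX : X' →ₗ[ℂ] X) (aY : Y →ₗ[ℂ] Y') (bY : Y' →ₗ[ℂ] Y)
    (aZ : Z →ₗ[ℂ] Z') (bZ : Z' →ₗ[ℂ] Z)
    (hX : ∀ x, bX (aX x) = x) (hY : ∀ x, bY (aY x) = x) (hZ : ∀ x, bZ (aZ x) = x)
    {e : Y' →ₗ[ℂ] Y'} {D : Y' →ₗ[ℂ] Z'} {A : X' →ₗ[ℂ] Y'} (he : ∀ v, aY (bY v) = e v)
    (hD : ∀ v, aZ (g (bY v)) = D v) (hA : ∀ v, aY (f (bX v)) = A v) :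
    FiniteDimensional ℂ M ∧ Module.finrank ℂ M + Module.finrank ℂ (LinearMap.range D) +
      Module.finrank ℂ (LinearMap.range A) = Module.finrank ℂ (LinearMap.range e) := by
  have hsX : Function.Surjective bX := fun x => ⟨aX x, hX x⟩
  have hsY : Function.Surjective bY := fun x => ⟨aY x, hY x⟩
  have hiY : Function.Injective aY := Function.LeftInverse.injective hY
  have hiZ : Function.Injective aZ := Function.LeftInverse.injective hZ
  have h1 : LinearMap.range D = (LinearMap.range g).map aZ := by
    have : D = aZ ∘ₗ g ∘ₗ bY := LinearMap.ext fun v => (hD v).symm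
    rw [this, LinearMap.range_comp, LinearMap.range_comp, LinearMap.range_eq_top.2 hsY,
      Submodule.map_top]
  have h2 : LinearMap.range A = (LinearMap.range f).map aY := by
    have : A = aY ∘ₗ f ∘ₗ bX := LinearMap.ext fun v => (hA v).symm
    rw [this, LinearMap.range_comp, LinearMap.range_comp, LinearMap.range_eq_top.2 hsX,
      Submodule.map_top]
  have h3 : LinearMap.range e = LinearMap.range aY := by
    have : e = aY ∘ₗ bY := LinearMap.ext fun v => (he v).symm
    rw [this, LinearMap.range_comp, LinearMap.range_eq_top.2 hsY, Submodule.map_top]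
  have : FiniteDimensional ℂ Y := Module.Finite.of_surjective bY hsY
  obtain ⟨h4, h5⟩ := hM.finrank_add hgf
  refine ⟨h4, ?_⟩
  rw [h1, h2, h3, ← (Submodule.equivMapOfInjective aZ hiZ _).finrank_eq,
    ← (Submodule.equivMapOfInjective aY hiY _).finrank_eq, LinearMap.finrank_range_of_inj hiY, h5]

end FiniteDim

section Coefficients

variable {Γ : Type} [Group Γ] {W : Type} [AddCommGroup W] [Module ℂ W] (ρ : Representation ℂ Γ W)

/-- The transpose of a matrix over `ℂ[Γ]` with the antipode `g ↦ g⁻¹` applied to the entries. It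
turns matrices acting on rows over `ℂ[Γ]` into matrices acting on columns. -/
def antiTranspose {r s : ℕ} (A : Matrix (Fin r) (Fin s) (MonoidAlgebra ℂ Γ)) :
    Matrix (Fin s) (Fin r) (MonoidAlgebra ℂ Γ) :=
  A.transpose.map (HopfAlgebra.antipode ℂ)

theorem matAct_apply {r s : ℕ} (A : Matrix (Fin r) (Fin s) (MonoidAlgebra ℂ Γ)) (w : Fin s → W)
    (i : Fin r) : matAct ρ A w i = ∑ j, ρ.asAlgebraHom (A i j) (w j) := by
  simp [matAct]

/-- A morphism from a free representation of finite rank is determined by the images of the basis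
vectors. -/
def homFin (r : ℕ) : (Rep.free ℂ Γ (Fin r) ⟶ Rep.of ρ) ≃ₗ[ℂ] (Fin r → W) :=
  Rep.freeLiftLEquiv ℂ Γ (Fin r) (Rep.of ρ)

theorem homFin_apply (r : ℕ) (f : Rep.free ℂ Γ (Fin r) ⟶ Rep.of ρ) (i : Fin r) :
    homFin ρ r f i = f.hom (Finsupp.single i (MonoidAlgebra.single 1 1)) := by
  rfl

theorem homFin_comp {r s : ℕ} (φ : Rep.free ℂ Γ (Fin r) ⟶ Rep.free ℂ Γ (Fin s))
    (f : Rep.free ℂ Γ (Fin s) ⟶ Rep.of ρ) :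
    homFin ρ r (φ ≫ f) = matAct ρ (repMatrix φ) (homFin ρ s f) := by
  funext i
  rw [homFin_apply, matAct_apply, Rep.hom_comp, Representation.IntertwiningMap.comp_apply,
    hom_single_eq_sum, map_sum]
  refine Finset.sum_congr rfl fun j _ => ?_
  rw [free_single_eq, asAlgebraHom_hom_apply]
  rfl

/-- The functor `M ↦ (W ⊗ M)_Γ` on a free representation of finite rank. -/
def coinvFin (r : ℕ) :
    (((Rep.coinvariantsTensor ℂ Γ).obj (Rep.of ρ)).obj (Rep.free ℂ Γ (Fin r)) : ModuleCat ℂ)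
      ≃ₗ[ℂ] (Fin r → W) :=
  Rep.coinvariantsTensorFreeLEquiv (Rep.of ρ) (Fin r) ≪≫ₗ Finsupp.linearEquivFunOnFinite ℂ W (Fin r)

theorem coinvFin_mk (r : ℕ) (w : W) (j : Fin r) (x : MonoidAlgebra ℂ Γ) :
    coinvFin ρ r (Rep.coinvariantsTensorMk (Rep.of ρ) (Rep.free ℂ Γ (Fin r)) w
      (Finsupp.single j x)) = Pi.single j (ρ.asAlgebraHom (HopfAlgebra.antipode ℂ x) w) := by
  induction x using MonoidAlgebra.induction_linear with
  | zero => simp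
  | add x y hx hy => simp only [Finsupp.single_add, map_add, LinearMap.add_apply, hx, hy,
      Pi.single_add]
  | single g c =>
    have h := Rep.coinvariantsTensorFreeToFinsupp_mk_tmul_single (Rep.of ρ) w j g c
    refine (congrArg (Finsupp.linearEquivFunOnFinite ℂ W (Fin r)) h).trans ?_
    rw [MonoidAlgebra.antipode_single, Representation.asAlgebraHom_single]
    simp

theorem coinvFin_map {r s : ℕ} (φ : Rep.free ℂ Γ (Fin r) ⟶ Rep.free ℂ Γ (Fin s))
    (w : Fin r → W) :
    coinvFin ρ s ((((Rep.coinvariantsTensor ℂ Γ).obj (Rep.of ρ)).map φ).hom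
      ((coinvFin ρ r).symm w)) = matAct ρ (antiTranspose (repMatrix φ)) w := by
  have h : (coinvFin ρ s).toLinearMap ∘ₗ
      (((Rep.coinvariantsTensor ℂ Γ).obj (Rep.of ρ)).map φ).hom ∘ₗ
        (coinvFin ρ r).symm.toLinearMap = matAct ρ (antiTranspose (repMatrix φ)) := by
    refine LinearMap.pi_ext fun i w => ?_
    have h1 : (coinvFin ρ r).symm (Pi.single i w) =
        Rep.coinvariantsTensorMk (Rep.of ρ) (Rep.free ℂ Γ (Fin r)) w
          (Finsupp.single i (MonoidAlgebra.single 1 1)) := by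
      rw [LinearEquiv.symm_apply_eq, coinvFin_mk]
      simp [MonoidAlgebra.antipode_single, Representation.asAlgebraHom_single]
    have h2 : (((Rep.coinvariantsTensor ℂ Γ).obj (Rep.of ρ)).map φ).hom
        (Rep.coinvariantsTensorMk (Rep.of ρ) (Rep.free ℂ Γ (Fin r)) w
          (Finsupp.single i (MonoidAlgebra.single 1 1))) =
        Rep.coinvariantsTensorMk (Rep.of ρ) (Rep.free ℂ Γ (Fin s)) w
          (φ.hom (Finsupp.single i (MonoidAlgebra.single 1 1))) := rfl
    simp only [LinearMap.comp_apply, LinearEquiv.coe_coe]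
    rw [h1, h2, hom_single_eq_sum, map_sum, map_sum]
    refine (Finset.sum_congr rfl fun j _ => coinvFin_mk ρ s w j _).trans ?_
    funext j
    rw [Finset.sum_apply, Finset.sum_eq_single j, matAct_apply, Finset.sum_eq_single i]
    · simp [antiTranspose]
    · intro k _ hk
      simp [hk]
    · simp
    · intro k _ hk
      simp [Ne.symm hk]
    · simp
  exact LinearMap.congr_fun h w

end Coefficients

/-! ### Homology, cohomology and `ℓ²`-Betti numbers in terms of matrices over the group algebra -/

section Key

variable (Γ : Type) [Group Γ]

/-- In the degrees where the resolution is finitely generated, its terms are retracts of free modules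
of finite rank. Three matrices over `ℂ[Γ]`, namely those of the idempotent in degree `i` and of the
two adjacent differentials, then compute the `ℓ²`-Betti number through their von Neumann ranks and
the Betti numbers with coefficients in any finite dimensional representation through the ranks of
their actions. For homology, where coefficients are tensored, the matrices have to be
anti-transposed. For `i = 0` the differential leaving degree `i` is `d 0 0 = 0`. -/
theorem exists_matrices_of_isTypeFP {n : ℕ} (hFP : IsTypeFP Γ (n + 1)) {i : ℕ} (hi : i ≤ n) :
    ∃ (r s t : ℕ) (E : Matrix (Fin r) (Fin r) (MonoidAlgebra ℂ Γ))
      (D : Matrix (Fin r) (Fin s) (MonoidAlgebra ℂ Γ))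
      (A : Matrix (Fin t) (Fin r) (MonoidAlgebra ℂ Γ)),
      (0 ≤ vnRank (E.map (groupAlgToVN Γ)) - vnRank (D.map (groupAlgToVN Γ)) -
        vnRank (A.map (groupAlgToVN Γ)) ∧
      l2Betti Γ i = ENNReal.ofReal (vnRank (E.map (groupAlgToVN Γ)) -
        vnRank (D.map (groupAlgToVN Γ)) - vnRank (A.map (groupAlgToVN Γ)))) ∧
      ∀ (W : Type) [AddCommGroup W] [Module ℂ W] [FiniteDimensional ℂ W]
        (ρ : Representation ℂ Γ W),
        (FiniteDimensional ℂ (groupHomology (Rep.of ρ) i) ∧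
          Module.finrank ℂ (groupHomology (Rep.of ρ) i) +
            Module.finrank ℂ (LinearMap.range (matAct ρ (antiTranspose D))) +
            Module.finrank ℂ (LinearMap.range (matAct ρ (antiTranspose A))) =
            Module.finrank ℂ (LinearMap.range (matAct ρ (antiTranspose E)))) ∧
        (FiniteDimensional ℂ (groupCohomology (Rep.of ρ) i) ∧
          Module.finrank ℂ (groupCohomology (Rep.of ρ) i) +
            Module.finrank ℂ (LinearMap.range (matAct ρ A)) +
            Module.finrank ℂ (LinearMap.range (matAct ρ D)) =
            Module.finrank ℂ (LinearMap.range (matAct ρ E))) := by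
  classical
  obtain ⟨P, hP⟩ := hFP
  obtain ⟨r, aY, bY, hY⟩ := exists_free_retract (P.complex.X i) (hP i (by omega))
  obtain ⟨s, aZ, bZ, hZ⟩ := exists_free_retract (P.complex.X (i - 1)) (hP (i - 1) (by omega))
  obtain ⟨t, aX, bX, hX⟩ := exists_free_retract (P.complex.X (i + 1)) (hP (i + 1) (by omega))
  refine ⟨r, s, t, repMatrix (bY ≫ aY), repMatrix (bY ≫ P.complex.d i (i - 1) ≫ aZ),
    repMatrix (bX ≫ P.complex.d (i + 1) i ≫ aY), ?_, ?_⟩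
  · -- the base change to `N(Γ)`
    set F := baseChangeFunctor Γ
    have hid : ∀ {M N : Rep.{0} ℂ Γ} (a : M ⟶ N) (b : N ⟶ M), a ≫ b = 𝟙 M → ∀ x : BaseChange M,
        BaseChange.map b (BaseChange.map a x) = x := by
      intro M N a b hab x
      have h := F.map_comp a b
      rw [hab, F.map_id] at h
      exact (LinearMap.congr_fun (ModuleCat.hom_ext_iff.1 h) x).symm
    have hcomp : ∀ {M N L : Rep.{0} ℂ Γ} (a : M ⟶ N) (b : N ⟶ L) (x : BaseChange M),
        BaseChange.map (a ≫ b) x = BaseChange.map b (BaseChange.map a x) := fun a b x =>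
      LinearMap.congr_fun (ModuleCat.hom_ext_iff.1 (F.map_comp a b)) x
    rw [l2Betti_eq_vnDim_homology Γ P i]
    have hM := isHomologyOf_chainComplex ((F.mapHomologicalComplex _).obj P.complex) i
    have hdd := ((F.mapHomologicalComplex _).obj P.complex).d_comp_d (i + 1) i (i - 1)
    refine vnDim_eq_of_retract hM
      (fun x => LinearMap.congr_fun (ModuleCat.hom_ext_iff.1 hdd) x)
      ((baseChangeFin t).toLinearMap ∘ₗ BaseChange.map aX)
      (BaseChange.map bX ∘ₗ (baseChangeFin t).symm.toLinearMap)
      ((baseChangeFin r).toLinearMap ∘ₗ BaseChange.map aY)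
      (BaseChange.map bY ∘ₗ (baseChangeFin r).symm.toLinearMap)
      ((baseChangeFin s).toLinearMap ∘ₗ BaseChange.map aZ)
      (BaseChange.map bZ ∘ₗ (baseChangeFin s).symm.toLinearMap) ?_ ?_ ?_ _ _ _ ?_ ?_ ?_
    · intro x
      exact (congrArg (BaseChange.map bX) ((baseChangeFin t).symm_apply_apply _)).trans (hid _ _ hX x)
    · intro x
      exact (congrArg (BaseChange.map bY) ((baseChangeFin r).symm_apply_apply _)).trans (hid _ _ hY x)
    · intro x
      exact (congrArg (BaseChange.map bZ) ((baseChangeFin s).symm_apply_apply _)).trans (hid _ _ hZ x)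
    · intro v
      rw [← baseChangeFin_map, hcomp]
      rfl
    · intro v
      rw [← baseChangeFin_map, hcomp, hcomp]
      rfl
    · intro v
      rw [← baseChangeFin_map, hcomp, hcomp]
      rfl
  · intro W _ _ _ ρ
    constructor
    · -- the functor `M ↦ (W ⊗ M)_Γ`
      set F := (Rep.coinvariantsTensor ℂ Γ).obj (Rep.of ρ)
      have hid : ∀ {M N : Rep.{0} ℂ Γ} (a : M ⟶ N) (b : N ⟶ M), a ≫ b = 𝟙 M → ∀ x,
          (F.map b).hom ((F.map a).hom x) = x := by
        intro M N a b hab x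
        have h := F.map_comp a b
        rw [hab, F.map_id] at h
        exact (LinearMap.congr_fun (ModuleCat.hom_ext_iff.1 h) x).symm
      have hcomp : ∀ {M N L : Rep.{0} ℂ Γ} (a : M ⟶ N) (b : N ⟶ L) (x : F.obj M),
          (F.map (a ≫ b)).hom x = (F.map b).hom ((F.map a).hom x) := fun a b x =>
        LinearMap.congr_fun (ModuleCat.hom_ext_iff.1 (F.map_comp a b)) x
      have hM := (isHomologyOf_chainComplex (P.complex.coinvariantsTensorObj (Rep.of ρ)) i).of_equiv
        (groupHomologyIso (Rep.of ρ) i P).symm.toLinearEquiv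
      have hdd := (P.complex.coinvariantsTensorObj (Rep.of ρ)).d_comp_d (i + 1) i (i - 1)
      refine hM.finrank_of_retract (fun x => LinearMap.congr_fun (ModuleCat.hom_ext_iff.1 hdd) x)
        ((coinvFin ρ t).toLinearMap ∘ₗ (F.map aX).hom)
        ((F.map bX).hom ∘ₗ (coinvFin ρ t).symm.toLinearMap)
        ((coinvFin ρ r).toLinearMap ∘ₗ (F.map aY).hom)
        ((F.map bY).hom ∘ₗ (coinvFin ρ r).symm.toLinearMap)
        ((coinvFin ρ s).toLinearMap ∘ₗ (F.map aZ).hom)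
        ((F.map bZ).hom ∘ₗ (coinvFin ρ s).symm.toLinearMap) ?_ ?_ ?_ ?_ ?_ ?_
      · intro x
        exact (congrArg (F.map bX).hom ((coinvFin ρ t).symm_apply_apply _)).trans (hid _ _ hX x)
      · intro x
        exact (congrArg (F.map bY).hom ((coinvFin ρ r).symm_apply_apply _)).trans (hid _ _ hY x)
      · intro x
        exact (congrArg (F.map bZ).hom ((coinvFin ρ s).symm_apply_apply _)).trans (hid _ _ hZ x)
      · intro v
        rw [← coinvFin_map, hcomp]
        rfl
      · intro v
        rw [← coinvFin_map, hcomp, hcomp]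
        rfl
      · intro v
        rw [← coinvFin_map, hcomp, hcomp]
        rfl
    · -- the contravariant functor `M ↦ Hom(M, W)`
      have hM := (isHomologyOf_cochainComplex (P.complex.linearYonedaObj ℂ (Rep.of ρ)) i).of_equiv
        (groupCohomologyIso (Rep.of ρ) i P).symm.toLinearEquiv
      have hdd := (P.complex.linearYonedaObj ℂ (Rep.of ρ)).d_comp_d (i - 1) i (i + 1)
      have hid : ∀ {M N : Rep.{0} ℂ Γ} (a : M ⟶ N) (b : N ⟶ M), a ≫ b = 𝟙 M →
          ∀ f : M ⟶ Rep.of ρ, a ≫ b ≫ f = f := by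
        intro M N a b hab f
        rw [← Category.assoc, hab, Category.id_comp]
      refine hM.finrank_of_retract (fun x => LinearMap.congr_fun (ModuleCat.hom_ext_iff.1 hdd) x)
        ((homFin ρ s).toLinearMap ∘ₗ Linear.leftComp ℂ (Rep.of ρ) bZ)
        (Linear.leftComp ℂ (Rep.of ρ) aZ ∘ₗ (homFin ρ s).symm.toLinearMap)
        ((homFin ρ r).toLinearMap ∘ₗ Linear.leftComp ℂ (Rep.of ρ) bY)
        (Linear.leftComp ℂ (Rep.of ρ) aY ∘ₗ (homFin ρ r).symm.toLinearMap)
        ((homFin ρ t).toLinearMap ∘ₗ Linear.leftComp ℂ (Rep.of ρ) bX)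
        (Linear.leftComp ℂ (Rep.of ρ) aX ∘ₗ (homFin ρ t).symm.toLinearMap) ?_ ?_ ?_ ?_ ?_ ?_
      · intro (x : P.complex.X (i - 1) ⟶ Rep.of ρ)
        exact (congrArg (Linear.leftComp ℂ (Rep.of ρ) aZ)
          ((homFin ρ s).symm_apply_apply (bZ ≫ x))).trans (hid _ _ hZ x)
      · intro (x : P.complex.X i ⟶ Rep.of ρ)
        exact (congrArg (Linear.leftComp ℂ (Rep.of ρ) aY)
          ((homFin ρ r).symm_apply_apply (bY ≫ x))).trans (hid _ _ hY x)
      · intro (x : P.complex.X (i + 1) ⟶ Rep.of ρ)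
        exact (congrArg (Linear.leftComp ℂ (Rep.of ρ) aX)
          ((homFin ρ t).symm_apply_apply (bX ≫ x))).trans (hid _ _ hX x)
      · intro v
        obtain ⟨f, rfl⟩ := (homFin ρ r).surjective v
        rw [← homFin_comp, Category.assoc]
        exact congrArg (fun g => homFin ρ r (bY ≫ aY ≫ g)) ((homFin ρ r).symm_apply_apply f)
      · intro v
        obtain ⟨f, rfl⟩ := (homFin ρ r).surjective v
        rw [← homFin_comp, Category.assoc, Category.assoc]
        exact congrArg (fun g => homFin ρ t (bX ≫ P.complex.d (i + 1) i ≫ aY ≫ g))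
          ((homFin ρ r).symm_apply_apply f)
      · intro v
        obtain ⟨f, rfl⟩ := (homFin ρ s).surjective v
        rw [← homFin_comp, Category.assoc, Category.assoc]
        exact congrArg (fun g => homFin ρ r (bY ≫ P.complex.d i (i - 1) ≫ aZ ≫ g))
          ((homFin ρ s).symm_apply_apply f)

end Key

/-! ### Complex conjugation on `ℓ²(Γ)^ι` -/

section Conjugation

variable {Γ : Type*} {ι κ : Type*} [Fintype ι] [Fintype κ]

/-- Complex conjugation of the coefficients of the vectors in `ℓ²(Γ)^ι`. -/
def conjPow (x : L2Pow Γ ι) : L2Pow Γ ι := WithLp.toLp 2 fun i => star (x i)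

theorem conjPow_coord (x : L2Pow Γ ι) (i : ι) : conjPow x i = star (x i) := rfl

theorem conjPow_conjPow (x : L2Pow Γ ι) : conjPow (conjPow x) = x := by
  apply PiLp.ext
  intro i
  simp [conjPow_coord]

theorem conjPow_sub (x y : L2Pow Γ ι) : conjPow (x - y) = conjPow x - conjPow y := by
  apply PiLp.ext
  intro i
  simp [conjPow_coord]

theorem norm_conjPow (x : L2Pow Γ ι) : ‖conjPow x‖ = ‖x‖ := by
  simp [PiLp.norm_eq_of_L2, conjPow_coord]

theorem continuous_conjPow : Continuous (conjPow : L2Pow Γ ι → L2Pow Γ ι) :=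
  (Isometry.of_dist_eq fun x y => by
    rw [dist_eq_norm, ← conjPow_sub, norm_conjPow, dist_eq_norm]).continuous

theorem inner_star_star (f h : L2 Γ) : inner ℂ (star f) (star h) = inner ℂ h f := by
  rw [lp.inner_eq_tsum, lp.inner_eq_tsum]
  refine tsum_congr fun g => ?_
  simp [mul_comm]

theorem inner_conjPow (x y : L2Pow Γ ι) : inner ℂ (conjPow x) (conjPow y) = inner ℂ y x := by
  simp only [PiLp.inner_apply, conjPow_coord, inner_star_star]

theorem conjPow_basisVec (i : ι) (g : Γ) : conjPow (basisVec i g) = basisVec i g := by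
  classical
  apply PiLp.ext
  intro j
  rw [conjPow_coord]
  ext h
  rw [lp.coeFn_star, Pi.star_apply]
  by_cases hj : j = i
  · subst hj
    by_cases hh : h = g
    · subst hh; simp [basisVec]
    · simp [basisVec, hh]
  · simp [basisVec, hj]

variable [Group Γ]

/-- The von Neumann dimension is invariant under complex conjugation. -/
theorem hilbertDim_eq_of_conjPow {V W : Submodule ℂ (L2Pow Γ ι)}
    (hVW : ∀ x ∈ V, conjPow x ∈ W) (hWV : ∀ x ∈ W, conjPow x ∈ V) :
    hilbertDim V = hilbertDim W := by
  rw [hilbertDim_eq_sum, hilbertDim_eq_sum]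
  refine Finset.sum_congr rfl fun i _ => ?_
  have h : projCl W (basisVec i (1 : Γ)) = conjPow (projCl V (basisVec i (1 : Γ))) := by
    refine projCl_eq_of_mem (map_mem_closure continuous_conjPow (projCl_mem V _) hVW)
      fun w hw => ?_
    rw [← conjPow_basisVec i (1 : Γ), ← conjPow_sub, ← conjPow_conjPow w, inner_conjPow,
      ← inner_conj_symm, conjPow_basisVec, inner_sub_projCl V _ _ (hWV w hw), map_zero]
  rw [h, norm_conjPow]

end Conjugation

/-! ### Von Neumann ranks of matrices over the group algebra -/

section Ranks

variable {Γ : Type} [Group Γ]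

theorem leftTranslation_inner (g : Γ) (f h : L2 Γ) :
    inner ℂ (leftTranslation g f) h = inner ℂ f (leftTranslation g⁻¹ h) := by
  have h1 : leftTranslation g (leftTranslation g⁻¹ h) = h := by
    ext x; simp [leftTranslation_apply]
  conv_lhs => rw [← h1]
  exact (permL2 (Equiv.mulLeft g⁻¹)).inner_map_map f _

theorem star_leftTranslation (g : Γ) (f : L2 Γ) :
    star (leftTranslation g f) = leftTranslation g (star f) := by
  ext x
  simp [leftTranslation_apply]

/-- Up to complex conjugation, the antipode is the adjoint. -/
theorem inner_groupAlgToVN (a : MonoidAlgebra ℂ Γ) (f h : L2 Γ) :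
    inner ℂ (vnVal (groupAlgToVN Γ a) f) h =
      inner ℂ f (star (vnVal (groupAlgToVN Γ (HopfAlgebra.antipode ℂ a)) (star h))) := by
  induction a using MonoidAlgebra.induction_linear with
  | zero => simp
  | add x y hx hy =>
    simp only [map_add, add_apply, inner_add_left, hx, hy, star_add,
      inner_add_right]
  | single g c =>
    rw [MonoidAlgebra.antipode_single, groupAlgToVN_single, groupAlgToVN_single, map_smul,
      map_smul, vnVal_toVN, vnVal_toVN, smul_apply,
      smul_apply, star_smul, star_leftTranslation, star_star, inner_smul_left,
      inner_smul_right, leftTranslation_inner]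
    simp

/-- The anti-transpose acts as the adjoint conjugated by complex conjugation. -/
theorem conjPow_matOp_antiTranspose {r s : ℕ} (B : Matrix (Fin r) (Fin s) (MonoidAlgebra ℂ Γ))
    (x : L2Pow Γ (Fin r)) :
    conjPow (matOp ((antiTranspose B).map (groupAlgToVN Γ)) (conjPow x)) =
      ContinuousLinearMap.adjoint (matOp (B.map (groupAlgToVN Γ))) x := by
  refine ext_inner_left ℂ fun y => ?_
  rw [ContinuousLinearMap.adjoint_inner_right, PiLp.inner_apply, PiLp.inner_apply]
  simp only [conjPow_coord, matOp_coord, star_sum, _root_.inner_sum, sum_inner, antiTranspose,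
    Matrix.map_apply, Matrix.transpose_apply]
  rw [Finset.sum_comm]
  simp only [inner_groupAlgToVN]

/-- A matrix over the group algebra and its anti-transpose have the same von Neumann rank. -/
theorem vnRank_antiTranspose {r s : ℕ} (B : Matrix (Fin r) (Fin s) (MonoidAlgebra ℂ Γ)) :
    vnRank ((antiTranspose B).map (groupAlgToVN Γ)) = vnRank (B.map (groupAlgToVN Γ)) := by
  rw [vnRank, vnRank, ← hilbertDim_range_adjoint (isEquivariant_matOp (B.map (groupAlgToVN Γ)))]
  refine hilbertDim_eq_of_conjPow ?_ ?_
  · rintro _ ⟨x, rfl⟩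
    refine ⟨conjPow x, ?_⟩
    have h := conjPow_matOp_antiTranspose B (conjPow x)
    rw [conjPow_conjPow] at h
    exact h.symm
  · rintro _ ⟨x, rfl⟩
    refine ⟨conjPow x, ?_⟩
    have h := congrArg conjPow (conjPow_matOp_antiTranspose B x)
    rw [conjPow_conjPow] at h
    exact h

theorem asAlgebraHom_regularRep (a : MonoidAlgebra ℂ Γ) (f : L2 Γ) :
    (regularRep Γ).asAlgebraHom a f = vnVal (groupAlgToVN Γ a) f := by
  induction a using MonoidAlgebra.induction_linear with
  | zero => simp
  | add x y hx hy =>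
    simp only [map_add, add_apply, LinearMap.add_apply, hx, hy]
  | single g c =>
    rw [Representation.asAlgebraHom_single, groupAlgToVN_single, map_smul, vnVal_toVN]
    rfl

theorem twistedOne_bot (χ : (⊥ : Subgroup Γ) →* ℂˣ) [DecidableEq Γ] :
    twistedOne ⊥ χ = lp.single 2 (1 : Γ) (1 : ℂ) := by
  rw [twistedOne, finsum_unique]
  have : (default : (⊥ : Subgroup Γ)) = 1 := Subsingleton.elim _ _
  rw [this]
  simp
  congr!

theorem twistedL2_bot (χ : (⊥ : Subgroup Γ) →* ℂˣ) : twistedL2 ⊥ χ = ⊤ := by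
  refine eq_top_iff.2 fun f _ z g => ?_
  have : z = 1 := Subsingleton.elim _ _
  subst this
  simp

theorem twistedImage_bot (χ : (⊥ : Subgroup Γ) →* ℂˣ) {r s : ℕ}
    (A : Matrix (Fin r) (Fin s) (MonoidAlgebra ℂ Γ)) : twistedImage ⊥ χ A =
      (LinearMap.range (matOp (A.map (groupAlgToVN Γ))).toLinearMap).topologicalClosure := by
  have h : ∀ x : Fin s → L2 Γ, WithLp.toLp 2 (matAct (regularRep Γ) A x) =
      matOp (A.map (groupAlgToVN Γ)) (WithLp.toLp 2 x) := by
    intro x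
    apply PiLp.ext
    intro i
    rw [matOp_coord]
    simp only [matAct, LinearMap.pi_apply, LinearMap.sum_apply, LinearMap.comp_apply,
      LinearMap.proj_apply, asAlgebraHom_regularRep, Matrix.map_apply]
  rw [twistedImage, twistedL2_bot]
  congr 1
  ext y
  constructor
  · rintro ⟨_, ⟨x, -, rfl⟩, rfl⟩
    exact ⟨WithLp.toLp 2 x, (h x).symm⟩
  · rintro ⟨x, rfl⟩
    exact ⟨_, ⟨WithLp.ofLp x, by simp, rfl⟩, h _⟩

/-- If `Z` is trivial, then the twisted rank is the ordinary von Neumann rank. -/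
theorem twistedVNRank_eq_vnRank {Z : Subgroup Γ} (hZ : Z = ⊥) (χ : Z →* ℂˣ) {r s : ℕ}
    (A : Matrix (Fin r) (Fin s) (MonoidAlgebra ℂ Γ)) :
    twistedVNRank Z χ A = vnRank (A.map (groupAlgToVN Γ)) := by
  classical
  subst hZ
  rw [twistedVNRank, vnRank, hilbertDim_eq_sum]
  refine Finset.sum_congr rfl fun i _ => ?_
  have h1 : (WithLp.toLp 2 (Pi.single i (twistedOne ⊥ χ)) : L2Pow Γ (Fin r)) = basisVec i 1 := by
    rw [twistedOne_bot, basisVec]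
    congr!
  have h2 : (twistedImage ⊥ χ A).starProjection =
      projCl (LinearMap.range (matOp (A.map (groupAlgToVN Γ))).toLinearMap) := by
    rw [projCl]
    congr 1
    exact twistedImage_bot χ A
  rw [h1, ← h2]
  exact Submodule.re_inner_starProjection_eq_normSq _ _

end Ranks

/-! ### The center of a semisimple group is finite -/

section Center

variable {m : ℕ}

theorem noetherianSpace_zariski (m : ℕ) :
    @TopologicalSpace.NoetherianSpace (GL (Fin m) ℂ) (zariski m) :=
  let := zariski m
  Topology.IsInducing.noetherianSpace ⟨rfl⟩

/-- Left translations are continuous for the Zariski topology, since they act on polynomials by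
linear substitutions of the variables. -/
theorem continuous_mulLeft_zariski (a : GL (Fin m) ℂ) :
    @Continuous _ _ (zariski m) (zariski m) (fun g => a * g) := by
  let := zariski m
  refine continuous_iff_isClosed.2 fun S hS => ?_
  obtain ⟨P, rfl⟩ := (isClosed_zariski_iff S).1 hS
  refine (isClosed_zariski_iff _).2 ⟨(MvPolynomial.bind₁ fun ij : Fin m × Fin m =>
    ∑ k, MvPolynomial.C ((a : Matrix (Fin m) (Fin m) ℂ) ij.1 k) * MvPolynomial.X (k, ij.2)) '' P, ?_⟩
  have h : ∀ (p : MvPolynomial (Fin m × Fin m) ℂ) (g : GL (Fin m) ℂ),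
      evalGL (MvPolynomial.bind₁ (fun ij : Fin m × Fin m => ∑ k,
        MvPolynomial.C ((a : Matrix (Fin m) (Fin m) ℂ) ij.1 k) * MvPolynomial.X (k, ij.2)) p) g =
      evalGL p (a * g) := by
    intro p g
    rw [evalGL, evalGL, MvPolynomial.eval, MvPolynomial.eval₂Hom_bind₁]
    congr 2
    funext ij
    simp [Matrix.mul_apply]
  ext g
  simp [h]

theorem isClosed_center {G : Subgroup (GL (Fin m) ℂ)}
    (hG : IsClosed[zariski m] (G : Set (GL (Fin m) ℂ))) :
    IsClosed[zariski m] (((↑) : G → GL (Fin m) ℂ) '' (Subgroup.center G : Set G)) := by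
  let := zariski m
  have h : ((↑) : G → GL (Fin m) ℂ) '' (Subgroup.center G : Set G) =
      (G : Set (GL (Fin m) ℂ)) ∩ ⋂ a : G, {g | (a : GL (Fin m) ℂ) * g = g * a} := by
    ext g
    simp only [Set.mem_image, SetLike.mem_coe, Subgroup.mem_center_iff, Set.mem_inter_iff,
      Set.mem_iInter, Set.mem_ofPred_eq]
    constructor
    · rintro ⟨z, hz, rfl⟩
      exact ⟨z.2, fun a => congrArg Subtype.val (hz a)⟩
    · rintro ⟨hg, h⟩
      exact ⟨⟨g, hg⟩, fun a => Subtype.ext (h a), rfl⟩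
  rw [h]
  refine hG.inter (isClosed_iInter fun a => (isClosed_zariski_iff _).2
    ⟨Set.range fun ij : Fin m × Fin m => ∑ k,
      (MvPolynomial.C (((a : GL (Fin m) ℂ) : Matrix (Fin m) (Fin m) ℂ) ij.1 k) *
        MvPolynomial.X (k, ij.2) - MvPolynomial.X (ij.1, k) *
        MvPolynomial.C (((a : GL (Fin m) ℂ) : Matrix (Fin m) (Fin m) ℂ) k ij.2)), ?_⟩)
  ext g
  simp only [Set.mem_ofPred_eq, Set.forall_mem_range, evalGL, map_sum, map_sub, map_mul,
    MvPolynomial.eval_C, MvPolynomial.eval_X, Finset.sum_sub_distrib, sub_eq_zero, Prod.forall]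
  rw [Units.ext_iff, ← Matrix.ext_iff]
  simp [Matrix.mul_apply]

/-- The identity component of the center is a connected solvable normal subgroup, hence trivial; by
translation, the center is totally disconnected, hence finite because it is a Noetherian space. -/
theorem finite_center {G : Subgroup (GL (Fin m) ℂ)} (hG : IsSemisimpleAlgebraicGroup G) :
    Finite (Subgroup.center G) := by
  let τ := zariski m
  have : TopologicalSpace.NoetherianSpace (GL (Fin m) ℂ) := noetherianSpace_zariski m
  let e : Subgroup.center G → GL (Fin m) ℂ := fun z => ((z : G) : GL (Fin m) ℂ)
  let : TopologicalSpace (Subgroup.center G) := TopologicalSpace.induced e inferInstance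
  have he : Topology.IsInducing e := ⟨rfl⟩
  have hrange : IsClosed (Set.range e) := by
    have h := isClosed_center hG.closedConnected.1
    rwa [Set.image_eq_range] at h
  have : TopologicalSpace.NoetherianSpace (Subgroup.center G) := he.noetherianSpace
  have hmul : ∀ a : Subgroup.center G, Continuous fun z => a * z := fun a =>
    he.continuous_iff.2 ((continuous_mulLeft_zariski (e a)).comp he.continuous)
  -- Translation by `a⁻¹` maps the component of `a` into the identity component.
  have htrans : ∀ a z : Subgroup.center G, z ∈ connectedComponent a →
      a⁻¹ * z ∈ connectedComponent (1 : Subgroup.center G) := by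
    intro a z hz
    have h := (isPreconnected_connectedComponent.image _ (hmul a⁻¹).continuousOn).subset_connectedComponent
      (Set.mem_image_of_mem _ (mem_connectedComponent (x := a)))
    rw [inv_mul_cancel] at h
    exact h (Set.mem_image_of_mem _ hz)
  let C : Subgroup (Subgroup.center G) := Subgroup.ofDiv
    (connectedComponent (1 : Subgroup.center G)) ⟨1, mem_connectedComponent⟩ (by
      intro a ha b hb
      rw [show a * b⁻¹ = b⁻¹ * a from Subtype.ext (Subgroup.mem_center_iff.1 b⁻¹.2 a)]
      refine htrans b a ?_
      rwa [connectedComponent_eq hb] at ha)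
  have hC : ∀ z, z ∈ C ↔ z ∈ connectedComponent (1 : Subgroup.center G) := fun z => Iff.rfl
  have hCbot : C.map (Subgroup.center G).subtype = ⊥ := by
    refine hG.radical_trivial _ ⟨?_⟩ ?_ ?_
    · rintro _ ⟨z, hz, rfl⟩ g
      refine ⟨z, hz, ?_⟩
      rw [Subgroup.coe_subtype, Subgroup.mem_center_iff.1 z.2 g, mul_inv_cancel_right]
    · refine Group.isSolvable_of_comm ?_
      rintro ⟨_, x, hx, rfl⟩ ⟨_, y, hy, rfl⟩
      exact Subtype.ext (Subgroup.mem_center_iff.1 y.2 x)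
    · have h : ((↑) : G → GL (Fin m) ℂ) '' (C.map (Subgroup.center G).subtype : Set G) =
          e '' connectedComponent (1 : Subgroup.center G) := by
        rw [Subgroup.coe_map, Set.image_image]
        rfl
      rw [h]
      exact ⟨(Topology.IsClosedEmbedding.mk ⟨he, fun x y hxy => Subtype.ext (Subtype.ext hxy)⟩
        hrange).isClosedMap _ isClosed_connectedComponent,
        isConnected_connectedComponent.image _ he.continuous.continuousOn⟩
  have hsub : ∀ a z : Subgroup.center G, z ∈ connectedComponent a → z = a := by
    intro a z hz
    have h1 : ((a⁻¹ * z : Subgroup.center G) : G) ∈ C.map (Subgroup.center G).subtype :=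
      ⟨_, (hC _).2 (htrans a z hz), rfl⟩
    rw [hCbot, Subgroup.mem_bot] at h1
    exact (inv_mul_eq_one.1 (Subtype.ext h1)).symm
  have hfin := TopologicalSpace.NoetherianSpace.finite_irreducibleComponents
    (α := Subgroup.center G)
  -- A Noetherian space has finitely many irreducible components, and these are now points.
  refine Set.finite_univ_iff.1 ?_
  rw [← sUnion_irreducibleComponents]
  refine hfin.sUnion fun S hS => Set.Subsingleton.finite fun x hx y hy => ?_
  exact hsub y x (hS.1.isPreirreducible.isPreconnected.subset_connectedComponent hy hx)

theorem nontrivial_of_isIrreducible {G : Type*} [Group G] {W : Type*} [AddCommGroup W]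
    [Module ℂ W] {ρ : Representation ℂ G W} (hρ : ρ.IsIrreducible) : Nontrivial W := by
  by_contra h
  rw [not_nontrivial_iff_subsingleton] at h
  exact bot_ne_top (α := Subrepresentation ρ) (SetLike.ext fun x => by
    rw [Subsingleton.elim x 0]
    exact ⟨fun _ => Submodule.zero_mem (⊤ : Subrepresentation ρ).toSubmodule,
      fun _ => Submodule.zero_mem (⊥ : Subrepresentation ρ).toSubmodule⟩)

/-- By Schur's lemma, an irreducible representation has a central character. -/
theorem exists_hasCentralChar {G : Subgroup (GL (Fin m) ℂ)} {W : Type*} [AddCommGroup W]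
    [Module ℂ W] [FiniteDimensional ℂ W] (ρ : Representation ℂ G W) (hρ : ρ.IsIrreducible) :
    ∃ χ : Subgroup.center G →* ℂˣ, HasCentralChar ρ χ := by
  have hW : Nontrivial W := nontrivial_of_isIrreducible hρ
  have h : ∀ z : Subgroup.center G, ∃ c : ℂ, ∀ w, ρ (z : G) w = c • w := by
    intro z
    let f : Representation.IntertwiningMap ρ ρ := ⟨ρ (z : G), fun g => by
      rw [← Module.End.mul_eq_comp, ← Module.End.mul_eq_comp, ← map_mul, ← map_mul,
        Subgroup.mem_center_iff.1 z.2 g]⟩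
    obtain ⟨c, hc⟩ :=
      (Representation.IsIrreducible.algebraMap_intertwiningMap_bijective_of_isAlgClosed (ρ := ρ)).2 f
    refine ⟨c, fun w => ?_⟩
    exact (congrArg (fun f : Representation.IntertwiningMap ρ ρ => f w) hc).symm
  choose c hc using h
  obtain ⟨w, hw⟩ := exists_ne (0 : W)
  refine ⟨MonoidHom.toHomUnits ⟨⟨c, ?_⟩, fun a b => ?_⟩, fun z w => hc z w⟩
  · refine smul_left_injective ℂ hw ?_
    simp [← hc]
  · refine smul_left_injective ℂ hw ?_
    simp [← hc, mul_smul]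

end Center

/-! ### Approximation of Betti numbers -/

section Approximation

theorem repRank_eq {Γ : Type*} [Group Γ] {W : Type*} [AddCommGroup W] [Module ℂ W]
    [FiniteDimensional ℂ W] [Nontrivial W] (ρ : Representation ℂ Γ W) {r s : ℕ}
    (A : Matrix (Fin r) (Fin s) (MonoidAlgebra ℂ Γ)) :
    repRank ρ A = (Module.finrank ℂ (LinearMap.range (matAct ρ A)) : ℝ) / Module.finrank ℂ W := by
  have h := Submodule.finrank_quotient_add_finrank (LinearMap.range (matAct ρ A))
  rw [Module.finrank_pi_fintype, Finset.sum_const, Finset.card_univ, Fintype.card_fin,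
    smul_eq_mul] at h
  have hW : (Module.finrank ℂ W : ℝ) ≠ 0 := Nat.cast_ne_zero.2 Module.finrank_pos.ne'
  rw [repRank, sub_eq_iff_eq_add, ← add_div, eq_div_iff hW]
  rw [add_comm] at h
  exact_mod_cast h.symm

/-- The deviations of the normalized dimensions of `H_i(Γ, W)` and `H^i(Γ, W)` from the `ℓ²`-Betti
number are bounded by the deviations of the ranks of finitely many matrices, which do not depend
on `W`. -/
theorem exists_matrices_abs_sub_le (Γ : Type) [Group Γ] {n : ℕ} (hFP : IsTypeFP Γ (n + 1)) {i : ℕ}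
    (hi : i ≤ n) :
    ∃ (r s t : ℕ) (E : Matrix (Fin r) (Fin r) (MonoidAlgebra ℂ Γ))
      (D : Matrix (Fin r) (Fin s) (MonoidAlgebra ℂ Γ))
      (A : Matrix (Fin t) (Fin r) (MonoidAlgebra ℂ Γ)),
      ∀ (W : Type) [AddCommGroup W] [Module ℂ W] [FiniteDimensional ℂ W] [Nontrivial W]
        (ρ : Representation ℂ Γ W),
        |(Module.finrank ℂ (groupHomology (Rep.of ρ) i) : ℝ) / Module.finrank ℂ W -
            (l2Betti Γ i).toReal| ≤
          |repRank ρ (antiTranspose E) - vnRank ((antiTranspose E).map (groupAlgToVN Γ))| +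
          |repRank ρ (antiTranspose D) - vnRank ((antiTranspose D).map (groupAlgToVN Γ))| +
          |repRank ρ (antiTranspose A) - vnRank ((antiTranspose A).map (groupAlgToVN Γ))| ∧
        |(Module.finrank ℂ (groupCohomology (Rep.of ρ) i) : ℝ) / Module.finrank ℂ W -
            (l2Betti Γ i).toReal| ≤
          |repRank ρ E - vnRank (E.map (groupAlgToVN Γ))| +
          |repRank ρ D - vnRank (D.map (groupAlgToVN Γ))| +
          |repRank ρ A - vnRank (A.map (groupAlgToVN Γ))| := by
  obtain ⟨r, s, t, E, D, A, ⟨hnn, hb⟩, h⟩ := exists_matrices_of_isTypeFP Γ hFP hi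
  refine ⟨r, s, t, E, D, A, fun W _ _ _ _ ρ => ?_⟩
  obtain ⟨⟨-, h1⟩, -, h2⟩ := h W ρ
  have key : ∀ a b c e b' c' e' : ℝ, a + b + c = e →
      |a - (e' - b' - c')| ≤ |e - e'| + |b - b'| + |c - c'| := by
    intro a b c e b' c' e' habc
    have : a - (e' - b' - c') = (e - e') - (b - b') - (c - c') := by linarith
    rw [this]
    exact (abs_sub _ _).trans (by gcongr; exact abs_sub _ _)
  rw [hb, ENNReal.toReal_ofReal hnn]
  simp only [vnRank_antiTranspose, repRank_eq]
  constructor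
  · refine key _ _ _ _ _ _ _ ?_
    rw [← add_div, ← add_div]
    congr 1
    exact_mod_cast h1
  · refine key _ _ _ _ _ _ _ ?_
    rw [← add_div, ← add_div]
    congr 1
    have : Module.finrank ℂ (groupCohomology (Rep.of ρ) i) +
            Module.finrank ℂ (LinearMap.range (matAct ρ D)) +
            Module.finrank ℂ (LinearMap.range (matAct ρ A)) =
            Module.finrank ℂ (LinearMap.range (matAct ρ E)) := by omega
    exact_mod_cast this

variable {m : ℕ} {G : Subgroup (GL (Fin m) ℂ)} {R : RootFrame G} {Γ : Subgroup G}

/-- Since there are only finitely many central characters, the convergence in the rank-function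
conjecture is uniform in them. -/
theorem SatisfiesRankConjecture.exists_uniform (h : SatisfiesRankConjecture R Γ)
    (hG : IsSemisimpleAlgebraicGroup G) (hZ : Γ ⊓ Subgroup.center G = ⊥) {r s : ℕ}
    (A : Matrix (Fin r) (Fin s) (MonoidAlgebra ℂ Γ)) {ε : ℝ} (hε : 0 < ε) :
    ∃ N : ℕ, ∀ (W : Type) [AddCommGroup W] [Module ℂ W] (ρ : Representation ℂ G W)
      (l : Fin R.rank → ℕ), IsIrrepWithHighestWeight R ρ l → (∀ i, N ≤ l i) →
      |repRank (ρ.comp Γ.subtype) A - vnRank (A.map (groupAlgToVN Γ))| < ε := by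
  have := finite_center hG
  have hZ' : (Subgroup.center G).subgroupOf Γ = ⊥ := by
    rw [Subgroup.subgroupOf_eq_bot, disjoint_iff, inf_comm, hZ]
  choose N hN using fun χ => h χ r s A ε hε
  obtain ⟨M, hM⟩ := (Set.finite_range N).bddAbove
  refine ⟨M, fun W _ _ ρ l hρ hl => ?_⟩
  have := hρ.finiteDimensional
  obtain ⟨χ, hχ⟩ := exists_hasCentralChar ρ hρ.irreducible
  have h1 := hN χ W ρ l hρ hχ fun i => (hM ⟨χ, rfl⟩).trans (hl i)
  rwa [twistedVNRank_eq_vnRank hZ'] at h1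

/-- Since there are only finitely many central characters, the constant in the quantitative
rank-function conjecture can be chosen uniformly in them. -/
theorem SatisfiesQuantitativeRankConjecture.exists_uniform
    (h : SatisfiesQuantitativeRankConjecture R Γ) (hG : IsSemisimpleAlgebraicGroup G)
    (hZ : Γ ⊓ Subgroup.center G = ⊥) {r s : ℕ}
    (A : Matrix (Fin r) (Fin s) (MonoidAlgebra ℂ Γ)) :
    ∃ C : ℝ, ∀ (W : Type) [AddCommGroup W] [Module ℂ W] (ρ : Representation ℂ G W)
      (l : Fin R.rank → ℕ), IsIrrepWithHighestWeight R ρ l → ∀ N : ℕ, 0 < N → (∀ i, N ≤ l i) →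
      |repRank (ρ.comp Γ.subtype) A - vnRank (A.map (groupAlgToVN Γ))| ≤ C / N := by
  have := finite_center hG
  have hZ' : (Subgroup.center G).subgroupOf Γ = ⊥ := by
    rw [Subgroup.subgroupOf_eq_bot, disjoint_iff, inf_comm, hZ]
  choose C hC using fun χ => h χ r s A
  obtain ⟨M, hM⟩ := (Set.finite_range C).bddAbove
  refine ⟨M, fun W _ _ ρ l hρ N hN hl => ?_⟩
  have := hρ.finiteDimensional
  obtain ⟨χ, hχ⟩ := exists_hasCentralChar ρ hρ.irreducible
  have h1 := hC χ W ρ l hρ hχ N hN hl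
  rw [twistedVNRank_eq_vnRank hZ'] at h1
  refine h1.trans ?_
  gcongr
  exact hM ⟨χ, rfl⟩

end Approximation

end

end L2Approx

end

open L2Approx in
theorem mainTheorem7 {m : ℕ} (G : Subgroup (GL (Fin m) ℂ)) (hG : IsSemisimpleAlgebraicGroup G)
    (R : RootFrame G) (Γ : Subgroup G) (n : ℕ) (hFP : IsTypeFP Γ (n + 1))
    (hZ : Γ ⊓ Subgroup.center G = ⊥) :
    (∀ i ≤ n, l2Betti Γ i ≠ ⊤) ∧
    (∀ (W : Type) [AddCommGroup W] [Module ℂ W] [FiniteDimensional ℂ W]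
      (ρ : Representation ℂ G W), ∀ i ≤ n,
        FiniteDimensional ℂ (homologyOf Γ ρ i) ∧ FiniteDimensional ℂ (cohomologyOf Γ ρ i)) ∧
    (SatisfiesRankConjecture R Γ →
      ∀ (W : ℕ → Type) [∀ k, AddCommGroup (W k)] [∀ k, Module ℂ (W k)]
        (ρ : ∀ k, Representation ℂ G (W k)) (l : ℕ → Fin R.rank → ℕ),
        (∀ k, IsIrrepWithHighestWeight R (ρ k) (l k)) →
        (∀ N : ℕ, ∀ᶠ k in Filter.atTop, ∀ i, N ≤ l k i) →
        ∀ i ≤ n,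
          Filter.Tendsto
            (fun k => (Module.finrank ℂ (homologyOf Γ (ρ k) i) : ℝ) / Module.finrank ℂ (W k))
            Filter.atTop (nhds (l2Betti Γ i).toReal) ∧
          Filter.Tendsto
            (fun k => (Module.finrank ℂ (cohomologyOf Γ (ρ k) i) : ℝ) / Module.finrank ℂ (W k))
            Filter.atTop (nhds (l2Betti Γ i).toReal)) ∧
    (SatisfiesQuantitativeRankConjecture R Γ →
      ∀ i ≤ n, ∃ C : ℝ,
        ∀ (W : Type) [AddCommGroup W] [Module ℂ W] (ρ : Representation ℂ G W)
          (l : Fin R.rank → ℕ), IsIrrepWithHighestWeight R ρ l →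
          ∀ N : ℕ, 0 < N → (∀ j, N ≤ l j) →
          |(Module.finrank ℂ (homologyOf Γ ρ i) : ℝ) / Module.finrank ℂ W -
              (l2Betti Γ i).toReal| ≤ C / N ∧
          |(Module.finrank ℂ (cohomologyOf Γ ρ i) : ℝ) / Module.finrank ℂ W -
              (l2Betti Γ i).toReal| ≤ C / N) := by
  refine ⟨fun i hi => ?_, fun W _ _ _ ρ i hi => ?_, fun h W _ _ ρ l hρ hl i hi => ?_,
    fun h i hi => ?_⟩
  · obtain ⟨r, s, t, E, D, A, ⟨-, hb⟩, -⟩ := exists_matrices_of_isTypeFP Γ hFP hi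
    rw [hb]
    exact ENNReal.ofReal_ne_top
  · obtain ⟨r, s, t, E, D, A, -, h⟩ := exists_matrices_of_isTypeFP Γ hFP hi
    exact ⟨(h W (ρ.comp Γ.subtype)).1.1, (h W (ρ.comp Γ.subtype)).2.1⟩
  · obtain ⟨r, s, t, E, D, A, hle⟩ := exists_matrices_abs_sub_le Γ hFP hi
    have hrank : ∀ {p q : ℕ} (B : Matrix (Fin p) (Fin q) (MonoidAlgebra ℂ Γ)), Filter.Tendsto
        (fun k => |repRank ((ρ k).comp Γ.subtype) B - vnRank (B.map (groupAlgToVN Γ))|)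
        Filter.atTop (nhds 0) := by
      intro p q B
      refine (tendsto_zero_iff_abs_tendsto_zero _).1 ?_
      rw [Metric.tendsto_nhds]
      intro ε hε
      obtain ⟨N, hN⟩ := h.exists_uniform hG hZ B hε
      filter_upwards [hl N] with k hk
      rw [Real.dist_0_eq_abs]
      exact hN _ (ρ k) (l k) (hρ k) hk
    have hle' := fun k =>
      have := (hρ k).finiteDimensional
      have := nontrivial_of_isIrreducible (hρ k).irreducible
      hle (W k) ((ρ k).comp Γ.subtype)
    constructor
    · rw [tendsto_iff_dist_tendsto_zero]
      refine squeeze_zero (fun k => dist_nonneg) (fun k => (hle' k).1) ?_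
      simpa using ((hrank (antiTranspose E)).add (hrank (antiTranspose D))).add
        (hrank (antiTranspose A))
    · rw [tendsto_iff_dist_tendsto_zero]
      refine squeeze_zero (fun k => dist_nonneg) (fun k => (hle' k).2) ?_
      simpa using ((hrank E).add (hrank D)).add (hrank A)
  · obtain ⟨r, s, t, E, D, A, hle⟩ := exists_matrices_abs_sub_le Γ hFP hi
    obtain ⟨c1, h1⟩ := h.exists_uniform hG hZ (antiTranspose E)
    obtain ⟨c2, h2⟩ := h.exists_uniform hG hZ (antiTranspose D)
    obtain ⟨c3, h3⟩ := h.exists_uniform hG hZ (antiTranspose A)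
    obtain ⟨c4, h4⟩ := h.exists_uniform hG hZ E
    obtain ⟨c5, h5⟩ := h.exists_uniform hG hZ D
    obtain ⟨c6, h6⟩ := h.exists_uniform hG hZ A
    refine ⟨max (c1 + c2 + c3) (c4 + c5 + c6), fun W _ _ ρ l hρ N hN hl => ?_⟩
    have := hρ.finiteDimensional
    have := nontrivial_of_isIrreducible hρ.irreducible
    obtain ⟨hh, hc⟩ := hle W (ρ.comp Γ.subtype)
    constructor
    · refine (hh.trans (add_le_add (add_le_add (h1 W ρ l hρ N hN hl) (h2 W ρ l hρ N hN hl))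
        (h3 W ρ l hρ N hN hl))).trans ?_
      rw [← add_div, ← add_div]
      gcongr
      exact le_max_left _ _
    · refine (hc.trans (add_le_add (add_le_add (h4 W ρ l hρ N hN hl) (h5 W ρ l hρ N hN hl))
        (h6 W ρ l hρ N hN hl))).trans ?_
      rw [← add_div, ← add_div]
      gcongr
      exact le_max_right _ _
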